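/- **Definitions.** Let $[a,b]$ be a compact interval, $a<b$, in $\mathbb R$ or in the extended real line $[-\infty,\infty]$. A continuous map $f:[a,b]\to[a,b]$ is *countably piecewise monotone and Markov* with respect to $P\subset[a,b]$ if $P$ is closed and countable, $a,b\in P$, $f(P)\subset P$, and $f$ is monotone on every component of $[a,b]\setminus P$ (these components are the *basic intervals*). It has *constant slope* $\lambda$ if, for some such $P$, it is affine with slope of absolute value $\lambda$ on each basic interval. The *transition matrix* $T$ of $(f,P)$ is indexed by the basic intervals: $T_{IJ}=1$ if $f(I)\supseteq J$ and $T_{IJ}=0$ otherwise. A *nonnegative eigenvector* with eigenvalue $\lambda\in\mathbb R$ is a nonzero vector $v\ge 0$ with $\sum_J T_{IJ}v_J=\lambda v_I$ (a convergent sum) for all $I$. For a vertex $u$ of the transition graph of $T$ let $p^{(n)}_{uu}$ be the number of loops of length $n$ at $u$, and $f^{(n)}_{uu}$ the number of those that do not visit $u$ at an intermediate time. The chain has *Perron value* $\lambda_M$ if $\lim_n (p^{(n)}_{uu})^{1/n}=\lambda_M$ for every $u$; a transitive chain with Perron value $\lambda_M$ is *strongly positive recurrent* if $\limsup_n (f^{(n)}_{uu})^{1/n}<\lambda_M$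 for some $u$. **Statement.** The polynomial $\lambda^3-2\lambda^2-\lambda-2$ has exactly one real root $\lambda_{\min}$. There is a topologically mixing continuous map $f:[0,1]\to[0,1]$, countably piecewise monotone and Markov with respect to a set $P$, of the following form. Its basic intervals are $A_i,B_i,C_i$ $(i\ge 0)$ and $D$, ordered from left to right as $$D<C_0<C_1<C_2<\cdots<B_2<A_2<B_1<A_1<B_0<A_0 ,$$ of lengths proportional, with total length $1$, to $$|A_i|:\ (\lambda_{\min}^2+1)\lambda_{\min}^{-i},\quad |B_i|:\ (\lambda_{\min}^2-1)\lambda_{\min}^{-i},\quad |C_i|:\ (\lambda_{\min}^3-\lambda_{\min}^2-\lambda_{\min}-1)\lambda_{\min}^{-i},\quad |D|:\ (\lambda_{\min}^3-\lambda_{\min}^2-\lambda_{\min}-1)\lambda_{\min};$$ $f$ is affine with slope $+\lambda_{\min}$ on each $A_i$ and $C_i$, and with slope $-\lambda_{\min}$ on each $B_i$ and on $D$; and the basic intervals covered by the images are: by $f(D)$ all of them; by $f(C_0)$ only $D$; by $f(C_i)$, $i\ge1$, only $C_{i-1}$; by $f(A_i)$ the $A_j,B_j$ with $j\ge i+1$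 and the $C_j$ with $j\ge i$; by $f(B_i)$ the $A_j,B_j$ with $j\ge i+2$ and the $C_j$ with $j\ge i$. For this $f$, with transition matrix $T$ of $(f,P)$: 1. Every nonnegative eigenvector of $T$ has a finite sum of entries, and for real $\lambda$ a nonnegative eigenvector of $T$ with eigenvalue $\lambda$ exists if and only if $\lambda\ge\lambda_{\min}$. 2. For every $\lambda\ge\lambda_{\min}$, $f$ is topologically conjugate to a continuous countably piecewise monotone Markov map $g:[0,1]\to[0,1]$ of constant slope $\lambda$. 3. $f$ is not topologically conjugate to any continuous countably piecewise monotone Markov map of constant slope (whatever the slope) on the extended real line $[-\infty,\infty]$ or on an extended half-line $[a,\infty]$ or $[-\infty,b]$. 4. The topological entropy of $f$ is $h_{\mathrm{top}}(f)=\log\lambda_{\min}$. 5. The Markov chain of $T$ has Perron value $\lambda_{\min}$ and is strongly positive recurrent. -/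

import Mathlib

open Set Filter Topology
open scoped ENNReal

/-! ### Countably piecewise monotone Markov maps -/

/-- The `P`-basic intervals: the connected components of the complement of `P`. -/
def IsBasicInterval {X : Type*} [TopologicalSpace X] (P J : Set X) : Prop :=
  ∃ x ∈ Pᶜ, J = connectedComponentIn Pᶜ x

/-- The type of all `P`-basic intervals. -/
def BasicInterval {X : Type*} [TopologicalSpace X] (P : Set X) : Type _ :=
  {J : Set X // IsBasicInterval P J}

/-- `f` is a continuous self-map of the nondegenerate closed interval `[a, b]` (of the real line,
or of the extended real line) which is countably piecewise monotone and Markov with respect to the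
partition set `P`. -/
structure IsCPMM {E : Type*} [LinearOrder E] [TopologicalSpace E] {a b : E}
    (f : Icc a b → Icc a b) (P : Set (Icc a b)) : Prop where
  lt : a < b
  continuous : Continuous f
  isClosed : IsClosed P
  countable : P.Countable
  left_mem : ∀ x : Icc a b, (x : E) = a → x ∈ P
  right_mem : ∀ x : Icc a b, (x : E) = b → x ∈ P
  mapsTo : MapsTo f P P
  monotone : ∀ J, IsBasicInterval P J → MonotoneOn f J ∨ AntitoneOn f J

/-- On every `P`-basic interval the map `f` of the real interval `[a, b]` is affine with slope of
absolute value `l`. -/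
def HasConstantSlope {a b : ℝ} (f : Icc a b → Icc a b) (P : Set (Icc a b)) (l : ℝ) : Prop :=
  ∀ J, IsBasicInterval P J →
    ∃ s c : ℝ, |s| = l ∧ ∀ x ∈ J, (f x : ℝ) = s * (x : ℝ) + c

/-- The same for a map of an interval `[a, b]` of the extended real line. When `a, b ∈ P`, all
points of a `P`-basic interval are finite, i.e. of the form `t : ℝ`. -/
def HasConstantSlopeExt {a b : EReal} (f : Icc a b → Icc a b) (P : Set (Icc a b)) (l : ℝ) : Prop :=
  ∀ J, IsBasicInterval P J →
    ∃ s c : ℝ, |s| = l ∧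
      ∀ x ∈ J, ∀ t : ℝ, (x : EReal) = (t : EReal) → (f x : EReal) = ((s * t + c : ℝ) : EReal)

/-- Topological mixing. -/
def IsTopMixing {X : Type*} [TopologicalSpace X] (f : X → X) : Prop :=
  ∀ U V : Set X, IsOpen U → IsOpen V → U.Nonempty → V.Nonempty →
    ∃ n₀ : ℕ, ∀ n ≥ n₀, (f^[n] '' U ∩ V).Nonempty

/-- Topological conjugacy. -/
def IsConjugateTo {X Y : Type*} [TopologicalSpace X] [TopologicalSpace Y]
    (f : X → X) (g : Y → Y) : Prop :=
  ∃ ψ : X ≃ₜ Y, ∀ x, ψ (f x) = g (ψ x)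

/-! ### The transition matrix and its Markov chain -/

open Classical in
/-- The transition matrix: `T I J = 1` if `f(I) ⊇ J`, and `T I J = 0` otherwise. -/
noncomputable def transitionMatrix {X : Type*} [TopologicalSpace X] (f : X → X) (P : Set X) :
    Matrix (BasicInterval P) (BasicInterval P) ℝ :=
  fun I J => if J.1 ⊆ f '' I.1 then 1 else 0

/-- `v` is a nonnegative (nonzero) eigenvector of `T` with eigenvalue `l`. -/
def IsNonnegEigenvector {V : Type*} (T : Matrix V V ℝ) (l : ℝ) (v : V → ℝ) : Prop :=
  (∀ I, 0 ≤ v I) ∧ v ≠ 0 ∧ ∀ I, HasSum (fun J => T I J * v J) (l * v I)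

/-- The paths of length `n` from `u` to `w` in the transition graph of the 0-1 matrix `T`. -/
def pathSet {V : Type*} (T : Matrix V V ℝ) (n : ℕ) (u w : V) : Set (Fin (n + 1) → V) :=
  {p | p 0 = u ∧ p (Fin.last n) = w ∧ ∀ i : Fin n, T (p i.castSucc) (p i.succ) = 1}

/-- The number of loops of length `n` that start and end at `u`. -/
noncomputable def loopCount {V : Type*} (T : Matrix V V ℝ) (u : V) (n : ℕ) : ℕ∞ :=
  (pathSet T n u u).encard

/-- The number of those loops of length `n` at `u` that do not visit `u` at any intermediate
time. -/
noncomputable def firstReturnCount {V : Type*} (T : Matrix V V ℝ) (u : V) (n : ℕ) : ℕ∞ :=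
  {p ∈ pathSet T n u u | ∀ i : Fin (n + 1), i ≠ 0 → i ≠ Fin.last n → p i ≠ u}.encard

/-- The chain has Perron value `L`: the numbers of loops satisfy `(p_uu^(n))^(1/n) → L`, for every
vertex `u`. -/
def HasPerronValue {V : Type*} (T : Matrix V V ℝ) (L : ℝ≥0∞) : Prop :=
  ∀ u, Tendsto (fun n : ℕ => (loopCount T u n : ℝ≥0∞) ^ (1 / (n : ℝ))) atTop (𝓝 L)

/-- The exponential growth rate of the numbers of first return loops at `u`. -/
noncomputable def firstReturnRate {V : Type*} (T : Matrix V V ℝ) (u : V) : ℝ≥0∞ :=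
  limsup (fun n : ℕ => (firstReturnCount T u n : ℝ≥0∞) ^ (1 / (n : ℝ))) atTop

/-- Every vertex can be reached from every vertex. -/
def IsTransitiveChain {V : Type*} (T : Matrix V V ℝ) : Prop :=
  ∀ u w, ∃ n, 1 ≤ n ∧ (pathSet T n u w).Nonempty

/-- Strong positive recurrence of a transitive chain: for some vertex the first return loops grow
at a strictly smaller exponential rate than all loops do. -/
def IsStronglyPositiveRecurrent {V : Type*} (T : Matrix V V ℝ) : Prop :=
  IsTransitiveChain T ∧ ∃ L : ℝ≥0∞, HasPerronValue T L ∧ ∃ u, firstReturnRate T u < L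

/-! ### The combinatorics and the geometry of the example -/

/-- Names for the basic intervals of the example. -/
inductive Cell : Type
  | A (i : ℕ) : Cell
  | B (i : ℕ) : Cell
  | C (i : ℕ) : Cell
  | D : Cell

/-- The order of the intervals from left to right:
`D < C₀ < C₁ < C₂ < ⋯ < B₂ < A₂ < B₁ < A₁ < B₀ < A₀`. -/
def Cell.LeftOf : Cell → Cell → Prop
  | .D, .D => False
  | .D, _ => True
  | .C _, .D => False
  | .C i, .C j => i < j
  | .C _, .A _ => True
  | .C _, .B _ => True
  | .A i, .A j => j < i
  | .A i, .B j => j < i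
  | .B i, .A j => j ≤ i
  | .B i, .B j => j < i
  | .A _, .C _ => False
  | .A _, .D => False
  | .B _, .C _ => False
  | .B _, .D => False

/-- The Markov dynamics: `Cell.Covers X Y` says that the image of `X` covers `Y`. -/
def Cell.Covers : Cell → Cell → Prop
  | .D, _ => True
  | .C 0, Y => Y = .D
  | .C (i + 1), Y => Y = .C i
  | .A i, .A j => i + 1 ≤ j
  | .A i, .B j => i + 1 ≤ j
  | .A i, .C j => i ≤ j
  | .A _, .D => False
  | .B i, .A j => i + 2 ≤ j
  | .B i, .B j => i + 2 ≤ j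
  | .B i, .C j => i ≤ j
  | .B _, .D => False

/-- The lengths of the intervals up to a common factor; their sum is
`l ^ 2 * (l ^ 3 - l ^ 2 - l - 1)` when `l ^ 3 - 2 * l ^ 2 - l - 2 = 0`. -/
noncomputable def Cell.weight (l : ℝ) : Cell → ℝ
  | .A i => (l ^ 2 + 1) / l ^ i
  | .B i => (l ^ 2 - 1) / l ^ i
  | .C i => (l ^ 3 - l ^ 2 - l - 1) / l ^ i
  | .D => (l ^ 3 - l ^ 2 - l - 1) * l

/-- `f` is the map of the example on `[0, 1]`: its `P`-basic intervals are `K X`, `X : Cell`, in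
the prescribed order and with the prescribed lengths (scaled to total length one), `f` follows the
prescribed Markov dynamics, increases on the intervals `A`, `C`, decreases on the intervals
`B`, `D`, and is affine with slope `± l` on each of them. -/
structure IsExampleMap (l : ℝ) (f : Icc (0 : ℝ) 1 → Icc (0 : ℝ) 1) (P : Set (Icc (0 : ℝ) 1))
    (K : Cell → Set (Icc (0 : ℝ) 1)) : Prop where
  isCPMM : IsCPMM f P
  basic : ∀ J, IsBasicInterval P J ↔ ∃ X, J = K X
  order : ∀ X Y, X.LeftOf Y → ∀ x ∈ K X, ∀ y ∈ K Y, x < y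
  length : ∀ X, Metric.diam (K X) = X.weight l / (l ^ 2 * (l ^ 3 - l ^ 2 - l - 1))
  covers : ∀ X Y, K Y ⊆ f '' K X ↔ X.Covers Y
  strictMono_A : ∀ i, StrictMonoOn f (K (.A i))
  strictMono_C : ∀ i, StrictMonoOn f (K (.C i))
  strictAnti_B : ∀ i, StrictAntiOn f (K (.B i))
  strictAnti_D : StrictAntiOn f (K .D)
  slope : HasConstantSlope f P l

/-! ### Partition points and models of the Markov dynamics -/

/-! The example is treated as one member of a family of maps with the same combinatorics. How the
endpoints of the cells move is fixed once and for all by `Pt.step`. A `Model` of slope `l` is a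
choice of positions of these endpoints in `[0, 1]` for which the image of each cell is `l` times as
long as the cell.

The equations of a model can be solved. The left points are `(1 - l⁻¹ ^ n) / (l - 1)`. Eliminating
the odd right points leaves a second order recurrence for the distances from the right ends of the
`A i` to the accumulation point. Its decaying solutions are `coeff l * l⁻¹ ^ i + c * root l ^ i`,
and total length one forces `c` to be `l ^ 3 - 2 * l ^ 2 - l - 2` divided by a positive cubic. If `c
≥ 0`, all lengths are positive, so `Model.ofSlope` exists for every `l ≥ lmin`. At `lmin` the second
term vanishes and the lengths are those prescribed.

Any two models are conjugate (`Model.isConjugateTo`). A monotone matching of their partition points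
is lifted repeatedly through the dynamics. Inverse branches contract by `1 / l`, so the lifts
converge to a map that commutes with the dynamics, and the same contraction shows that such maps in
opposite directions are mutually inverse.

Growth rates come from test vectors. The cell lengths form a right eigenvector and bound path counts
from above by `lmin ^ n`. A finite truncation of a left eigenvector bounds them from below
(`exists_le_pathCount`). This gives the Perron value, the bound `lmin ≤ l` for eigenvalues and,
through horseshoes made of loops at `D`, the entropy from below; the Lipschitz constant gives it
from above. The length vector for slope `2` satisfies every eigenvalue equation except the one at
`D`, so first returns to `D` grow at most like `2 ^ n`, and `2 < lmin`. The image of `D` covers all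
cells, so the equation at `D` already sums the whole eigenvector.

For an infinite interval, a conjugacy would give `C 0` finite length. As `C 0` covers `D` and `D`
covers everything, two steps of bounded slope would make the whole line bounded. -/

/-- Names for the points of the partition set: `left n` increases and `right n` decreases to
`mid`. -/
inductive Pt : Type
  | left (n : ℕ) : Pt
  | mid : Pt
  | right (n : ℕ) : Pt

namespace Pt

/-- The order of the partition points. -/
def Le : Pt → Pt → Prop
  | left i, left j => i ≤ j
  | left _, mid => True
  | left _, right _ => True
  | mid, left _ => False
  | mid, mid => True
  | mid, right _ => True
  | right _, left _ => False
  | right _, mid => False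
  | right i, right j => j ≤ i

/-- The dynamics on the partition points. -/
def step : Pt → Pt
  | left 0 => right 0
  | left (n + 1) => left n
  | mid => mid
  | right n => if Even n then right (n + 2) else left ((n + 1) / 2)

@[simp] lemma step_right_even (i : ℕ) : step (right (2 * i)) = right (2 * i + 2) := by
  simp [step]

@[simp] lemma step_right_odd (i : ℕ) : step (right (2 * i + 1)) = left (i + 1) := by
  have : ¬ Even (2 * i + 1) := by simp
  simp only [step, this, if_false]
  congr 1; omega

@[simp] lemma step_left_zero : step (left 0) = right 0 := rfl

@[simp] lemma step_left_succ (n : ℕ) : step (left (n + 1)) = left n := rfl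

@[simp] lemma step_mid : step mid = mid := rfl

end Pt

namespace Cell

/-- The left endpoint of a cell. -/
def lo : Cell → Pt
  | A i => .right (2 * i + 1)
  | B i => .right (2 * i + 2)
  | C i => .left (i + 1)
  | D => .left 0

/-- The right endpoint of a cell. -/
def hi : Cell → Pt
  | A i => .right (2 * i)
  | B i => .right (2 * i + 1)
  | C i => .left (i + 2)
  | D => .left 1

/-- The sign of the slope on a cell. -/
def sign : Cell → ℝ
  | A _ => 1
  | B _ => -1
  | C _ => 1
  | D => -1

lemma sign_eq (X : Cell) : X.sign = 1 ∨ X.sign = -1 := by cases X <;> simp [sign]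

lemma abs_sign (X : Cell) : |X.sign| = 1 := by cases X <;> simp [sign]

lemma sign_mul_sign (X : Cell) : X.sign * X.sign = 1 := by cases X <;> simp [sign]

lemma exists_left (n : ℕ) : ∃ X : Cell, X.lo = .left n ∧ X.hi = .left (n + 1) := by
  cases n with
  | zero => exact ⟨D, rfl, rfl⟩
  | succ n => exact ⟨C n, rfl, rfl⟩

lemma exists_right (n : ℕ) : ∃ X : Cell, X.lo = .right (n + 1) ∧ X.hi = .right n := by
  obtain ⟨k, rfl | rfl⟩ := Nat.even_or_odd' n
  · exact ⟨A k, rfl, rfl⟩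
  · exact ⟨B k, rfl, rfl⟩

lemma leftOf_or_eq_or_leftOf (X Y : Cell) : X.LeftOf Y ∨ X = Y ∨ Y.LeftOf X := by
  cases X <;> cases Y <;> simp [LeftOf] <;> omega

lemma LeftOf.hi_le_lo {X Y : Cell} (h : X.LeftOf Y) : X.hi.Le Y.lo := by
  cases X <;> cases Y <;> simp [LeftOf, hi, lo, Pt.Le] at * <;> omega

lemma le_lo_or_hi_le (t : Pt) (X : Cell) : t.Le X.lo ∨ X.hi.Le t := by
  cases X <;> cases t <;> simp [hi, lo, Pt.Le] <;> omega

instance : Countable Cell :=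
  Function.Injective.countable (β := ℕ × ℕ)
    (f := fun X => match X with | A i => (0, i) | B i => (1, i) | C i => (2, i) | D => (3, 0)) (by
      intro X Y h
      cases X <;> cases Y <;> simp_all)

end Cell

/-- Positions of the partition points on the real line. -/
structure Grid where
  /-- positions of the partition points to the left of `mid` -/
  left : ℕ → ℝ
  /-- position of the accumulation point -/
  mid : ℝ
  /-- positions of the partition points to the right of `mid` -/
  right : ℕ → ℝ
  left_strictMono : StrictMono left
  right_strictAnti : StrictAnti right
  left_tendsto : Tendsto left atTop (𝓝 mid)
  right_tendsto : Tendsto right atTop (𝓝 mid)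

/-- Positions of the partition points in `[0, 1]` that are compatible with a map of constant slope
`l` following the Markov dynamics of the example. -/
structure Model extends Grid where
  /-- the absolute value of the slope -/
  l : ℝ
  one_lt : 1 < l
  left_zero : left 0 = 0
  right_zero : right 0 = 1
  slope_D : l * left 1 = 1
  slope_C : ∀ i, l * (left (i + 2) - left (i + 1)) = left (i + 1) - left i
  slope_A : ∀ i, l * (right (2 * i) - right (2 * i + 1)) = right (2 * i + 2) - left (i + 1)
  slope_B : ∀ i, l * (right (2 * i + 1) - right (2 * i + 2)) = right (2 * i + 4) - left (i + 1)

namespace Grid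

variable (M : Grid)

/-- The position of a partition point. -/
def pos : Pt → ℝ
  | .left n => M.left n
  | .mid => M.mid
  | .right n => M.right n

lemma left_lt_mid (n : ℕ) : M.left n < M.mid :=
  (M.left_strictMono n.lt_succ_self).trans_le
    (M.left_strictMono.monotone.ge_of_tendsto M.left_tendsto _)

lemma mid_lt_right (n : ℕ) : M.mid < M.right n :=
  (M.right_strictAnti.antitone.le_of_tendsto M.right_tendsto _).trans_lt
    (M.right_strictAnti n.lt_succ_self)

lemma left_lt_right (m n : ℕ) : M.left m < M.right n := (M.left_lt_mid m).trans (M.mid_lt_right n)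

lemma pos_le_pos {s t : Pt} : M.pos s ≤ M.pos t ↔ s.Le t := by
  cases s <;> cases t <;>
    simp [pos, Pt.Le, M.left_strictMono.le_iff_le, M.right_strictAnti.le_iff_ge,
      (M.left_lt_mid _).le, (M.mid_lt_right _).le, (M.left_lt_right _ _).le, M.left_lt_mid,
      M.mid_lt_right, M.left_lt_right]

lemma lo_lt_hi (X : Cell) : M.pos X.lo < M.pos X.hi := by
  rw [← not_le, pos_le_pos]
  cases X <;> simp [Cell.lo, Cell.hi, Pt.Le]

lemma hi_le_lo {X Y : Cell} (h : X.LeftOf Y) : M.pos X.hi ≤ M.pos Y.lo :=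
  M.pos_le_pos.2 h.hi_le_lo

lemma pos_le_lo_or_hi_le_pos (t : Pt) (X : Cell) :
    M.pos t ≤ M.pos X.lo ∨ M.pos X.hi ≤ M.pos t := by
  simpa only [pos_le_pos] using Cell.le_lo_or_hi_le t X

/-- Every point between the extreme partition points is a partition point or lies in an open
cell. -/
lemma exists_pos_or_mem_Ioo {x : ℝ} (hx : x ∈ Icc (M.left 0) (M.right 0)) :
    (∃ t, x = M.pos t) ∨ ∃ X : Cell, x ∈ Ioo (M.pos X.lo) (M.pos X.hi) := by
  rcases lt_trichotomy x M.mid with h | h | h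
  · have hex : ∃ n, x < M.left n := (M.left_tendsto.eventually (lt_mem_nhds h)).exists
    classical
    have h0 : Nat.find hex ≠ 0 := by
      intro h0
      have := Nat.find_spec hex
      rw [h0] at this
      exact absurd hx.1 (not_le.2 this)
    obtain ⟨n, hn⟩ := Nat.exists_eq_succ_of_ne_zero h0
    have h1 : x < M.left (n + 1) := by simpa [hn] using Nat.find_spec hex
    have h2 : M.left n ≤ x := not_lt.1 (Nat.find_min hex (by omega))
    rcases h2.eq_or_lt with h2 | h2
    · exact Or.inl ⟨.left n, h2.symm⟩
    · obtain ⟨X, hX, hX'⟩ := Cell.exists_left n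
      exact Or.inr ⟨X, by rw [hX, hX']; exact ⟨h2, h1⟩⟩
  · exact Or.inl ⟨.mid, h⟩
  · have hex : ∃ n, M.right n < x := (M.right_tendsto.eventually (gt_mem_nhds h)).exists
    classical
    have h0 : Nat.find hex ≠ 0 := by
      intro h0
      have := Nat.find_spec hex
      rw [h0] at this
      exact absurd hx.2 (not_le.2 this)
    obtain ⟨n, hn⟩ := Nat.exists_eq_succ_of_ne_zero h0
    have h1 : M.right (n + 1) < x := by simpa [hn] using Nat.find_spec hex
    have h2 : x ≤ M.right n := not_lt.1 (Nat.find_min hex (by omega))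
    rcases h2.eq_or_lt with h2 | h2
    · exact Or.inl ⟨.right n, h2⟩
    · obtain ⟨X, hX, hX'⟩ := Cell.exists_right n
      exact Or.inr ⟨X, by rw [hX, hX']; exact ⟨h1, h2⟩⟩

lemma eq_of_mem_Ioc {X Y : Cell} {t : ℝ} (hX : t ∈ Ioc (M.pos X.lo) (M.pos X.hi))
    (hY : t ∈ Ioc (M.pos Y.lo) (M.pos Y.hi)) : X = Y := by
  rcases X.leftOf_or_eq_or_leftOf Y with h | h | h
  · exact absurd (M.hi_le_lo h) (not_le.2 (hY.1.trans_le hX.2))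
  · exact h
  · exact absurd (M.hi_le_lo h) (not_le.2 (hX.1.trans_le hY.2))

end Grid

/-! ### The piecewise affine map of a model -/

namespace Model

variable (M : Model)

lemma l_pos : 0 < M.l := by linarith [M.one_lt]

lemma pos_nonneg (t : Pt) : 0 ≤ M.pos t := by
  rw [← M.left_zero]; exact (M.pos_le_pos (s := .left 0)).2 (by cases t <;> simp [Pt.Le])

lemma pos_le_one (t : Pt) : M.pos t ≤ 1 := by
  rw [← M.right_zero]; exact (M.pos_le_pos (t := .right 0)).2 (by cases t <;> simp [Pt.Le])

lemma pos_mem (t : Pt) : M.pos t ∈ Icc (0 : ℝ) 1 := ⟨M.pos_nonneg t, M.pos_le_one t⟩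

lemma slope_eq (X : Cell) :
    X.sign * M.l * (M.pos X.hi - M.pos X.lo) = M.pos X.hi.step - M.pos X.lo.step := by
  cases X with
  | A i => simpa [Cell.sign, Cell.hi, Cell.lo, Grid.pos] using M.slope_A i
  | B i =>
    have := M.slope_B i
    have h : Pt.step (.right (2 * i + 2)) = .right (2 * i + 4) := Pt.step_right_even (i + 1)
    simp only [Cell.sign, Cell.hi, Cell.lo, Grid.pos, h, Pt.step_right_odd]
    linarith
  | C i => simpa [Cell.sign, Cell.hi, Cell.lo, Grid.pos] using M.slope_C i
  | D =>
    have := M.slope_D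
    simp [Cell.sign, Cell.hi, Cell.lo, Grid.pos, M.left_zero, M.right_zero]
    linarith

/-- Every point of `[0, 1]` is a partition point or lies in an open cell. -/
lemma exists_pos_or_mem_Ioo {x : ℝ} (hx : x ∈ Icc (0 : ℝ) 1) :
    (∃ t, x = M.pos t) ∨ ∃ X : Cell, x ∈ Ioo (M.pos X.lo) (M.pos X.hi) :=
  M.toGrid.exists_pos_or_mem_Ioo (by rwa [M.left_zero, M.right_zero])

open Classical in
/-- The sign of the slope of the map of the model. -/
noncomputable def sig (t : ℝ) : ℝ :=
  if ∃ X : Cell, X.sign = -1 ∧ t ∈ Ioc (M.pos X.lo) (M.pos X.hi) then -1 else 1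

lemma abs_sig (t : ℝ) : |M.sig t| = 1 := by
  unfold sig; split_ifs <;> simp

lemma measurable_sig : Measurable M.sig := by
  classical
  refine Measurable.ite ?_ measurable_const measurable_const
  have : {t | ∃ X : Cell, X.sign = -1 ∧ t ∈ Ioc (M.pos X.lo) (M.pos X.hi)}
      = ⋃ X : {X : Cell // X.sign = -1}, Ioc (M.pos X.1.lo) (M.pos X.1.hi) := by
    ext t; simp [and_left_comm]
  rw [this]
  exact MeasurableSet.iUnion fun _ => measurableSet_Ioc

lemma sig_eq {X : Cell} {t : ℝ} (ht : t ∈ Ioc (M.pos X.lo) (M.pos X.hi)) :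
    M.sig t = X.sign := by
  unfold sig
  split_ifs with h
  · obtain ⟨Y, hY, hY'⟩ := h
    rw [M.eq_of_mem_Ioc ht hY', hY]
  · rcases X.sign_eq with h' | h'
    · exact h'.symm
    · exact absurd ⟨X, h', ht⟩ h

lemma intervalIntegrable_sig (a b : ℝ) : IntervalIntegrable M.sig MeasureTheory.volume a b := by
  refine (intervalIntegrable_const (c := (1 : ℝ))).mono_fun
    M.measurable_sig.aestronglyMeasurable (Eventually.of_forall fun t => ?_)
  simp [M.abs_sig]

/-- The map of the model, as a function on the real line. -/
noncomputable def map (x : ℝ) : ℝ := 1 + M.l * ∫ t in (0 : ℝ)..x, M.sig t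

lemma map_sub_map (x y : ℝ) : M.map y - M.map x = M.l * ∫ t in x..y, M.sig t := by
  have := intervalIntegral.integral_interval_sub_left (M.intervalIntegrable_sig 0 y)
    (M.intervalIntegrable_sig 0 x)
  rw [← this]; unfold map; ring

lemma abs_map_sub_map_le (x y : ℝ) : |M.map y - M.map x| ≤ M.l * |y - x| := by
  rw [map_sub_map, abs_mul, abs_of_pos M.l_pos]
  refine mul_le_mul_of_nonneg_left ?_ M.l_pos.le
  have := intervalIntegral.norm_integral_le_of_norm_le_const (f := M.sig) (a := x) (b := y) (C := 1)
    (fun t _ => by simp [M.abs_sig])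
  simpa using this

lemma continuous_map : Continuous M.map := by
  have : LipschitzWith (Real.toNNReal M.l) M.map :=
    LipschitzWith.of_dist_le_mul fun x y => by
      rw [Real.coe_toNNReal _ M.l_pos.le, Real.dist_eq, Real.dist_eq]
      exact M.abs_map_sub_map_le y x
  exact this.continuous

/-- On a closed cell the map is affine. -/
lemma map_sub_map_of_mem {X : Cell} {x y : ℝ} (hx : x ∈ Icc (M.pos X.lo) (M.pos X.hi))
    (hy : y ∈ Icc (M.pos X.lo) (M.pos X.hi)) :
    M.map y - M.map x = X.sign * M.l * (y - x) := by
  rw [map_sub_map]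
  have : ∫ t in x..y, M.sig t = ∫ _ in x..y, X.sign := by
    refine intervalIntegral.integral_congr_ae (Eventually.of_forall fun t ht => M.sig_eq ?_)
    rw [mem_uIoc] at ht
    rcases ht with ht | ht
    · exact ⟨hx.1.trans_lt ht.1, ht.2.trans hy.2⟩
    · exact ⟨hy.1.trans_lt ht.1, ht.2.trans hx.2⟩
  rw [this]; simp; ring

/-- The deviation of `map` from `step` is the same at both ends of a cell, so it propagates between
neighbouring partition points. -/
lemma map_pos_sub (X : Cell) :
    M.map (M.pos X.hi) - M.pos X.hi.step = M.map (M.pos X.lo) - M.pos X.lo.step := by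
  have h1 := M.map_sub_map_of_mem (left_mem_Icc.2 (M.lo_lt_hi X).le)
    (right_mem_Icc.2 (M.lo_lt_hi X).le)
  rw [M.slope_eq] at h1
  linarith

lemma map_left (n : ℕ) : M.map (M.left n) = M.pos (Pt.step (.left n)) := by
  induction n with
  | zero => simp [M.left_zero, map, Grid.pos, M.right_zero]
  | succ n ih =>
    obtain ⟨X, h1, h2⟩ := Cell.exists_left n
    have := M.map_pos_sub X
    rw [h1, h2] at this
    change M.map (M.left (n + 1)) - _ = M.map (M.left n) - _ at this
    rw [ih] at this
    linarith

lemma map_mid : M.map M.mid = M.mid := by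
  have h1 : Tendsto (fun n => M.map (M.left (n + 1))) atTop (𝓝 (M.map M.mid)) :=
    (M.continuous_map.tendsto _).comp ((tendsto_add_atTop_iff_nat 1).2 M.left_tendsto)
  have h2 : (fun n => M.map (M.left (n + 1))) = M.left := by
    funext n; rw [M.map_left]; rfl
  rw [h2] at h1
  exact tendsto_nhds_unique h1 M.left_tendsto

/-- No finite chain of cells joins the left points to the right ones. Neighbouring cells only show
that the deviation is constant on the right; it is zero because, along the even points, it tends to
its value at the fixed point `mid`. -/
lemma map_right (n : ℕ) : M.map (M.right n) = M.pos (Pt.step (.right n)) := by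
  have hc : ∀ n, M.map (M.right n) - M.pos (Pt.step (.right n))
      = M.map (M.right 0) - M.pos (Pt.step (.right 0)) := by
    intro n
    induction n with
    | zero => rfl
    | succ n ih =>
      obtain ⟨X, h1, h2⟩ := Cell.exists_right n
      have := M.map_pos_sub X
      rw [h1, h2] at this
      rw [← ih]; exact this.symm
  have h2 : Tendsto (fun i : ℕ => 2 * i) atTop atTop :=
    tendsto_id.const_mul_atTop' (by norm_num)
  have h3 : Tendsto (fun i : ℕ => M.right (2 * i)) atTop (𝓝 M.mid) := M.right_tendsto.comp h2
  have h4 : Tendsto (fun i : ℕ => M.right (2 * i + 2)) atTop (𝓝 M.mid) :=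
    ((tendsto_add_atTop_iff_nat 2).2 M.right_tendsto).comp h2
  have h5 : Tendsto (fun i : ℕ => M.map (M.right (2 * i)) - M.right (2 * i + 2)) atTop
      (𝓝 (M.map M.mid - M.mid)) := ((M.continuous_map.tendsto _).comp h3).sub h4
  have h6 : (fun i : ℕ => M.map (M.right (2 * i)) - M.right (2 * i + 2))
      = fun _ => M.map (M.right 0) - M.pos (Pt.step (.right 0)) := by
    funext i; rw [← hc (2 * i), Pt.step_right_even]; rfl
  rw [h6] at h5
  have h7 := tendsto_nhds_unique tendsto_const_nhds h5
  have := hc n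
  rw [h7, M.map_mid] at this
  linarith

@[simp] lemma map_pos (t : Pt) : M.map (M.pos t) = M.pos t.step := by
  cases t with
  | left n => exact M.map_left n
  | mid => exact M.map_mid
  | right n => exact M.map_right n

lemma map_mem {x : ℝ} (hx : x ∈ Icc (0 : ℝ) 1) : M.map x ∈ Icc (0 : ℝ) 1 := by
  rcases M.exists_pos_or_mem_Ioo hx with ⟨t, rfl⟩ | ⟨X, hX⟩
  · rw [map_pos]; exact M.pos_mem _
  · have hX' := Ioo_subset_Icc_self hX
    have h1 := M.map_sub_map_of_mem (left_mem_Icc.2 (M.lo_lt_hi X).le) hX'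
    have h2 := M.map_sub_map_of_mem hX' (right_mem_Icc.2 (M.lo_lt_hi X).le)
    rw [map_pos] at h1 h2
    have h3 := M.pos_mem X.lo.step
    have h4 := M.pos_mem X.hi.step
    have h5 : 0 < M.l * (x - M.pos X.lo) := mul_pos M.l_pos (sub_pos.2 hX.1)
    have h6 : 0 < M.l * (M.pos X.hi - x) := mul_pos M.l_pos (sub_pos.2 hX.2)
    rcases X.sign_eq with h | h <;> rw [h] at h1 h2 <;>
      exact ⟨by linarith [h3.1, h4.1], by linarith [h3.2, h4.2]⟩

end Model

/-! ### Images of cells and the Markov partition -/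

namespace Cell

/-- The left endpoint of the image of a cell. -/
def imLo : Cell → Pt
  | A i => .left (i + 1)
  | B i => .left (i + 1)
  | C i => .left i
  | D => .left 0

/-- The right endpoint of the image of a cell. -/
def imHi : Cell → Pt
  | A i => .right (2 * i + 2)
  | B i => .right (2 * i + 4)
  | C i => .left (i + 1)
  | D => .right 0

lemma step_lo_hi (X : Cell) :
    (X.sign = 1 ∧ X.lo.step = X.imLo ∧ X.hi.step = X.imHi) ∨
      (X.sign = -1 ∧ X.lo.step = X.imHi ∧ X.hi.step = X.imLo) := by
  cases X with
  | A i => exact Or.inl ⟨rfl, by simp [lo, imLo], by simp [hi, imHi]⟩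
  | B i =>
    exact Or.inr ⟨rfl, Pt.step_right_even (i + 1), by simp [hi, imLo]⟩
  | C i => exact Or.inl ⟨rfl, rfl, rfl⟩
  | D => exact Or.inr ⟨rfl, rfl, rfl⟩

lemma covers_iff (X Y : Cell) : X.Covers Y ↔ X.imLo.Le Y.lo ∧ Y.hi.Le X.imHi := by
  cases X with
  | C i => cases i <;> cases Y <;> simp [Covers, imLo, imHi, lo, hi, Pt.Le] <;> omega
  | _ => cases Y <;> simp [Covers, imLo, imHi, lo, hi, Pt.Le] <;> omega

/-- The Markov property: the ends of an image are partition points, so an image cannot cut a cell.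
-/
lemma not_covers_iff {X Y : Cell} : ¬ X.Covers Y ↔ Y.hi.Le X.imLo ∨ X.imHi.Le Y.lo := by
  cases X with
  | C i => cases i <;> cases Y <;> simp [Covers, imLo, imHi, lo, hi, Pt.Le]
  | _ => cases Y <;> simp [Covers, imLo, imHi, lo, hi, Pt.Le] <;> omega

end Cell

namespace Model

variable (M : Model)

/-- The distance of image points in a closed cell is multiplied by `l`. -/
lemma abs_map_sub_map_of_mem {X : Cell} {x y : ℝ} (hx : x ∈ Icc (M.pos X.lo) (M.pos X.hi))
    (hy : y ∈ Icc (M.pos X.lo) (M.pos X.hi)) :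
    |M.map y - M.map x| = M.l * |y - x| := by
  rw [M.map_sub_map_of_mem hx hy, abs_mul, abs_mul, X.abs_sign, one_mul, abs_of_pos M.l_pos]

lemma map_injOn (X : Cell) : InjOn M.map (Icc (M.pos X.lo) (M.pos X.hi)) := by
  intro x hx y hy h
  have := M.abs_map_sub_map_of_mem hx hy
  rw [h, sub_self, abs_zero] at this
  have := (mul_eq_zero.1 this.symm).resolve_left M.l_pos.ne'
  rw [abs_eq_zero] at this
  linarith

lemma map_image_Icc (X : Cell) :
    M.map '' Icc (M.pos X.lo) (M.pos X.hi) = Icc (M.pos X.imLo) (M.pos X.imHi) := by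
  have hlo := left_mem_Icc.2 (M.lo_lt_hi X).le
  have hse := M.slope_eq X
  have hl := M.l_pos
  apply Subset.antisymm
  · rintro _ ⟨x, hx, rfl⟩
    have h1 := M.map_sub_map_of_mem hlo hx
    have h5 : 0 ≤ M.l * (x - M.pos X.lo) := mul_nonneg hl.le (sub_nonneg.2 hx.1)
    have h6 : 0 ≤ M.l * (M.pos X.hi - x) := mul_nonneg hl.le (sub_nonneg.2 hx.2)
    rw [map_pos] at h1
    rcases X.step_lo_hi with ⟨h, h3, h4⟩ | ⟨h, h3, h4⟩ <;> rw [h3] at h1 <;>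
      rw [h3, h4] at hse <;> rw [h] at h1 hse <;> constructor <;> linarith
  · intro z hz
    have hm : M.pos X.lo + X.sign * (z - M.pos X.lo.step) / M.l
        ∈ Icc (M.pos X.lo) (M.pos X.hi) := by
      have key : X.sign * (z - M.pos X.lo.step) ∈ Icc 0 (M.l * (M.pos X.hi - M.pos X.lo)) := by
        rcases X.step_lo_hi with ⟨h, h3, h4⟩ | ⟨h, h3, h4⟩ <;> rw [h3] <;>
          rw [h3, h4] at hse <;> rw [h] at hse ⊢ <;> constructor <;> linarith [hz.1, hz.2]
      constructor
      · have := div_nonneg key.1 hl.le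
        linarith
      · have : X.sign * (z - M.pos X.lo.step) / M.l ≤ M.pos X.hi - M.pos X.lo := by
          rw [div_le_iff₀ hl]; linarith [key.2]
        linarith
    refine ⟨_, hm, ?_⟩
    have h1 := M.map_sub_map_of_mem hlo hm
    rw [map_pos, add_sub_cancel_left, mul_assoc, mul_div_cancel₀ _ hl.ne', ← mul_assoc,
      X.sign_mul_sign] at h1
    linarith

lemma map_image_Ioo (X : Cell) :
    M.map '' Ioo (M.pos X.lo) (M.pos X.hi) = Ioo (M.pos X.imLo) (M.pos X.imHi) := by
  have hlo := left_mem_Icc.2 (M.lo_lt_hi X).le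
  have hhi := right_mem_Icc.2 (M.lo_lt_hi X).le
  have hends : (M.map (M.pos X.lo) = M.pos X.imLo ∧ M.map (M.pos X.hi) = M.pos X.imHi) ∨
      (M.map (M.pos X.lo) = M.pos X.imHi ∧ M.map (M.pos X.hi) = M.pos X.imLo) := by
    rw [map_pos, map_pos]
    rcases X.step_lo_hi with ⟨-, h3, h4⟩ | ⟨-, h3, h4⟩ <;> simp [h3, h4]
  rw [← Icc_sdiff_both, (M.map_injOn X).image_sdiff_subset
    (by rintro x (rfl | rfl) <;> assumption), map_image_Icc, image_pair, ← Icc_sdiff_both]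
  rcases hends with ⟨h1, h2⟩ | ⟨h1, h2⟩ <;> rw [h1, h2]
  rw [pair_comm]

/-- The map of the model, as a self-map of `[0, 1]`. -/
noncomputable def f (x : Icc (0 : ℝ) 1) : Icc (0 : ℝ) 1 := ⟨M.map x, M.map_mem x.2⟩

@[simp] lemma coe_f (x : Icc (0 : ℝ) 1) : (M.f x : ℝ) = M.map x := rfl

lemma continuous_f : Continuous M.f :=
  Continuous.subtype_mk (M.continuous_map.comp continuous_subtype_val) _

/-- The open cells. -/
def cell (X : Cell) : Set (Icc (0 : ℝ) 1) := {x | (x : ℝ) ∈ Ioo (M.pos X.lo) (M.pos X.hi)}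

/-- The partition set. -/
def part : Set (Icc (0 : ℝ) 1) := (⋃ X, M.cell X)ᶜ

lemma isOpen_cell (X : Cell) : IsOpen (M.cell X) := isOpen_Ioo.preimage continuous_subtype_val

lemma isClosed_part : IsClosed M.part := (isOpen_iUnion M.isOpen_cell).isClosed_compl

lemma mem_Icc_of_mem_Icc {X : Cell} {x : ℝ} (hx : x ∈ Icc (M.pos X.lo) (M.pos X.hi)) :
    x ∈ Icc (0 : ℝ) 1 :=
  ⟨(M.pos_nonneg _).trans hx.1, hx.2.trans (M.pos_le_one _)⟩

lemma val_image_cell (X : Cell) :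
    (Subtype.val '' M.cell X : Set ℝ) = Ioo (M.pos X.lo) (M.pos X.hi) := by
  ext x
  constructor
  · rintro ⟨y, hy, rfl⟩; exact hy
  · intro hx
    exact ⟨⟨x, M.mem_Icc_of_mem_Icc (Ioo_subset_Icc_self hx)⟩, hx, rfl⟩

lemma cell_nonempty (X : Cell) : (M.cell X).Nonempty := by
  rw [← image_nonempty (f := Subtype.val), val_image_cell, nonempty_Ioo]
  exact M.lo_lt_hi X

lemma eq_of_mem_cell {X Y : Cell} {x : Icc (0 : ℝ) 1} (hX : x ∈ M.cell X) (hY : x ∈ M.cell Y) :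
    X = Y :=
  M.eq_of_mem_Ioc (Ioo_subset_Ioc_self hX) (Ioo_subset_Ioc_self hY)

lemma cell_injective : Function.Injective M.cell := by
  intro X Y h
  obtain ⟨x, hx⟩ := M.cell_nonempty X
  exact M.eq_of_mem_cell hx (h ▸ hx)

lemma mem_part_iff {x : Icc (0 : ℝ) 1} : x ∈ M.part ↔ ∃ t, (x : ℝ) = M.pos t := by
  constructor
  · intro hx
    rcases M.exists_pos_or_mem_Ioo x.2 with h | ⟨X, hX⟩
    · exact h
    · exact absurd (mem_iUnion.2 ⟨X, hX⟩) hx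
  · rintro ⟨t, ht⟩ hx
    obtain ⟨X, hX⟩ := mem_iUnion.1 hx
    have h := hX.1
    have h' := hX.2
    rw [ht] at h h'
    rcases M.pos_le_lo_or_hi_le_pos t X with h1 | h1 <;> linarith

lemma notMem_part_iff {x : Icc (0 : ℝ) 1} : x ∉ M.part ↔ ∃ X, x ∈ M.cell X := by
  simp [part]

lemma notMem_part_of_mem_cell {X : Cell} {x : Icc (0 : ℝ) 1} (hx : x ∈ M.cell X) : x ∉ M.part :=
  M.notMem_part_iff.2 ⟨X, hx⟩

lemma countable_part : M.part.Countable := by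
  have : Countable Pt := Function.Injective.countable (β := ℕ × ℕ)
    (f := fun t => match t with | .left i => (0, i) | .mid => (1, 0) | .right i => (2, i)) (by
      intro X Y h
      cases X <;> cases Y <;> simp_all)
  refine ((countable_range M.pos).preimage_of_injOn
    (Subtype.val_injective (p := fun x => x ∈ Icc (0 : ℝ) 1)).injOn).mono ?_
  intro x hx
  obtain ⟨t, ht⟩ := M.mem_part_iff.1 hx
  exact ⟨t, ht.symm⟩

lemma mapsTo_part : MapsTo M.f M.part M.part := by
  intro x hx
  obtain ⟨t, ht⟩ := M.mem_part_iff.1 hx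
  exact M.mem_part_iff.2 ⟨t.step, by rw [coe_f, ht, map_pos]⟩

lemma ordConnected_cell (X : Cell) : (M.cell X).OrdConnected :=
  ⟨fun _ hx _ hy _ hz => ⟨hx.1.trans_le hz.1, lt_of_le_of_lt hz.2 hy.2⟩⟩

/-- A component is order convex, so one that left the cell would contain an endpoint of it, which is
a partition point. -/
lemma connectedComponentIn_eq {X : Cell} {x : Icc (0 : ℝ) 1} (hx : x ∈ M.cell X) :
    connectedComponentIn M.partᶜ x = M.cell X := by
  apply Subset.antisymm
  · have hc : (connectedComponentIn M.partᶜ x).OrdConnected :=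
      isPreconnected_connectedComponentIn.ordConnected
    have hxm : x ∈ connectedComponentIn M.partᶜ x :=
      mem_connectedComponentIn (M.notMem_part_of_mem_cell hx)
    have hnot : ∀ t, (⟨M.pos t, M.pos_mem t⟩ : Icc (0 : ℝ) 1) ∉ connectedComponentIn M.partᶜ x :=
      fun t ht => connectedComponentIn_subset _ _ ht (M.mem_part_iff.2 ⟨t, rfl⟩)
    intro y hy
    constructor
    · by_contra! h
      exact hnot X.lo (hc.out hy hxm ⟨h, hx.1.le⟩)
    · by_contra! h
      exact hnot X.hi (hc.out hxm hy ⟨hx.2.le, h⟩)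
  · exact (M.ordConnected_cell X).isPreconnected.subset_connectedComponentIn hx
      fun y hy => M.notMem_part_of_mem_cell hy

lemma isBasicInterval_iff (J : Set (Icc (0 : ℝ) 1)) :
    IsBasicInterval M.part J ↔ ∃ X, J = M.cell X := by
  constructor
  · rintro ⟨x, hx, rfl⟩
    obtain ⟨X, hX⟩ := M.notMem_part_iff.1 hx
    exact ⟨X, M.connectedComponentIn_eq hX⟩
  · rintro ⟨X, rfl⟩
    obtain ⟨x, hx⟩ := M.cell_nonempty X
    exact ⟨x, M.notMem_part_of_mem_cell hx, (M.connectedComponentIn_eq hx).symm⟩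

lemma strictMonoOn_cell {X : Cell} (h : X.sign = 1) : StrictMonoOn M.f (M.cell X) := by
  intro x hx y hy hxy
  have := M.map_sub_map_of_mem (Ioo_subset_Icc_self hx) (Ioo_subset_Icc_self hy)
  rw [h, one_mul] at this
  have h2 : 0 < M.l * ((y : ℝ) - x) := mul_pos M.l_pos (sub_pos.2 hxy)
  exact Subtype.coe_lt_coe.1 (by rw [coe_f, coe_f]; linarith)

lemma strictAntiOn_cell {X : Cell} (h : X.sign = -1) : StrictAntiOn M.f (M.cell X) := by
  intro x hx y hy hxy
  have := M.map_sub_map_of_mem (Ioo_subset_Icc_self hx) (Ioo_subset_Icc_self hy)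
  rw [h] at this
  have h2 : 0 < M.l * ((y : ℝ) - x) := mul_pos M.l_pos (sub_pos.2 hxy)
  exact Subtype.coe_lt_coe.1 (by rw [coe_f, coe_f]; linarith)

lemma isCPMM : IsCPMM M.f M.part where
  lt := zero_lt_one
  continuous := M.continuous_f
  isClosed := M.isClosed_part
  countable := M.countable_part
  left_mem x hx := M.mem_part_iff.2 ⟨.left 0, by rw [hx]; exact M.left_zero.symm⟩
  right_mem x hx := M.mem_part_iff.2 ⟨.right 0, by rw [hx]; exact M.right_zero.symm⟩
  mapsTo := M.mapsTo_part
  monotone J hJ := by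
    obtain ⟨X, rfl⟩ := (M.isBasicInterval_iff J).1 hJ
    rcases X.sign_eq with h | h
    · exact Or.inl (M.strictMonoOn_cell h).monotoneOn
    · exact Or.inr (M.strictAntiOn_cell h).antitoneOn

lemma hasConstantSlope : HasConstantSlope M.f M.part M.l := by
  intro J hJ
  obtain ⟨X, rfl⟩ := (M.isBasicInterval_iff J).1 hJ
  refine ⟨X.sign * M.l, M.map (M.pos X.lo) - X.sign * M.l * M.pos X.lo, ?_, fun x hx => ?_⟩
  · rw [abs_mul, X.abs_sign, one_mul, abs_of_pos M.l_pos]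
  · have := M.map_sub_map_of_mem (left_mem_Icc.2 (M.lo_lt_hi X).le) (Ioo_subset_Icc_self hx)
    rw [coe_f]; linarith

lemma diam_cell (X : Cell) : Metric.diam (M.cell X) = M.pos X.hi - M.pos X.lo := by
  rw [← isometry_subtype_coe.diam_image, val_image_cell, Real.diam_Ioo (M.lo_lt_hi X).le]

lemma cell_lt {X Y : Cell} (h : X.LeftOf Y) : ∀ x ∈ M.cell X, ∀ y ∈ M.cell Y, x < y :=
  fun _ hx _ hy => Subtype.coe_lt_coe.1 ((hx.2.trans_le (M.hi_le_lo h)).trans hy.1)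

lemma val_image_f_cell (X : Cell) :
    (Subtype.val '' (M.f '' M.cell X) : Set ℝ) = Ioo (M.pos X.imLo) (M.pos X.imHi) := by
  rw [← map_image_Ioo, ← val_image_cell, image_image, image_image]; rfl

lemma cell_subset_image_iff (X Y : Cell) : M.cell Y ⊆ M.f '' M.cell X ↔ X.Covers Y := by
  rw [← image_subset_image_iff (Subtype.val_injective (p := fun x => x ∈ Icc (0 : ℝ) 1)),
    val_image_f_cell, val_image_cell, Ioo_subset_Ioo_iff (M.lo_lt_hi Y), M.pos_le_pos, M.pos_le_pos,
    Cell.covers_iff]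

lemma covers_of_mem {X Y : Cell} {x : Icc (0 : ℝ) 1} (hx : x ∈ M.cell X)
    (hy : M.f x ∈ M.cell Y) : X.Covers Y := by
  by_contra h
  have hm : M.map x ∈ Ioo (M.pos X.imLo) (M.pos X.imHi) := by
    rw [← map_image_Ioo]; exact mem_image_of_mem _ hx
  have h1 := hy.1
  have h2 := hy.2
  rw [coe_f] at h1 h2
  rcases Cell.not_covers_iff.1 h with h | h <;> have := M.pos_le_pos.2 h
  · linarith [hm.1]
  · linarith [hm.2]

end Model

/-! ### Any two models are conjugate -/

namespace Model

/-- A monotone map of `[0, 1]` taking the partition points of `M` to those of `N`. -/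
structure Matching (M N : Model) (ψ : ℝ → ℝ) : Prop where
  mono : MonotoneOn ψ (Icc 0 1)
  pos : ∀ t, ψ (M.pos t) = N.pos t

variable {M N : Model}

namespace Matching

variable {ψ : ℝ → ℝ}

lemma mem_Icc (h : Matching M N ψ) {x : ℝ} {s t : Pt} (hx : x ∈ Icc (M.pos s) (M.pos t)) :
    ψ x ∈ Icc (N.pos s) (N.pos t) := by
  have hx' : x ∈ Icc (0 : ℝ) 1 := ⟨(M.pos_nonneg s).trans hx.1, hx.2.trans (M.pos_le_one t)⟩
  rw [← h.pos, ← h.pos]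
  exact ⟨h.mono (M.pos_mem s) hx' hx.1, h.mono hx' (M.pos_mem t) hx.2⟩

lemma mapsTo (h : Matching M N ψ) {x : ℝ} (hx : x ∈ Icc (0 : ℝ) 1) : ψ x ∈ Icc (0 : ℝ) 1 := by
  have := h.mem_Icc (s := .left 0) (t := .right 0) (x := x)
  simpa only [Grid.pos, M.left_zero, M.right_zero, N.left_zero, N.right_zero] using
    this (by simpa only [Grid.pos, M.left_zero, M.right_zero] using hx)

lemma comp {K : Model} {φ : ℝ → ℝ} (hφ : Matching N K φ) (hψ : Matching M N ψ) :
    Matching M K (φ ∘ ψ) where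
  mono := hφ.mono.comp hψ.mono fun _ hx => hψ.mapsTo hx
  pos t := by simp [hψ.pos, hφ.pos]

end Matching

/-- A step function suffices: `x` goes to the supremum of the positions in `N` of the partition
points that are at most `x` in `M`. Continuity plays no role for the starting point of the
iteration. -/
lemma exists_matching (M N : Model) : ∃ ψ, Matching M N ψ := by
  let S : ℝ → Set ℝ := fun x => {y | ∃ t, M.pos t ≤ x ∧ y = N.pos t}
  have hbdd : ∀ x, BddAbove (S x) := fun x => ⟨1, by rintro _ ⟨t, -, rfl⟩; exact N.pos_le_one t⟩
  refine ⟨fun x => sSup (S x), ?_, fun s => ?_⟩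
  · intro x hx y _ hxy
    refine csSup_le_csSup (hbdd y) ⟨N.pos (.left 0), .left 0, ?_, rfl⟩ ?_
    · exact M.left_zero.trans_le hx.1
    · rintro _ ⟨t, ht, rfl⟩; exact ⟨t, ht.trans hxy, rfl⟩
  · refine IsGreatest.csSup_eq ⟨⟨s, le_rfl, rfl⟩, ?_⟩
    rintro _ ⟨t, ht, rfl⟩
    exact N.pos_le_pos.2 (M.pos_le_pos.1 ht)

/-- Here `y` is the value of the inverse branch of `N.map` on the corresponding cell. The
comparisons with all partition points record which cell or point `y` belongs to without naming it.
-/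
lemma exists_lift_point {ψ : ℝ → ℝ} (h : Matching M N ψ) {x : ℝ}
    (hx : x ∈ Icc (0 : ℝ) 1) :
    ∃ y, (∀ t, x ≤ M.pos t → y ≤ N.pos t) ∧ (∀ t, M.pos t ≤ x → N.pos t ≤ y) ∧
      N.map y = ψ (M.map x) := by
  rcases M.exists_pos_or_mem_Ioo hx with ⟨s, rfl⟩ | ⟨X, hX⟩
  · refine ⟨N.pos s, fun t ht => ?_, fun t ht => ?_, ?_⟩
    · exact N.pos_le_pos.2 (M.pos_le_pos.1 ht)
    · exact N.pos_le_pos.2 (M.pos_le_pos.1 ht)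
    · rw [map_pos, map_pos, h.pos]
  · have h1 : M.map x ∈ Icc (M.pos X.imLo) (M.pos X.imHi) := by
      rw [← map_image_Icc]; exact mem_image_of_mem _ (Ioo_subset_Icc_self hX)
    have h2 := h.mem_Icc h1
    rw [← map_image_Icc] at h2
    obtain ⟨y, hy, hy'⟩ := h2
    refine ⟨y, fun t ht => ?_, fun t ht => ?_, hy'⟩
    · rcases M.pos_le_lo_or_hi_le_pos t X with h3 | h3
      · linarith [hX.1]
      · exact hy.2.trans (N.pos_le_pos.2 (M.pos_le_pos.1 h3))
    · rcases M.pos_le_lo_or_hi_le_pos t X with h3 | h3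
      · exact (N.pos_le_pos.2 (M.pos_le_pos.1 h3)).trans hy.1
      · linarith [hX.2]

/-- Any matching map can be lifted through the two dynamics to a matching map. -/
lemma Matching.exists_lift {ψ : ℝ → ℝ} (h : Matching M N ψ) :
    ∃ ψ', Matching M N ψ' ∧ ∀ x ∈ Icc (0 : ℝ) 1, N.map (ψ' x) = ψ (M.map x) := by
  choose! ψ' h1 h2 h3 using fun x (hx : x ∈ Icc (0 : ℝ) 1) => exists_lift_point h hx
  refine ⟨ψ', ⟨?_, fun t => ?_⟩, h3⟩
  · intro x hx y hy hxy
    -- A partition point between `x` and `y` also separates their lifts. Otherwise both points lie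
    -- in one cell, on which the two maps have slopes of the same sign.
    by_cases hsep : ∃ t, x ≤ M.pos t ∧ M.pos t ≤ y
    · obtain ⟨t, ht, ht'⟩ := hsep
      exact (h1 x hx t ht).trans (h2 y hy t ht')
    push Not at hsep
    rcases M.exists_pos_or_mem_Ioo hx with ⟨s, rfl⟩ | ⟨X, hX⟩
    · exact absurd hxy (not_le.2 (hsep s le_rfl))
    have hyX : y < M.pos X.hi := hsep _ hX.2.le
    have hX' := Ioo_subset_Icc_self hX
    have hY' : y ∈ Icc (M.pos X.lo) (M.pos X.hi) := ⟨hX.1.le.trans hxy, hyX.le⟩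
    have m1 : ψ' x ∈ Icc (N.pos X.lo) (N.pos X.hi) := ⟨h2 x hx _ hX'.1, h1 x hx _ hX'.2⟩
    have m2 : ψ' y ∈ Icc (N.pos X.lo) (N.pos X.hi) := ⟨h2 y hy _ hY'.1, h1 y hy _ hY'.2⟩
    have e1 := M.map_sub_map_of_mem hX' hY'
    have e2 := N.map_sub_map_of_mem m1 m2
    rw [h3 x hx, h3 y hy] at e2
    have e3 : 0 ≤ M.l * (y - x) := mul_nonneg M.l_pos.le (sub_nonneg.2 hxy)
    have e4 : 0 ≤ N.l * (ψ' y - ψ' x) := by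
      rcases X.sign_eq with hs | hs <;> rw [hs] at e1 e2
      · have := h.mono (M.map_mem hx) (M.map_mem hy) (by linarith)
        linarith
      · have := h.mono (M.map_mem hy) (M.map_mem hx) (by linarith)
        linarith
    linarith [nonneg_of_mul_nonneg_right e4 N.l_pos]
  · exact le_antisymm (h1 _ (M.pos_mem t) t le_rfl) (h2 _ (M.pos_mem t) t le_rfl)

/-- Both values lie in the same closed cell of `N`, where `N.map` expands distances by exactly
`N.l`. This is the contraction behind existence and uniqueness of the conjugacy. -/
lemma Matching.abs_sub_le {ψ φ : ℝ → ℝ} (hψ : Matching M N ψ) (hφ : Matching M N φ) {ε : ℝ}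
    (hε : 0 ≤ ε) {x : ℝ} (hx : x ∈ Icc (0 : ℝ) 1) (h : |N.map (ψ x) - N.map (φ x)| ≤ ε) :
    |ψ x - φ x| ≤ ε / N.l := by
  rcases M.exists_pos_or_mem_Ioo hx with ⟨t, rfl⟩ | ⟨X, hX⟩
  · rw [hψ.pos, hφ.pos, sub_self, abs_zero]
    exact div_nonneg hε N.l_pos.le
  · have hX' := Ioo_subset_Icc_self hX
    rw [N.abs_map_sub_map_of_mem (hφ.mem_Icc hX') (hψ.mem_Icc hX')] at h
    rw [le_div_iff₀ N.l_pos]; linarith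

/-- Successive lifts differ by at most `(1 / N.l) ^ n`, hence converge. The limit commutes with the
dynamics by continuity of `N.map` alone; the lifts themselves need not be continuous. -/
lemma exists_semiconj (M N : Model) :
    ∃ ψ, Matching M N ψ ∧ ∀ x ∈ Icc (0 : ℝ) 1, N.map (ψ x) = ψ (M.map x) := by
  choose L hL hL' using fun p : {ψ // Matching M N ψ} => p.2.exists_lift
  obtain ⟨ψ₀, h₀⟩ := exists_matching M N
  let Ψ : ℕ → {ψ // Matching M N ψ} := fun n => (fun p => ⟨L p, hL p⟩)^[n] ⟨ψ₀, h₀⟩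
  have hΨ : ∀ n, ∀ x ∈ Icc (0 : ℝ) 1, N.map ((Ψ (n + 1)).1 x) = (Ψ n).1 (M.map x) := by
    intro n x hx
    have : Ψ (n + 1) = ⟨L (Ψ n), hL (Ψ n)⟩ := Function.iterate_succ_apply' _ _ _
    rw [this]; exact hL' _ x hx
  have hdist : ∀ n, ∀ x ∈ Icc (0 : ℝ) 1,
      |(Ψ n).1 x - (Ψ (n + 1)).1 x| ≤ 1 * (1 / N.l) ^ n := by
    intro n
    induction n with
    | zero =>
      intro x hx
      have h1 := (Ψ 0).2.mapsTo hx
      have h2 := (Ψ 1).2.mapsTo hx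
      simp only [pow_zero, mul_one]
      rw [abs_sub_le_iff]
      constructor <;> linarith [h1.1, h1.2, h2.1, h2.2]
    | succ n ih =>
      intro x hx
      have h0 : 0 ≤ 1 * (1 / N.l) ^ n := by have := N.l_pos; positivity
      have := (Ψ (n + 1)).2.abs_sub_le (Ψ (n + 2)).2 h0 hx
        (by rw [hΨ n x hx, hΨ (n + 1) x hx]; exact ih _ (M.map_mem hx))
      rwa [pow_succ, mul_one_div, ← mul_div_assoc]
  have hlt : 1 / N.l < 1 := by rw [div_lt_one N.l_pos]; exact N.one_lt
  have hlim : ∀ x ∈ Icc (0 : ℝ) 1, ∃ y, Tendsto (fun n => (Ψ n).1 x) atTop (𝓝 y) :=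
    fun x hx => cauchySeq_tendsto_of_complete
      (cauchySeq_of_le_geometric _ 1 hlt fun n => hdist n x hx)
  choose! ψ hψ using hlim
  refine ⟨ψ, ⟨fun x hx y hy hxy => ?_, fun t => ?_⟩, fun x hx => ?_⟩
  · exact le_of_tendsto_of_tendsto' (hψ x hx) (hψ y hy) fun n => (Ψ n).2.mono hx hy hxy
  · refine tendsto_nhds_unique (hψ _ (M.pos_mem t)) ?_
    simp only [(Ψ _).2.pos]
    exact tendsto_const_nhds
  · have h1 : Tendsto (fun n => N.map ((Ψ (n + 1)).1 x)) atTop (𝓝 (N.map (ψ x))) :=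
      (N.continuous_map.tendsto _).comp ((tendsto_add_atTop_iff_nat 1).2 (hψ x hx))
    simp only [hΨ _ x hx] at h1
    exact tendsto_nhds_unique h1 (hψ _ (M.map_mem hx))

/-- A matching map that commutes with the dynamics is the identity. -/
lemma Matching.eq_self {χ : ℝ → ℝ} (h : Matching M M χ)
    (hc : ∀ x ∈ Icc (0 : ℝ) 1, M.map (χ x) = χ (M.map x)) {x : ℝ} (hx : x ∈ Icc (0 : ℝ) 1) :
    χ x = x := by
  have hid : Matching M M id := ⟨monotoneOn_id, fun _ => rfl⟩
  have key : ∀ n : ℕ, ∀ x ∈ Icc (0 : ℝ) 1, |χ x - x| ≤ (1 / M.l) ^ n := by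
    intro n
    induction n with
    | zero =>
      intro x hx
      have h1 := h.mapsTo hx
      rw [pow_zero, abs_sub_le_iff]
      constructor <;> linarith [h1.1, h1.2, hx.1, hx.2]
    | succ n ih =>
      intro x hx
      have h0 : 0 ≤ (1 / M.l) ^ n := by have := M.l_pos; positivity
      have := h.abs_sub_le hid h0 hx (by rw [hc x hx]; exact ih _ (M.map_mem hx))
      rwa [pow_succ, mul_one_div]
  have hlt : 1 / M.l < 1 := by rw [div_lt_one M.l_pos]; exact M.one_lt
  have hlim := tendsto_pow_atTop_nhds_zero_of_lt_one (one_div_nonneg.2 M.l_pos.le) hlt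
  have := ge_of_tendsto' hlim fun n => key n x hx
  linarith [abs_nonpos_iff.1 this]

/-- The semiconjugacies in the two directions compose to self-matchings that commute with the
dynamics, hence to identities. A monotone bijection with monotone inverse is automatically a
homeomorphism. -/
theorem isConjugateTo (M N : Model) : IsConjugateTo M.f N.f := by
  obtain ⟨ψ, hψ, hψc⟩ := exists_semiconj M N
  obtain ⟨φ, hφ, hφc⟩ := exists_semiconj N M
  let e : Icc (0 : ℝ) 1 ≃ Icc (0 : ℝ) 1 :=
    { toFun := fun x => ⟨ψ x, hψ.mapsTo x.2⟩
      invFun := fun x => ⟨φ x, hφ.mapsTo x.2⟩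
      left_inv := fun x => Subtype.ext <| (hφ.comp hψ).eq_self (fun y hy => by
        simp [hφc _ (hψ.mapsTo hy), hψc y hy]) x.2
      right_inv := fun x => Subtype.ext <| (hψ.comp hφ).eq_self (fun y hy => by
        simp [hψc _ (hφ.mapsTo hy), hφc y hy]) x.2 }
  have h1 : Monotone e := fun x y hxy => hψ.mono x.2 y.2 hxy
  have h2 : Monotone e.symm := fun x y hxy => hφ.mono x.2 y.2 hxy
  refine ⟨(e.toOrderIso h1 h2).toHomeomorph, fun x => Subtype.ext ?_⟩
  exact (hψc x x.2).symm

end Model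

/-! ### The slopes `l` for which a model exists -/

lemma two_lt_of_poly_nonneg {l : ℝ} (h : 0 ≤ l ^ 3 - 2 * l ^ 2 - l - 2) : 2 < l := by
  by_contra! hl
  have h1 : l ^ 3 - 2 * l ^ 2 - l - 2 = l ^ 2 * (l - 2) - (l + 2) := by ring
  rcases le_or_gt l (-2) with h2 | h2
  · nlinarith [mul_nonneg (sq_nonneg l) (sub_nonneg.2 hl), sq_nonneg (l + 2)]
  · nlinarith [mul_nonneg (sq_nonneg l) (sub_nonneg.2 hl)]

lemma poly_le_poly_iff {x y : ℝ} (hx : 2 < x) (hy : 2 < y) :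
    x ^ 3 - 2 * x ^ 2 - x - 2 ≤ y ^ 3 - 2 * y ^ 2 - y - 2 ↔ x ≤ y := by
  have hf : 0 < x ^ 2 + x * y + y ^ 2 - 2 * (x + y) - 1 := by nlinarith
  have : y ^ 3 - 2 * y ^ 2 - y - 2 - (x ^ 3 - 2 * x ^ 2 - x - 2)
      = (y - x) * (x ^ 2 + x * y + y ^ 2 - 2 * (x + y) - 1) := by ring
  rw [← sub_nonneg, this, mul_nonneg_iff_of_pos_right hf, sub_nonneg]

lemma exists_root : ∃ l : ℝ, l ^ 3 - 2 * l ^ 2 - l - 2 = 0 := by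
  have := intermediate_value_Icc (a := (2 : ℝ)) (b := 3) (by norm_num)
    (f := fun l : ℝ => l ^ 3 - 2 * l ^ 2 - l - 2) (by fun_prop)
  obtain ⟨l, -, hl⟩ := this (show (0 : ℝ) ∈ _ by constructor <;> norm_num)
  exact ⟨l, hl⟩

lemma poly_eq_zero_iff {l : ℝ} (hl : l ^ 3 - 2 * l ^ 2 - l - 2 = 0) (x : ℝ) :
    x ^ 3 - 2 * x ^ 2 - x - 2 = 0 ↔ x = l := by
  constructor
  · intro hx
    have h1 := two_lt_of_poly_nonneg hl.ge
    have h2 := two_lt_of_poly_nonneg hx.ge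
    exact le_antisymm ((poly_le_poly_iff h2 h1).1 (by rw [hl, hx]))
      ((poly_le_poly_iff h1 h2).1 (by rw [hl, hx]))
  · rintro rfl; exact hl

lemma poly_nonneg_of_le {l x : ℝ} (hl : l ^ 3 - 2 * l ^ 2 - l - 2 = 0) (hx : l ≤ x) :
    0 ≤ x ^ 3 - 2 * x ^ 2 - x - 2 := by
  have h1 := two_lt_of_poly_nonneg hl.ge
  rw [← hl]
  exact (poly_le_poly_iff h1 (h1.trans_le hx)).2 hx

lemma cubic_pos {l : ℝ} (hl : 2 < l) : 0 < l ^ 3 - l ^ 2 - l - 1 := by nlinarith [sq_nonneg (l - 2)]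

namespace OfSlope

variable (l : ℝ)

/-- The positive root of `x ^ 2 + (1 + l) * x = l`. -/
noncomputable def root : ℝ := (√((1 + l) ^ 2 + 4 * l) - (1 + l)) / 2

/-- The coefficient of `l⁻¹ ^ i` in the distance from the right end of `A i` to `mid`. -/
noncomputable def coeff : ℝ := 2 * l / ((l - 1) * (l ^ 3 - l ^ 2 - l - 1))

/-- The coefficient of `root l ^ i` in the distance from the right end of `A i` to `mid`. -/
noncomputable def coeff' : ℝ := (l - 2) / (l - 1) - coeff l

/-- The distance from the right end of `A i` to `mid`. -/
noncomputable def dist (i : ℕ) : ℝ := coeff l * l⁻¹ ^ i + coeff' l * root l ^ i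

/-- The positions of the partition points to the right of `mid`. -/
noncomputable def right (n : ℕ) : ℝ :=
  if Even n then (l - 1)⁻¹ + dist l (n / 2)
  else (l - 1)⁻¹ + dist l (n / 2) - (dist l (n / 2 + 1) + (l - 1)⁻¹ * l⁻¹ ^ (n / 2 + 1)) / l

variable {l}

lemma right_even (i : ℕ) : right l (2 * i) = (l - 1)⁻¹ + dist l i := by
  simp [right]

lemma right_odd (i : ℕ) : right l (2 * i + 1)
    = (l - 1)⁻¹ + dist l i - (dist l (i + 1) + (l - 1)⁻¹ * l⁻¹ ^ (i + 1)) / l := by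
  have h1 : ¬ Even (2 * i + 1) := by simp
  have h2 : (2 * i + 1) / 2 = i := by omega
  simp only [right, h1, if_false, h2]

lemma root_eq (hl : 2 < l) : root l ^ 2 + (1 + l) * root l = l := by
  have := Real.sq_sqrt (show 0 ≤ (1 + l) ^ 2 + 4 * l by positivity)
  unfold root; nlinarith

lemma root_pos (hl : 2 < l) : 0 < root l := by
  have : 1 + l < √((1 + l) ^ 2 + 4 * l) := Real.lt_sqrt_of_sq_lt (by linarith)
  unfold root; linarith

lemma root_lt_one (hl : 2 < l) : root l < 1 := by
  by_contra! h
  nlinarith [root_eq hl]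

lemma coeff_pos (hl : 2 < l) : 0 < coeff l :=
  div_pos (by linarith) (mul_pos (by linarith) (cubic_pos hl))

/-- The polynomial enters here. The value of `coeff'` is dictated by the position of the right end
`1`, and its sign decides whether the lengths stay positive. -/
lemma coeff'_eq (hl : 2 < l) :
    coeff' l = (l ^ 3 - 2 * l ^ 2 - l - 2) / (l ^ 3 - l ^ 2 - l - 1) := by
  have h1 : l - 1 ≠ 0 := by linarith
  have h2 := (cubic_pos hl).ne'
  unfold coeff' coeff
  obtain ⟨q, hq⟩ : ∃ q, q = l ^ 3 - l ^ 2 - l - 1 := ⟨_, rfl⟩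
  rw [← hq] at h2 ⊢
  field_simp
  rw [hq]
  ring

lemma coeff'_nonneg (hl : 2 < l) (h : 0 ≤ l ^ 3 - 2 * l ^ 2 - l - 2) : 0 ≤ coeff' l := by
  rw [coeff'_eq hl]
  exact div_nonneg h (cubic_pos hl).le

lemma dist_pos (hl : 2 < l) (h : 0 ≤ l ^ 3 - 2 * l ^ 2 - l - 2) (i : ℕ) : 0 < dist l i := by
  have h1 := coeff_pos hl
  have h2 := coeff'_nonneg hl h
  have h3 := root_pos hl
  have h4 : 0 < l := by linarith
  unfold dist; positivity

/-- This is the sum of `slope_A` and `slope_B`, from which the odd point drops out. The powers of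
`root l` solve the homogeneous recurrence, and the powers of `l⁻¹` give a particular solution. -/
lemma dist_rec (hl : 2 < l) (i : ℕ) :
    l * dist l i = (1 + l) * dist l (i + 1) + dist l (i + 2)
      + 2 * ((l - 1)⁻¹ * l⁻¹ ^ (i + 1)) := by
  have h1 := root_eq hl
  have h2 : coeff l * (l - (1 + l) * l⁻¹ - l⁻¹ ^ 2) = 2 * (l - 1)⁻¹ * l⁻¹ := by
    have h1 : l - 1 ≠ 0 := by linarith
    have h2 := (cubic_pos hl).ne'
    have h3 : l ≠ 0 := by linarith
    unfold coeff
    obtain ⟨q, hq⟩ : ∃ q, q = l ^ 3 - l ^ 2 - l - 1 := ⟨_, rfl⟩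
    rw [← hq] at h2 ⊢
    field_simp
    rw [hq]
    ring
  have e1 : coeff' l * root l ^ i * (root l ^ 2 + (1 + l) * root l)
      = coeff' l * root l ^ i * l := by rw [h1]
  have e2 := congrArg (· * l⁻¹ ^ i) h2
  simp only [dist, pow_succ, pow_zero, one_mul] at e1 e2 ⊢
  linarith

lemma tendsto_inv_pow (hl : 2 < l) : Tendsto (fun n : ℕ => l⁻¹ ^ n) atTop (𝓝 0) :=
  tendsto_pow_atTop_nhds_zero_of_lt_one (by rw [inv_nonneg]; linarith)
    (inv_lt_one_of_one_lt₀ (by linarith))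

lemma tendsto_dist (hl : 2 < l) : Tendsto (dist l) atTop (𝓝 0) := by
  have h2 := tendsto_pow_atTop_nhds_zero_of_lt_one (root_pos hl).le (root_lt_one hl)
  have := ((tendsto_inv_pow hl).const_mul (coeff l)).add (h2.const_mul (coeff' l))
  simp only [mul_zero, add_zero] at this
  exact this

lemma right_even_sub (i : ℕ) : right l (2 * i) - right l (2 * i + 1)
    = (dist l (i + 1) + (l - 1)⁻¹ * l⁻¹ ^ (i + 1)) / l := by
  rw [right_even, right_odd]; ring

/-- The odd points are defined so that `slope_A` holds; `slope_B` is then the recurrence `dist_rec`.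
-/
lemma right_odd_sub (hl : 2 < l) (i : ℕ) : right l (2 * i + 1) - right l (2 * i + 2)
    = (dist l (i + 2) + (l - 1)⁻¹ * l⁻¹ ^ (i + 1)) / l := by
  rw [show 2 * i + 2 = 2 * (i + 1) by ring, right_even, right_odd, eq_div_iff (by linarith)]
  have h := dist_rec hl i
  have h3 : (dist l (i + 1) + (l - 1)⁻¹ * l⁻¹ ^ (i + 1)) / l * l
      = dist l (i + 1) + (l - 1)⁻¹ * l⁻¹ ^ (i + 1) := div_mul_cancel₀ _ (by linarith)
  linarith

lemma right_strictAnti (hl : 2 < l) (h : 0 ≤ l ^ 3 - 2 * l ^ 2 - l - 2) :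
    StrictAnti (right l) := by
  have hpos : ∀ i, 0 < (l - 1)⁻¹ * l⁻¹ ^ (i + 1) := fun i =>
    mul_pos (inv_pos.2 (by linarith)) (pow_pos (inv_pos.2 (by linarith)) _)
  refine strictAnti_nat_of_succ_lt fun n => ?_
  obtain ⟨i, rfl | rfl⟩ := Nat.even_or_odd' n
  · rw [← sub_pos, right_even_sub]
    exact div_pos (add_pos (dist_pos hl h _) (hpos i)) (by linarith)
  · rw [← sub_pos, right_odd_sub hl]
    exact div_pos (add_pos (dist_pos hl h _) (hpos i)) (by linarith)

lemma tendsto_right (hl : 2 < l) (h : 0 ≤ l ^ 3 - 2 * l ^ 2 - l - 2) :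
    Tendsto (right l) atTop (𝓝 (l - 1)⁻¹) := by
  have h2 : Tendsto (fun i : ℕ => 2 * i) atTop atTop :=
    tendsto_id.const_mul_atTop' (by norm_num)
  refine (tendsto_iff_tendsto_subseq_of_antitone (right_strictAnti hl h).antitone h2).2 ?_
  have := (tendsto_dist hl).const_add (l - 1)⁻¹
  rw [add_zero] at this
  refine this.congr fun i => ?_
  simp [right_even]

end OfSlope

open OfSlope in
/-- The model of slope `l`. -/
noncomputable def Model.ofSlope (l : ℝ) (h : 0 ≤ l ^ 3 - 2 * l ^ 2 - l - 2) : Model where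
  l := l
  left n := (l - 1)⁻¹ * (1 - l⁻¹ ^ n)
  mid := (l - 1)⁻¹
  right := OfSlope.right l
  one_lt := by linarith [two_lt_of_poly_nonneg h]
  left_zero := by simp
  right_zero := by
    have hl := two_lt_of_poly_nonneg h
    have := right_even (l := l) 0
    rw [mul_zero] at this
    rw [this]
    have h1 : l - 1 ≠ 0 := by linarith
    simp only [OfSlope.dist, coeff', pow_zero]
    field_simp
    ring
  left_strictMono := by
    have hl := two_lt_of_poly_nonneg h
    intro m n hmn
    have h1 : l⁻¹ ^ n < l⁻¹ ^ m :=
      pow_lt_pow_right_of_lt_one₀ (inv_pos.2 (by linarith))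
        (inv_lt_one_of_one_lt₀ (by linarith)) hmn
    exact mul_lt_mul_of_pos_left (by linarith) (inv_pos.2 (by linarith))
  right_strictAnti := OfSlope.right_strictAnti (two_lt_of_poly_nonneg h) h
  left_tendsto := by
    have := ((tendsto_inv_pow (two_lt_of_poly_nonneg h)).const_sub 1).const_mul (l - 1)⁻¹
    simpa using this
  right_tendsto := OfSlope.tendsto_right (two_lt_of_poly_nonneg h) h
  slope_D := by
    have hl := two_lt_of_poly_nonneg h
    have h1 : l - 1 ≠ 0 := by linarith
    have h2 : l ≠ 0 := by linarith
    rw [pow_one]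
    field_simp
  slope_C i := by
    have hl := two_lt_of_poly_nonneg h
    have h1 : l * l⁻¹ = 1 := mul_inv_cancel₀ (by linarith)
    simp only [pow_succ]
    linear_combination ((l - 1)⁻¹ * (l⁻¹ ^ i - l⁻¹ ^ i * l⁻¹)) * h1
  slope_A i := by
    have hl := two_lt_of_poly_nonneg h
    rw [right_even_sub, mul_div_cancel₀ _ (by linarith), show 2 * i + 2 = 2 * (i + 1) by ring,
      right_even]
    ring
  slope_B i := by
    have hl := two_lt_of_poly_nonneg h
    rw [right_odd_sub hl, mul_div_cancel₀ _ (by linarith), show 2 * i + 4 = 2 * (i + 2) by ring,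
      right_even]
    ring

-- At the root of the polynomial `coeff'` vanishes, so all lengths become pure powers of `l⁻¹`.
open OfSlope in
lemma Model.ofSlope_length {l : ℝ} (h : l ^ 3 - 2 * l ^ 2 - l - 2 = 0) (X : Cell) :
    (ofSlope l h.ge).pos X.hi - (ofSlope l h.ge).pos X.lo
      = X.weight l / (l ^ 2 * (l ^ 3 - l ^ 2 - l - 1)) := by
  have hl := two_lt_of_poly_nonneg h.ge
  have h1 : l - 1 ≠ 0 := by linarith
  have h2 := (cubic_pos hl).ne'
  have h3 : l ≠ 0 := by linarith
  have hk : coeff' l = 0 := by rw [coeff'_eq hl, h, zero_div]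
  have hd : ∀ i, OfSlope.dist l i = coeff l * l⁻¹ ^ i := by simp [OfSlope.dist, hk]
  obtain ⟨q, hq⟩ : ∃ q, q = l ^ 3 - l ^ 2 - l - 1 := ⟨_, rfl⟩
  rw [← hq] at h2
  simp only [Cell.weight, coeff, ← hq] at hd ⊢
  cases X with
  | A i =>
    simp only [Grid.pos, Cell.hi, Cell.lo, ofSlope, right_even_sub, hd, inv_pow]
    field_simp
    rw [hq]
    ring
  | B i =>
    simp only [Grid.pos, Cell.hi, Cell.lo, ofSlope, right_odd_sub hl, hd, inv_pow]
    field_simp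
    rw [hq]
    ring
  | C i =>
    simp only [Grid.pos, Cell.hi, Cell.lo, ofSlope, inv_pow]
    field_simp
    ring
  | D =>
    simp only [Grid.pos, Cell.hi, Cell.lo, ofSlope, inv_pow]
    field_simp
    ring

lemma Model.ofSlope_isExampleMap {l : ℝ} (h : l ^ 3 - 2 * l ^ 2 - l - 2 = 0) :
    IsExampleMap l (ofSlope l h.ge).f (ofSlope l h.ge).part (ofSlope l h.ge).cell where
  isCPMM := isCPMM _
  basic := isBasicInterval_iff _
  order _ _ hXY := cell_lt _ hXY
  length X := by rw [diam_cell, ofSlope_length h]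
  covers := cell_subset_image_iff _
  strictMono_A _ := strictMonoOn_cell _ rfl
  strictMono_C _ := strictMonoOn_cell _ rfl
  strictAnti_B _ := strictAntiOn_cell _ rfl
  strictAnti_D := strictAntiOn_cell _ rfl
  slope := hasConstantSlope (ofSlope l h.ge)

/-! ### Counting paths of 0-1 matrices -/

lemma encard_eq_tsum_fiber {α ι : Type*} (A : Set α) (g : α → ι) :
    (A.encard : ℝ≥0∞) = ∑' i, ((A ∩ g ⁻¹' {i}).encard : ℝ≥0∞) := by
  rw [← ENNReal.tsum_set_one, ← ENNReal.tsum_fiberwise (fun _ : A => 1) (fun a => g a)]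
  refine tsum_congr fun i => ?_
  rw [ENNReal.tsum_set_one, ← Subtype.val_injective.encard_image]
  congr 2
  ext a
  simp [and_comm]

section Paths

variable {V : Type*} (T : Matrix V V ℝ)

/-- The number of paths of length `n` from `u` to `w`. -/
noncomputable def pathCount (n : ℕ) (u w : V) : ℝ≥0∞ := ((pathSet T n u w).encard : ℝ≥0∞)

open Classical in
/-- The sum of `v` over the successors of `u`. -/
noncomputable def succSum (v : V → ℝ≥0∞) (u : V) : ℝ≥0∞ := ∑' z, if T u z = 1 then v z else 0

variable {T}

lemma tail_mem_pathSet {n : ℕ} {u w : V} {p : Fin (n + 2) → V} (hp : p ∈ pathSet T (n + 1) u w) :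
    T u (p 1) = 1 ∧ Fin.tail p ∈ pathSet T n (p 1) w := by
  obtain ⟨h0, h1, h2⟩ := hp
  refine ⟨by have := h2 0; rwa [Fin.castSucc_zero, h0] at this, rfl, h1, fun i => h2 i.succ⟩

lemma cons_mem_pathSet {n : ℕ} {u z w : V} (h : T u z = 1) {p : Fin (n + 1) → V}
    (hp : p ∈ pathSet T n z w) : (Fin.cons u p : Fin (n + 2) → V) ∈ pathSet T (n + 1) u w := by
  obtain ⟨h0, h1, h2⟩ := hp
  refine ⟨rfl, ?_, fun i => ?_⟩
  · rw [← Fin.succ_last, Fin.cons_succ, h1]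
  · refine Fin.cases ?_ (fun i => ?_) i
    · rw [Fin.castSucc_zero, Fin.cons_zero, Fin.cons_succ, h0, h]
    · rw [← Fin.succ_castSucc, Fin.cons_succ, Fin.cons_succ]; exact h2 i

lemma pathSet_eq_of_tail {n : ℕ} {u w : V} :
    InjOn Fin.tail (pathSet T (n + 1) u w) := by
  intro p hp p' hp' h
  rw [← Fin.cons_self_tail p, ← Fin.cons_self_tail p', h, hp.1, hp'.1]

variable (T) in
lemma pathCount_zero (u : V) : pathCount T 0 u u = 1 := by
  have : pathSet T 0 u u = {fun _ => u} := by
    ext p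
    simp only [pathSet, mem_ofPred_eq, mem_singleton_iff]
    constructor
    · rintro ⟨h, -, -⟩; funext i; rw [show i = 0 from Fin.ext (by omega), h]
    · rintro rfl; exact ⟨rfl, rfl, fun i => i.elim0⟩
  simp [pathCount, this]

lemma pathCount_zero_of_ne {u w : V} (h : u ≠ w) : pathCount T 0 u w = 0 := by
  have : pathSet T 0 u w = ∅ := by
    ext p
    simp only [pathSet, mem_ofPred_eq, mem_empty_iff_false, iff_false]
    rintro ⟨h1, h2, -⟩
    exact h (h1.symm.trans h2)
  simp [pathCount, this]

/-- Paths are sorted by their second vertex; deleting the first vertex is then a bijection onto the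
shorter paths. -/
lemma pathCount_succ (n : ℕ) (u w : V) :
    pathCount T (n + 1) u w = succSum T (fun z => pathCount T n z w) u := by
  rw [pathCount, encard_eq_tsum_fiber _ (fun p => p 1), succSum]
  refine tsum_congr fun z => ?_
  have hinj : InjOn Fin.tail (pathSet T (n + 1) u w ∩ (fun p => p 1) ⁻¹' {z}) :=
    pathSet_eq_of_tail.mono inter_subset_left
  rw [← hinj.encard_image]
  split_ifs with h
  · rw [pathCount]
    congr 2
    ext p
    constructor
    · rintro ⟨q, ⟨hq, rfl⟩, rfl⟩; exact (tail_mem_pathSet hq).2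
    · intro hp
      exact ⟨Fin.cons u p, ⟨cons_mem_pathSet h hp, hp.1⟩, Fin.tail_cons _ _⟩
  · have : pathSet T (n + 1) u w ∩ (fun p => p 1) ⁻¹' {z} = ∅ := by
      ext p
      simp only [mem_inter_iff, mem_empty_iff_false, iff_false]
      rintro ⟨hp, rfl⟩
      exact h (tail_mem_pathSet hp).1
    rw [this]; simp

lemma succSum_mono {v v' : V → ℝ≥0∞} (h : ∀ z, v z ≤ v' z) (u : V) :
    succSum T v u ≤ succSum T v' u :=
  ENNReal.tsum_le_tsum fun z => by split_ifs <;> [exact h z; exact le_rfl]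

lemma succSum_mul_right (v : V → ℝ≥0∞) (c : ℝ≥0∞) (u : V) :
    succSum T (fun z => v z * c) u = succSum T v u * c := by
  rw [succSum, succSum, ← ENNReal.tsum_mul_right]
  exact tsum_congr fun z => by split_ifs <;> simp

lemma le_succSum {v : V → ℝ≥0∞} {u z : V} (h : T u z = 1) : v z ≤ succSum T v u := by
  have := ENNReal.le_tsum (f := fun z => if T u z = 1 then v z else 0) z
  simp only [if_pos h] at this
  exact this

lemma pathCount_le_succ (n : ℕ) {u z : V} (w : V) (h : T u z = 1) :
    pathCount T n z w ≤ pathCount T (n + 1) u w := by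
  rw [pathCount_succ]; exact le_succSum (v := fun z => pathCount T n z w) h

/-- A supersolution bounds the numbers of paths from above. -/
lemma pathCount_mul_le {v : V → ℝ≥0∞} {L : ℝ≥0∞} (hv : ∀ u, succSum T v u ≤ v u * L)
    (n : ℕ) (u w : V) : pathCount T n u w * v w ≤ v u * L ^ n := by
  induction n generalizing u with
  | zero =>
    by_cases h : u = w
    · rw [h, pathCount_zero]; simp
    · simp [pathCount_zero_of_ne h]
  | succ n ih =>
    rw [pathCount_succ, ← succSum_mul_right, pow_succ', ← mul_assoc]
    calc succSum T (fun z => pathCount T n z w * v w) u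
        ≤ succSum T (fun z => v z * L ^ n) u := succSum_mono ih u
      _ = succSum T v u * L ^ n := succSum_mul_right _ _ _
      _ ≤ v u * L * L ^ n := by gcongr; exact hv u

lemma pathCount_mul_pathCount_le (m n : ℕ) (u w z : V) :
    pathCount T m u w * pathCount T n w z ≤ pathCount T (m + n) u z := by
  induction m generalizing u with
  | zero =>
    by_cases h : u = w
    · rw [h, pathCount_zero]; simp
    · simp [pathCount_zero_of_ne h]
  | succ m ih =>
    rw [pathCount_succ, ← succSum_mul_right, show m + 1 + n = (m + n) + 1 by ring,
      pathCount_succ]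
    exact succSum_mono ih u

open Classical in
/-- A finitely supported left subsolution bounds the numbers of paths from below. -/
lemma le_sum_mul_pathCount (F : Finset V) (y : V → ℝ≥0∞) (ρ : ℝ≥0∞) (w : V) (hw : w ∈ F)
    (hy : ∀ z ∈ F, ρ * y z ≤ ∑ u ∈ F, if T u z = 1 then y u else 0) (n : ℕ) :
    ρ ^ n * y w ≤ ∑ u ∈ F, y u * pathCount T n u w := by
  induction n with
  | zero =>
    have := Finset.single_le_sum (f := fun u => y u * pathCount T 0 u w)
      (fun _ _ => zero_le) hw
    simpa [pathCount_zero] using this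
  | succ n ih =>
    calc ρ ^ (n + 1) * y w = ρ * (ρ ^ n * y w) := by ring
      _ ≤ ρ * ∑ z ∈ F, y z * pathCount T n z w := by gcongr
      _ = ∑ z ∈ F, (ρ * y z) * pathCount T n z w := by
        rw [Finset.mul_sum]; exact Finset.sum_congr rfl fun z _ => by ring
      _ ≤ ∑ z ∈ F, (∑ u ∈ F, if T u z = 1 then y u else 0) * pathCount T n z w := by
        gcongr with z hz; exact hy z hz
      _ = ∑ u ∈ F, y u * ∑ z ∈ F, if T u z = 1 then pathCount T n z w else 0 := by
        simp only [Finset.sum_mul, Finset.mul_sum]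
        rw [Finset.sum_comm]
        refine Finset.sum_congr rfl fun u _ => Finset.sum_congr rfl fun z _ => ?_
        split_ifs <;> simp
      _ ≤ ∑ u ∈ F, y u * pathCount T (n + 1) u w := by
        gcongr with u _
        rw [pathCount_succ]
        exact ENNReal.sum_le_tsum F

variable (T) in
/-- The paths of length `n` from `u` to `w` that do not visit `w` at intermediate times. -/
def firstPassageSet (n : ℕ) (u w : V) : Set (Fin (n + 1) → V) :=
  {p ∈ pathSet T n u w | ∀ i : Fin (n + 1), i ≠ 0 → i ≠ Fin.last n → p i ≠ w}

/-- With length at least two the second vertex is visited at an intermediate time, so it differs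
from `w`. -/
lemma firstPassageSet_succ_le (n : ℕ) (u w : V) :
    ((firstPassageSet T (n + 2) u w).encard : ℝ≥0∞) ≤
      ∑' z, {z | T u z = 1 ∧ z ≠ w}.indicator
        (fun z => ((firstPassageSet T (n + 1) z w).encard : ℝ≥0∞)) z := by
  rw [encard_eq_tsum_fiber _ (fun p => p 1)]
  refine ENNReal.tsum_le_tsum fun z => ?_
  have hinj : InjOn Fin.tail (firstPassageSet T (n + 2) u w ∩ (fun p => p 1) ⁻¹' {z}) :=
    pathSet_eq_of_tail.mono fun p hp => hp.1.1
  rw [← hinj.encard_image]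
  by_cases h : T u z = 1 ∧ z ≠ w
  · rw [indicator_of_mem (show z ∈ {z | T u z = 1 ∧ z ≠ w} from h)]
    simp only [ENat.toENNReal_le]
    refine encard_le_encard ?_
    rintro _ ⟨p, ⟨⟨hp, hp'⟩, rfl⟩, rfl⟩
    refine ⟨(tail_mem_pathSet hp).2, fun i hi hi' => hp' i.succ (Fin.succ_ne_zero i) ?_⟩
    rwa [← Fin.succ_last, Ne, Fin.succ_inj]
  · have : firstPassageSet T (n + 2) u w ∩ (fun p => p 1) ⁻¹' {z} = ∅ := by
      ext p
      simp only [mem_inter_iff, mem_empty_iff_false, iff_false]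
      rintro ⟨⟨hp, hp'⟩, rfl⟩
      refine h ⟨(tail_mem_pathSet hp).1, hp' 1 (by simp) ?_⟩
      intro h1
      have := congrArg Fin.val h1
      simp at this
    rw [this]; simp

/-- A supersolution off `w` bounds the numbers of first passage paths from above. -/
lemma firstPassageSet_encard_le {v : V → ℝ≥0∞} {L : ℝ≥0∞} {w : V}
    (hv : ∀ u ≠ w, ∑' z, {z | T u z = 1 ∧ z ≠ w}.indicator v z ≤ L * v u)
    (hw : ∀ u ≠ w, T u w = 1 → 1 ≤ v u) (n : ℕ) {u : V} (hu : u ≠ w) :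
    ((firstPassageSet T (n + 1) u w).encard : ℝ≥0∞) ≤ L ^ n * v u := by
  induction n generalizing u with
  | zero =>
    by_cases h : T u w = 1
    · refine le_trans ?_ ((hw u hu h).trans (by simp))
      rw [← ENat.toENNReal_one, ENat.toENNReal_le, encard_le_one_iff]
      rintro p q ⟨hp, -⟩ ⟨hq, -⟩
      funext i
      refine Fin.cases (hp.1.trans hq.1.symm) (fun j => ?_) i
      rw [show j = Fin.last 0 from Fin.ext (by omega)]
      exact hp.2.1.trans hq.2.1.symm
    · have : firstPassageSet T (0 + 1) u w = ∅ := by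
        ext p
        simp only [mem_empty_iff_false, iff_false]
        rintro ⟨hp, -⟩
        have h1 := (tail_mem_pathSet hp).1
        have h2 : p 1 = w := hp.2.1
        exact h (h2 ▸ h1)
      rw [this]; simp
  | succ n ih =>
    refine (firstPassageSet_succ_le n u w).trans ?_
    calc ∑' z, {z | T u z = 1 ∧ z ≠ w}.indicator
          (fun z => ((firstPassageSet T (n + 1) z w).encard : ℝ≥0∞)) z
        ≤ ∑' z, L ^ n * {z | T u z = 1 ∧ z ≠ w}.indicator v z := by
          refine ENNReal.tsum_le_tsum fun z => ?_
          by_cases hz : z ∈ {z | T u z = 1 ∧ z ≠ w}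
          · rw [indicator_of_mem hz, indicator_of_mem hz]; exact ih hz.2
          · rw [indicator_of_notMem hz]; exact zero_le
      _ = L ^ n * ∑' z, {z | T u z = 1 ∧ z ≠ w}.indicator v z := ENNReal.tsum_mul_left
      _ ≤ L ^ n * (L * v u) := by gcongr; exact hv u hu
      _ = L ^ (n + 1) * v u := by ring

/-- The supersolution is only required off `w`, so the first step out of `w` is counted separately.
It costs a factor independent of `n` and leaves the growth rate unchanged. -/
lemma firstPassageSet_self_encard_le {v : V → ℝ≥0∞} {L : ℝ≥0∞} {w : V}
    (hv : ∀ u ≠ w, ∑' z, {z | T u z = 1 ∧ z ≠ w}.indicator v z ≤ L * v u)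
    (hw : ∀ u ≠ w, T u w = 1 → 1 ≤ v u) (n : ℕ) :
    ((firstPassageSet T (n + 2) w w).encard : ℝ≥0∞) ≤
      L ^ n * ∑' z, {z | T w z = 1 ∧ z ≠ w}.indicator v z := by
  refine (firstPassageSet_succ_le n w w).trans ?_
  rw [← ENNReal.tsum_mul_left]
  refine ENNReal.tsum_le_tsum fun z => ?_
  by_cases hz : z ∈ {z | T w z = 1 ∧ z ≠ w}
  · rw [indicator_of_mem hz, indicator_of_mem hz]
    exact firstPassageSet_encard_le hv hw n hz.2
  · rw [indicator_of_notMem hz]; exact zero_le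

end Paths

/-! ### Path counts of the example -/

namespace Cell

open Classical in
/-- The transition matrix of the Markov dynamics on the names of the cells. -/
noncomputable def matrix : Matrix Cell Cell ℝ := fun X Y => if X.Covers Y then 1 else 0

@[simp] lemma matrix_eq_one {X Y : Cell} : matrix X Y = 1 ↔ X.Covers Y := by
  simp [matrix]

@[simp] lemma D_covers (X : Cell) : D.Covers X := trivial

@[simp] lemma C_covers_C {i j : ℕ} : (C i).Covers (C j) ↔ i = j + 1 := by
  cases i <;> simp [Covers, eq_comm]

@[simp] lemma C_covers_D {i : ℕ} : (C i).Covers D ↔ i = 0 := by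
  cases i <;> simp [Covers]

@[simp] lemma C_covers_A {i j : ℕ} : ¬ (C i).Covers (A j) := by
  cases i <;> simp [Covers]

@[simp] lemma C_covers_B {i j : ℕ} : ¬ (C i).Covers (B j) := by
  cases i <;> simp [Covers]

end Cell

namespace Grid

variable (G : Grid)

/-- The length of a cell. -/
noncomputable def width (X : Cell) : ℝ := G.pos X.hi - G.pos X.lo

lemma width_pos (X : Cell) : 0 < G.width X := sub_pos.2 (G.lo_lt_hi X)

lemma countable_range_pos : (range G.pos).Countable := by
  have : range G.pos = range G.left ∪ {G.mid} ∪ range G.right := by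
    ext x
    constructor
    · rintro ⟨_ | _ | _, rfl⟩ <;> simp [pos]
    · rintro ((⟨n, rfl⟩ | rfl) | ⟨n, rfl⟩)
      · exact ⟨.left n, rfl⟩
      · exact ⟨.mid, rfl⟩
      · exact ⟨.right n, rfl⟩
  rw [this]
  exact ((countable_range _).union (countable_singleton _)).union (countable_range _)

open Classical in
/-- The lengths of the cells covered by the image of `X` add up to the length of the image. -/
lemma succSum_width (X : Cell) :
    succSum Cell.matrix (fun Y => ENNReal.ofReal (G.width Y)) X
      = ENNReal.ofReal (G.pos X.imHi - G.pos X.imLo) := by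
  let S : Cell → Set ℝ := fun Y => if X.Covers Y then Ioo (G.pos Y.lo) (G.pos Y.hi) else ∅
  have hS : ∀ Y, S Y ⊆ Ioo (G.pos Y.lo) (G.pos Y.hi) := by
    intro Y; simp only [S]; split_ifs <;> simp
  have h1 : MeasureTheory.volume (⋃ Y, S Y) = ∑' Y, MeasureTheory.volume (S Y) := by
    refine MeasureTheory.measure_iUnion (fun Y Z hYZ => ?_) fun Y => ?_
    · refine disjoint_left.2 fun x hx hx' => hYZ ?_
      exact G.eq_of_mem_Ioc (Ioo_subset_Ioc_self (hS Y hx)) (Ioo_subset_Ioc_self (hS Z hx'))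
    · simp only [S]; split_ifs
      · exact measurableSet_Ioo
      · exact MeasurableSet.empty
  have h2 : MeasureTheory.volume (⋃ Y, S Y)
      = MeasureTheory.volume (Ioo (G.pos X.imLo) (G.pos X.imHi)) := by
    apply le_antisymm
    · refine MeasureTheory.measure_mono (iUnion_subset fun Y => ?_)
      simp only [S]; split_ifs with h
      · rw [Cell.covers_iff] at h
        exact Ioo_subset_Ioo (G.pos_le_pos.2 h.1) (G.pos_le_pos.2 h.2)
      · exact empty_subset _
    -- A cell that meets the image is covered by it, so the covered cells fill the image up to
    -- countably many points.
    · have hsub : Ioo (G.pos X.imLo) (G.pos X.imHi) ⊆ (⋃ Y, S Y) ∪ range G.pos := by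
        intro x hx
        have hx' : x ∈ Icc (G.left 0) (G.right 0) := by
          refine ⟨le_trans (G.pos_le_pos (s := .left 0) (t := X.imLo) |>.2 ?_) hx.1.le,
            hx.2.le.trans (G.pos_le_pos (s := X.imHi) (t := .right 0) |>.2 ?_)⟩
          · cases X.imLo <;> simp [Pt.Le]
          · cases X.imHi <;> simp [Pt.Le]
        rcases G.exists_pos_or_mem_Ioo hx' with ⟨t, rfl⟩ | ⟨Y, hY⟩
        · exact Or.inr ⟨t, rfl⟩
        · refine Or.inl (mem_iUnion.2 ⟨Y, ?_⟩)
          by_cases h : X.Covers Y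
          · simpa only [S, if_pos h] using hY
          · rcases Cell.not_covers_iff.1 h with h | h <;> have := G.pos_le_pos.2 h
            · linarith [hx.1, hY.2]
            · linarith [hx.2, hY.1]
      calc _ ≤ _ := MeasureTheory.measure_mono hsub
        _ ≤ _ := MeasureTheory.measure_union_le _ _
        _ = _ := by rw [G.countable_range_pos.measure_zero, add_zero]
  rw [h1, Real.volume_Ioo] at h2
  rw [← h2, succSum]
  refine tsum_congr fun Y => ?_
  simp only [Cell.matrix_eq_one, S]
  split_ifs
  · rw [Real.volume_Ioo, width]
  · simp

end Grid

lemma Model.image_width (M : Model) (X : Cell) :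
    M.pos X.imHi - M.pos X.imLo = M.width X * M.l := by
  have := M.slope_eq X
  rw [Grid.width]
  rcases X.step_lo_hi with ⟨h, h3, h4⟩ | ⟨h, h3, h4⟩ <;> rw [h3, h4, h] at this <;> linarith

/-- The cell lengths form an eigenvector of the transition matrix. -/
lemma Model.succSum_width (M : Model) (X : Cell) :
    succSum Cell.matrix (fun Y => ENNReal.ofReal (M.width Y)) X
      = ENNReal.ofReal (M.width X) * ENNReal.ofReal M.l := by
  rw [M.toGrid.succSum_width, M.image_width, ENNReal.ofReal_mul (M.width_pos X).le]

/-- The cell lengths are a supersolution, and for a loop the length of `X` cancels. -/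
lemma Model.pathCount_self_le (M : Model) (n : ℕ) (X : Cell) :
    pathCount Cell.matrix n X X ≤ ENNReal.ofReal M.l ^ n := by
  have := pathCount_mul_le (fun u => (M.succSum_width u).le) n X X
  rw [mul_comm] at this
  exact (ENNReal.mul_le_mul_iff_right (by simpa using M.width_pos X) ENNReal.ofReal_ne_top).1 this

/-! ### First returns to `D` -/

/-- A grid whose cell lengths are multiplied by two by the dynamics, except on `D`. -/
noncomputable def Grid.two : Grid where
  -- The cells have the lengths `Cell.weight 2`: `5`, `3` and `1` times `(1 / 2) ^ i` for `A i`, `B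
  -- i` and `C i`, and `2` for `D`. The total is `20`, whereas the eigenvalue equation at `D` would
  -- need `4`.
  left n := -4 * (1 / 2) ^ n
  mid := 0
  right n := if Even n then 16 * (1 / 2) ^ (n / 2) else 11 * (1 / 2) ^ (n / 2)
  left_strictMono := by
    refine strictMono_nat_of_lt_succ fun n => ?_
    have : (0 : ℝ) < (1 / 2) ^ n := by positivity
    rw [pow_succ]; linarith
  right_strictAnti := by
    refine strictAnti_nat_of_succ_lt fun n => ?_
    obtain ⟨i, rfl | rfl⟩ := Nat.even_or_odd' n
    · have h1 : ¬ Even (2 * i + 1) := by simp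
      have h2 : (2 * i + 1) / 2 = i := by omega
      have : (0 : ℝ) < (1 / 2) ^ i := by positivity
      simp only [h1, h2, if_false, even_two_mul, if_true, Nat.mul_div_cancel_left i two_pos]
      linarith
    · have h1 : ¬ Even (2 * i + 1) := by simp
      have h2 : (2 * i + 1) / 2 = i := by omega
      have h3 : (2 * i + 1 + 1) / 2 = i + 1 := by omega
      have h4 : Even (2 * i + 1 + 1) := by simp [h1, Nat.even_add_one]
      have : (0 : ℝ) < (1 / 2) ^ i := by positivity
      simp only [h1, h2, h3, h4, if_false, if_true, pow_succ]
      linarith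
  left_tendsto := by
    have := (tendsto_pow_atTop_nhds_zero_of_lt_one (r := (1 / 2 : ℝ)) (by norm_num)
      (by norm_num)).const_mul (-4)
    simpa using this
  right_tendsto := by
    have h2 : Tendsto (fun n : ℕ => n / 2) atTop atTop := Nat.tendsto_div_const_atTop two_ne_zero
    have h := ((tendsto_pow_atTop_nhds_zero_of_lt_one (r := (1 / 2 : ℝ)) (by norm_num)
      (by norm_num)).const_mul 16).comp h2
    rw [mul_zero] at h
    refine squeeze_zero (fun n => ?_) (fun n => ?_) h
    · split_ifs <;> positivity
    · have : (0 : ℝ) < (1 / 2) ^ (n / 2) := by positivity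
      simp only [Function.comp_apply]
      split_ifs <;> linarith

lemma Grid.two_image_width {X : Cell} (hX : X ≠ .D) :
    Grid.two.pos X.imHi - Grid.two.pos X.imLo = 2 * Grid.two.width X := by
  cases X with
  | A i =>
    have h1 : ¬ Even (2 * i + 1) := by simp
    have h2 : (2 * i + 1) / 2 = i := by omega
    have h3 : (2 * i + 2) / 2 = i + 1 := by omega
    have h4 : Even (2 * i + 2) := by simp [Nat.even_add]
    simp only [Cell.imHi, Cell.imLo, width, Cell.lo, Cell.hi, pos, two, h1, h2, h3, h4, if_true,
      if_false, even_two_mul, Nat.mul_div_cancel_left i two_pos, pow_succ]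
    ring
  | B i =>
    have h1 : ¬ Even (2 * i + 1) := by simp
    have h2 : (2 * i + 1) / 2 = i := by omega
    have h3 : (2 * i + 2) / 2 = i + 1 := by omega
    have h4 : Even (2 * i + 2) := by simp [Nat.even_add]
    have h5 : (2 * i + 4) / 2 = i + 2 := by omega
    have h6 : Even (2 * i + 4) := by
      rw [show 2 * i + 4 = 2 * (i + 2) by ring]; exact even_two_mul _
    simp only [Cell.imHi, Cell.imLo, width, Cell.lo, Cell.hi, pos, two, h1, h2, h3, h4, h5, h6,
      if_true, if_false, pow_succ]
    ring
  | C i =>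
    simp only [Cell.imHi, Cell.imLo, width, Cell.lo, Cell.hi, pos, two, pow_succ]
    ring
  | D => exact absurd rfl hX

-- Off `D`, the lengths of `Grid.two` are a supersolution for the factor `2`. The only other cell
-- that covers `D` is `C 0`, of length one, and the first step out of `D` contributes at most the
-- total length `20`.
open Classical in
lemma firstPassage_D_le (n : ℕ) :
    ((firstPassageSet Cell.matrix (n + 2) .D .D).encard : ℝ≥0∞) ≤ 2 ^ n * ENNReal.ofReal 20 := by
  let v : Cell → ℝ≥0∞ := fun X => ENNReal.ofReal (Grid.two.width X)
  have hle : ∀ X : Cell, ∑' z, {z | Cell.matrix X z = 1 ∧ z ≠ .D}.indicator v z ≤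
      ENNReal.ofReal (Grid.two.pos X.imHi - Grid.two.pos X.imLo) := by
    intro X
    rw [← Grid.succSum_width, succSum]
    refine ENNReal.tsum_le_tsum fun z => ?_
    by_cases hz : z ∈ {z | Cell.matrix X z = 1 ∧ z ≠ .D}
    · rw [indicator_of_mem hz, if_pos hz.1]
    · rw [indicator_of_notMem hz]; exact zero_le
  refine (firstPassageSet_self_encard_le (v := v) (L := 2) (fun X hX => ?_) (fun X hX h => ?_)
    n).trans ?_
  · refine (hle X).trans_eq ?_
    rw [Grid.two_image_width hX, ENNReal.ofReal_mul zero_le_two]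
    simp [v]
  · have hX' : X = .C 0 := by
      rw [Cell.matrix_eq_one] at h
      cases X with
      | C i => rw [Cell.C_covers_D.1 h]
      | D => exact absurd rfl hX
      | _ => exact h.elim
    rw [hX', ← ENNReal.ofReal_one]
    refine ENNReal.ofReal_le_ofReal ?_
    norm_num [Grid.width, Cell.lo, Cell.hi, Grid.pos, Grid.two]
  · gcongr
    refine (hle .D).trans_eq ?_
    norm_num [Grid.width, Cell.imLo, Cell.imHi, Grid.pos, Grid.two]

/-! ### A truncated left eigenvector -/

namespace LeftVector

variable (l : ℝ)

/-- The recursion for the left eigenvector. -/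
noncomputable def w : ℕ → ℝ
  | 0 => 1
  | 1 => 1
  | k + 2 => w (k + 1) + (w (k + 1) + w k) / l

/-- The part of the mass of the left eigenvector that is lost by truncation at level `j`. -/
noncomputable def rest (j : ℕ) : ℝ :=
  ((l ^ 2 + l + 1) * w l (j + 1) + l * w l j) / ((l ^ 3 - l ^ 2 - l - 1) * l ^ j)

/-- The truncated left eigenvector. -/
noncomputable def vec (N : ℕ) : Cell → ℝ
  | .A i => (w l (i + 2) - w l (i + 1)) / 2
  | .B i => (w l (i + 2) - w l (i + 1)) / 2
  | .C j => l ^ j * (rest l j - rest l (N + 1))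
  | .D => 1

open Classical in
/-- The support of the truncated left eigenvector. -/
noncomputable def supp (N : ℕ) : Finset Cell :=
  (Finset.range (N + 1)).image .A ∪ (Finset.range (N + 1)).image .B ∪
    (Finset.range (N + 1)).image .C ∪ {.D}

lemma sum_supp (N : ℕ) (g : Cell → ℝ) :
    ∑ u ∈ supp N, g u = ∑ i ∈ Finset.range (N + 1), g (.A i) + ∑ i ∈ Finset.range (N + 1), g (.B i)
      + ∑ i ∈ Finset.range (N + 1), g (.C i) + g .D := by
  classical
  unfold supp
  rw [Finset.sum_union, Finset.sum_union, Finset.sum_union, Finset.sum_image, Finset.sum_image,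
    Finset.sum_image, Finset.sum_singleton]
  · intro _ _ _ _ h; simpa using h
  · intro _ _ _ _ h; simpa using h
  · intro _ _ _ _ h; simpa using h
  all_goals
    rw [Finset.disjoint_left]
    intro X hX
    simp only [Finset.mem_union, Finset.mem_image, Finset.mem_range, Finset.mem_singleton] at *
    aesop

variable {l}

/-- As `2 < l`, this bound is of smaller order than `l ^ k`, which makes `rest` tend to zero. -/
lemma w_pos_and_le (hl : 2 < l) (k : ℕ) : 0 < w l k ∧ w l k ≤ 2 ^ k := by
  have hl0 : 0 < l := by linarith
  suffices (0 < w l k ∧ w l k ≤ 2 ^ k) ∧ (0 < w l (k + 1) ∧ w l (k + 1) ≤ 2 ^ (k + 1)) from this.1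
  induction k with
  | zero => norm_num [w]
  | succ k ih =>
    obtain ⟨⟨h1, h2⟩, h3, h4⟩ := ih
    refine ⟨⟨h3, h4⟩, ?_, ?_⟩
    · rw [w]; positivity
    · rw [w]
      have : (w l (k + 1) + w l k) / l ≤ (w l (k + 1) + w l k) / 2 := by gcongr
      have h5 : (2 : ℝ) ^ (k + 1 + 1) = 2 * 2 ^ (k + 1) := by ring
      have h6 : (2 : ℝ) ^ (k + 1) = 2 * 2 ^ k := by ring
      linarith

lemma w_mono (hl : 2 < l) (k : ℕ) : w l (k + 1) ≤ w l (k + 2) := by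
  have h1 := (w_pos_and_le hl k).1
  have h2 := (w_pos_and_le hl (k + 1)).1
  have : 0 ≤ (w l (k + 1) + w l k) / l := div_nonneg (by linarith) (by linarith)
  rw [w]; linarith

/-- The left eigenvalue equation at `C j` reads `l * y (C j) = w l (j + 2) + y (C (j + 1))`, so `y
(C j) / l ^ j` is the tail from `j` of the series of `w l (k + 2) / l ^ (k + 1)`. The closed form of
that tail is `rest l j`. -/
lemma rest_sub (hl : 2 < l) (j : ℕ) : l ^ (j + 1) * (rest l j - rest l (j + 1)) = w l (j + 2) := by
  have h2 := (cubic_pos hl).ne'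
  have h3 : l ≠ 0 := by linarith
  have hw : l * w l (j + 2) = (l + 1) * w l (j + 1) + w l j := by
    rw [w]; field_simp; ring
  unfold rest
  obtain ⟨q, hq⟩ : ∃ q, q = l ^ 3 - l ^ 2 - l - 1 := ⟨_, rfl⟩
  rw [← hq] at h2 ⊢
  rw [show j + 1 + 1 = j + 2 by ring]
  field_simp
  rw [hq]
  linear_combination (-l ^ 2 * l ^ j) * hw

lemma rest_antitone (hl : 2 < l) : Antitone (rest l) := by
  refine antitone_nat_of_succ_le fun j => ?_
  have h1 := rest_sub hl j
  have h2 := (w_pos_and_le hl (j + 2)).1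
  rw [← h1] at h2
  have := pos_of_mul_pos_right h2 (pow_nonneg (by linarith) _)
  linarith

/-- This is the left eigenvalue equation at `D`, which is covered only by `C 0` and `D`; it is what
singles out the root of the polynomial. -/
lemma rest_zero (h : l ^ 3 - 2 * l ^ 2 - l - 2 = 0) : rest l 0 = l - 1 := by
  have h2 := (cubic_pos (two_lt_of_poly_nonneg h.ge)).ne'
  unfold rest
  rw [div_eq_iff (by simpa using h2)]
  simp only [w, pow_zero]
  linear_combination (-l) * h

lemma tendsto_rest (hl : 2 < l) : Tendsto (rest l) atTop (𝓝 0) := by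
  have hl0 : 0 < l := by linarith
  have hq := cubic_pos hl
  have h1 : Tendsto (fun j : ℕ => ((l ^ 2 + l + 1) * 2 + l) / (l ^ 3 - l ^ 2 - l - 1) * (2 / l) ^ j)
      atTop (𝓝 0) := by
    simpa using (tendsto_pow_atTop_nhds_zero_of_lt_one (r := 2 / l) (by positivity)
      (by rwa [div_lt_one hl0])).const_mul
        (((l ^ 2 + l + 1) * 2 + l) / (l ^ 3 - l ^ 2 - l - 1))
  refine squeeze_zero (fun j => ?_) (fun j => ?_) h1
  · have h1 := (w_pos_and_le hl j).1
    have h2 := (w_pos_and_le hl (j + 1)).1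
    unfold rest; positivity
  · have h1 := (w_pos_and_le hl j).2
    have h2 := (w_pos_and_le hl (j + 1)).2
    rw [div_pow, div_mul_div_comm, rest]
    gcongr
    calc (l ^ 2 + l + 1) * w l (j + 1) + l * w l j
        ≤ (l ^ 2 + l + 1) * 2 ^ (j + 1) + l * 2 ^ j := by gcongr
      _ = _ := by ring

lemma vec_nonneg (hl : 2 < l) {N : ℕ} {X : Cell} (hX : X ∈ supp N) : 0 ≤ vec l N X := by
  cases X with
  | A i => exact div_nonneg (sub_nonneg.2 (w_mono hl i)) two_pos.le
  | B i => exact div_nonneg (sub_nonneg.2 (w_mono hl i)) two_pos.le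
  | C i =>
    have hi : i ≤ N := by simpa [supp, Nat.lt_succ_iff] using hX
    exact mul_nonneg (pow_nonneg (by linarith) _)
      (sub_nonneg.2 (rest_antitone hl (by omega)))
  | D => exact zero_le_one

lemma sum_vec_lt (N k : ℕ) (hk : k ≤ N + 1) :
    ∑ i ∈ Finset.range (N + 1), (if i + 1 ≤ k then (w l (i + 2) - w l (i + 1)) / 2 else 0)
      = (w l (k + 1) - 1) / 2 := by
  rw [← Finset.sum_filter]
  have : (Finset.range (N + 1)).filter (fun i => i + 1 ≤ k) = Finset.range k := by
    ext i; simp; omega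
  rw [this, ← Finset.sum_div, Finset.sum_range_sub (fun i => w l (i + 1))]
  simp [w]

lemma sum_vec_lt' (N k : ℕ) (hk : k ≤ N + 1) :
    ∑ i ∈ Finset.range (N + 1), (if i + 2 ≤ k then (w l (i + 2) - w l (i + 1)) / 2 else 0)
      = (w l k - 1) / 2 := by
  cases k with
  | zero => simp [w]
  | succ k =>
    rw [← sum_vec_lt N k (by omega)]
    simp

open Classical in
/-- The truncated vector is a left eigenvector up to an error at `D`. -/
lemma sum_vec (h : l ^ 3 - 2 * l ^ 2 - l - 2 = 0) {N : ℕ} {X : Cell} (hX : X ∈ supp N) :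
    ∑ u ∈ supp N, (if u.Covers X then vec l N u else 0)
      = if X = .D then l - rest l (N + 1) else l * vec l N X := by
  have hl := two_lt_of_poly_nonneg h.ge
  have hl0 : l ≠ 0 := by linarith
  have hw : ∀ k, l * (w l (k + 2) - w l (k + 1)) = w l (k + 1) + w l k := by
    intro k; rw [w]; field_simp; ring
  rw [sum_supp]
  cases X with
  | A k =>
    have hk : k ≤ N := by simpa [supp, Nat.lt_succ_iff] using hX
    -- Apart from `D`, only cells `A i`, `B i` with `i < k` can cover `A k`, so the truncation is
    -- not felt and the differences of `w` telescope.
    have hA : ∑ i ∈ Finset.range (N + 1), (if (Cell.A i).Covers (.A k) then vec l N (.A i) else 0)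
        = (w l (k + 1) - 1) / 2 := by
      rw [← sum_vec_lt N k (by omega)]
      exact Finset.sum_congr rfl fun i _ => if_congr Iff.rfl rfl rfl
    have hB : ∑ i ∈ Finset.range (N + 1), (if (Cell.B i).Covers (.A k) then vec l N (.B i) else 0)
        = (w l k - 1) / 2 := by
      rw [← sum_vec_lt' N k (by omega)]
      exact Finset.sum_congr rfl fun i _ => if_congr Iff.rfl rfl rfl
    rw [hA, hB]
    simp only [vec, Cell.C_covers_A, Cell.D_covers, if_false, if_true, reduceCtorEq,
      Finset.sum_const_zero]
    linarith [hw k]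
  | B k =>
    have hk : k ≤ N := by simpa [supp, Nat.lt_succ_iff] using hX
    have hA : ∑ i ∈ Finset.range (N + 1), (if (Cell.A i).Covers (.B k) then vec l N (.A i) else 0)
        = (w l (k + 1) - 1) / 2 := by
      rw [← sum_vec_lt N k (by omega)]
      exact Finset.sum_congr rfl fun i _ => if_congr Iff.rfl rfl rfl
    have hB : ∑ i ∈ Finset.range (N + 1), (if (Cell.B i).Covers (.B k) then vec l N (.B i) else 0)
        = (w l k - 1) / 2 := by
      rw [← sum_vec_lt' N k (by omega)]
      exact Finset.sum_congr rfl fun i _ => if_congr Iff.rfl rfl rfl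
    rw [hA, hB]
    simp only [vec, Cell.C_covers_B, Cell.D_covers, if_false, if_true, reduceCtorEq,
      Finset.sum_const_zero]
    linarith [hw k]
  | C k =>
    have hk : k ≤ N := by simpa [supp, Nat.lt_succ_iff] using hX
    have hA : ∑ i ∈ Finset.range (N + 1), (if (Cell.A i).Covers (.C k) then vec l N (.A i) else 0)
        = (w l (k + 2) - 1) / 2 := by
      rw [← sum_vec_lt N (k + 1) (by omega)]
      exact Finset.sum_congr rfl fun i _ => if_congr Nat.succ_le_succ_iff.symm rfl rfl
    have hB : ∑ i ∈ Finset.range (N + 1), (if (Cell.B i).Covers (.C k) then vec l N (.B i) else 0)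
        = (w l (k + 2) - 1) / 2 := by
      rw [← sum_vec_lt N (k + 1) (by omega)]
      exact Finset.sum_congr rfl fun i _ => if_congr Nat.succ_le_succ_iff.symm rfl rfl
    -- For `k = N` the predecessor `C (N + 1)` lies outside the support, and the formula correctly
    -- gives zero.
    have hC : ∑ i ∈ Finset.range (N + 1), (if (Cell.C i).Covers (.C k) then vec l N (.C i) else 0)
        = l ^ (k + 1) * (rest l (k + 1) - rest l (N + 1)) := by
      simp only [Cell.C_covers_C, Finset.sum_ite_eq', Finset.mem_range, vec]
      split_ifs with hkN
      · rfl
      · have : k = N := by omega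
        rw [this, sub_self, mul_zero]
    rw [hA, hB, hC]
    simp only [vec, Cell.D_covers, if_false, if_true, reduceCtorEq]
    linear_combination -rest_sub hl k
  | D =>
    have hA : ∀ i, ¬ (Cell.A i).Covers .D := fun i => id
    have hB : ∀ i, ¬ (Cell.B i).Covers .D := fun i => id
    -- The entry at `C 0` has lost `rest l (N + 1)`, while the entry at `D` was not adjusted: here
    -- alone the truncation shows.
    have hC : ∑ i ∈ Finset.range (N + 1), (if (Cell.C i).Covers .D then vec l N (.C i) else 0)
        = l - 1 - rest l (N + 1) := by
      simp [Cell.C_covers_D, vec, rest_zero h]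
    rw [hC]
    simp only [hA, hB, vec, Cell.D_covers, if_false, if_true, Finset.sum_const_zero]
    ring

end LeftVector

open LeftVector in
/-- The number of loops at `D` grows faster than `ρ ^ n` for every `ρ < l`. -/
lemma exists_le_pathCount {l : ℝ} (h : l ^ 3 - 2 * l ^ 2 - l - 2 = 0) {ρ : ℝ} (h0 : 0 ≤ ρ)
    (hρ : ρ < l) : ∃ c : ℝ≥0∞, c ≠ 0 ∧ c ≠ ⊤ ∧
      ∀ n, c * ENNReal.ofReal ρ ^ n ≤ pathCount Cell.matrix (n + 1) .D .D := by
  classical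
  have hl := two_lt_of_poly_nonneg h.ge
  -- Once the loss at `D` is below `l - ρ`, the truncated vector is a left subsolution for the
  -- factor `ρ`.
  obtain ⟨N, hN⟩ : ∃ N, rest l (N + 1) < l - ρ :=
    (((tendsto_add_atTop_iff_nat 1).2 (tendsto_rest hl)).eventually
      (gt_mem_nhds (sub_pos.2 hρ))).exists
  let y : Cell → ℝ≥0∞ := fun X => ENNReal.ofReal (vec l N X)
  have hD : Cell.D ∈ supp N := by simp [supp]
  have hy : ∀ z ∈ supp N, ENNReal.ofReal ρ * y z
      ≤ ∑ u ∈ supp N, if Cell.matrix u z = 1 then y u else 0 := by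
    intro z hz
    have e1 : ∑ u ∈ supp N, (if Cell.matrix u z = 1 then y u else 0)
        = ENNReal.ofReal (∑ u ∈ supp N, if u.Covers z then vec l N u else 0) := by
      rw [ENNReal.ofReal_sum_of_nonneg]
      · refine Finset.sum_congr rfl fun u _ => ?_
        simp only [Cell.matrix_eq_one]
        split_ifs <;> simp [y]
      · intro u hu
        split_ifs
        · exact vec_nonneg hl hu
        · exact le_rfl
    rw [e1, ← ENNReal.ofReal_mul h0, sum_vec h hz]
    refine ENNReal.ofReal_le_ofReal ?_
    split_ifs with hzD
    · rw [hzD]; simp only [vec]; linarith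
    · exact mul_le_mul_of_nonneg_right hρ.le (vec_nonneg hl hz)
  have key := le_sum_mul_pathCount (supp N) y (ENNReal.ofReal ρ) .D hD hy
  have hyD : y .D = 1 := by simp [y, vec]
  set S := ∑ u ∈ supp N, y u with hS
  have hS0 : S ≠ 0 := by
    intro h0
    have := (Finset.sum_eq_zero_iff.1 h0) _ hD
    rw [hyD] at this
    exact one_ne_zero this
  have hST : S ≠ ⊤ := (ENNReal.sum_lt_top.2 fun u _ => ENNReal.ofReal_lt_top).ne
  refine ⟨S⁻¹, ENNReal.inv_ne_zero.2 hST, ENNReal.inv_ne_top.2 hS0, fun n => ?_⟩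
  rw [ENNReal.inv_mul_le_iff hS0 hST]
  have := key n
  rw [hyD, mul_one] at this
  refine this.trans ?_
  rw [hS, Finset.sum_mul]
  gcongr with u _
  -- As `D` covers every `u`, a path from `u` to `D` extends to a loop at `D` that is one step
  -- longer.
  exact pathCount_le_succ n _ (by simp)

/-! ### Transport along a bijection of the vertices -/

section Transport

variable {V V' : Type*} {T : Matrix V V ℝ} {T' : Matrix V' V' ℝ} (e : V ≃ V')

lemma pathSet_equiv (h : ∀ X Y, T' (e X) (e Y) = T X Y) (n : ℕ) (u w : V) :
    pathSet T' n (e u) (e w) = (fun p => e ∘ p) '' pathSet T n u w := by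
  ext p
  constructor
  · rintro ⟨h0, h1, h2⟩
    refine ⟨e.symm ∘ p, ⟨?_, ?_, fun i => ?_⟩, ?_⟩
    · simp [h0]
    · simp [h1]
    · rw [← h]; simpa using h2 i
    · funext i; simp
  · rintro ⟨q, ⟨h0, h1, h2⟩, rfl⟩
    exact ⟨congrArg e h0, congrArg e h1, fun i => (h _ _).trans (h2 i)⟩

lemma injective_equiv_comp (n : ℕ) : Function.Injective (fun p : Fin n → V => e ∘ p) :=
  fun _ _ h => e.injective.comp_left h

lemma loopCount_equiv (h : ∀ X Y, T' (e X) (e Y) = T X Y) (n : ℕ) (u : V) :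
    (loopCount T' (e u) n : ℝ≥0∞) = pathCount T n u u := by
  rw [loopCount, pathSet_equiv e h, (injective_equiv_comp e _).encard_image, pathCount]

lemma firstReturnCount_equiv (h : ∀ X Y, T' (e X) (e Y) = T X Y) (n : ℕ) (u : V) :
    firstReturnCount T' (e u) n = (firstPassageSet T n u u).encard := by
  rw [firstReturnCount, pathSet_equiv e h, ← (injective_equiv_comp e _).encard_image]
  congr 1
  ext p
  constructor
  · rintro ⟨⟨q, hq, rfl⟩, hp⟩
    exact ⟨q, ⟨hq, fun i hi hi' hqi => hp i hi hi' (congrArg e hqi)⟩, rfl⟩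
  · rintro ⟨q, ⟨hq, hp⟩, rfl⟩
    exact ⟨⟨q, hq, rfl⟩, fun i hi hi' hqi => hp i hi hi' (e.injective hqi)⟩

lemma isNonnegEigenvector_equiv (h : ∀ X Y, T' (e X) (e Y) = T X Y) (l : ℝ) (v : V' → ℝ) :
    IsNonnegEigenvector T' l v ↔ IsNonnegEigenvector T l (v ∘ e) := by
  unfold IsNonnegEigenvector
  refine and_congr (e.forall_congr_right (q := fun a => 0 ≤ v a)).symm (and_congr (not_congr ?_) ?_)
  · rw [funext_iff, funext_iff]
    exact (e.forall_congr_right (q := fun a => v a = 0)).symm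
  · rw [← e.forall_congr_right]
    refine forall_congr' fun X => ?_
    rw [← e.hasSum_iff]
    simp [Function.comp_def, h]

end Transport

/-! ### Growth rates of loops -/

lemma tendsto_rpow_one_div_of_growth {x : ℕ → ℝ≥0∞} {L : ℝ}
    (hup : ∀ n, x n ≤ ENNReal.ofReal L ^ n) (a : ℕ)
    (hlow : ∀ ρ, 0 < ρ → ρ < L → ∃ c : ℝ, 0 < c ∧ ∀ n, ENNReal.ofReal (c * ρ ^ n) ≤ x (n + a)) :
    Tendsto (fun n : ℕ => x n ^ (1 / (n : ℝ))) atTop (𝓝 (ENNReal.ofReal L)) := by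
  refine tendsto_order.2 ⟨fun b hb => ?_, fun b hb => ?_⟩
  · have hb' : b ≠ ⊤ := hb.ne_top
    lift b to NNReal using hb'
    have hbL : (b : ℝ) < L := by
      have h := (ENNReal.toReal_lt_toReal ENNReal.coe_ne_top ENNReal.ofReal_ne_top).2 hb
      rw [ENNReal.coe_toReal, ENNReal.toReal_ofReal'] at h
      rcases lt_max_iff.1 h with h | h
      · exact h
      · exact absurd b.2 (not_le.2 h)
    obtain ⟨ρ, hρ, hρL⟩ := exists_between hbL
    have hρ0 : 0 < ρ := b.2.trans_lt hρ
    obtain ⟨c, hc, hcn⟩ := hlow ρ hρ0 hρL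
    have hlim : Tendsto (fun n : ℕ => (b / ρ : ℝ) ^ n * (b : ℝ) ^ a) atTop (𝓝 0) := by
      simpa using (tendsto_pow_atTop_nhds_zero_of_lt_one (r := (b / ρ : ℝ))
        (div_nonneg b.2 hρ0.le) ((div_lt_one hρ0).2 hρ)).mul_const ((b : ℝ) ^ a)
    have hev : ∀ᶠ n : ℕ in atTop, (b : ℝ≥0∞) < x (n + a + 1 - 1) ^ (1 / ((n + a : ℕ) : ℝ)) := by
      filter_upwards [hlim.eventually (gt_mem_nhds hc), eventually_gt_atTop 0] with n hn hn0
      have hna : (0 : ℝ) < ((n + a : ℕ) : ℝ) := by exact_mod_cast (by omega)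
      rw [one_div, ENNReal.lt_rpow_inv_iff hna, ENNReal.rpow_natCast, Nat.add_sub_cancel]
      refine lt_of_lt_of_le ?_ (hcn n)
      rw [← ENNReal.ofReal_coe_nnreal, ← ENNReal.ofReal_pow (NNReal.coe_nonneg b)]
      refine (ENNReal.ofReal_lt_ofReal_iff (by positivity)).2 ?_
      rw [div_pow, div_mul_eq_mul_div, div_lt_iff₀ (by positivity)] at hn
      rwa [pow_add]
    rw [← map_add_atTop_eq_nat a]
    exact hev
  · filter_upwards [eventually_gt_atTop 0] with n hn
    have hn' : (0 : ℝ) < n := by exact_mod_cast hn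
    refine lt_of_le_of_lt ?_ hb
    rw [one_div, ENNReal.rpow_inv_le_iff hn', ENNReal.rpow_natCast]
    exact hup n

lemma pathCount_D_ne_zero_of_covers {X Y : Cell} (h : X.Covers Y) {n : ℕ}
    (hn : pathCount Cell.matrix n Y .D ≠ 0) : pathCount Cell.matrix (n + 1) X .D ≠ 0 :=
  ne_of_gt ((pos_iff_ne_zero.2 hn).trans_le (pathCount_le_succ n _ (Cell.matrix_eq_one.2 h)))

/-- Every cell leads to `D`. -/
lemma exists_pathCount_D_ne_zero (X : Cell) : ∃ n, pathCount Cell.matrix n X .D ≠ 0 := by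
  have hC : ∀ i, ∃ n, pathCount Cell.matrix n (.C i) .D ≠ 0 := by
    intro i
    induction i with
    | zero =>
      refine ⟨1, pathCount_D_ne_zero_of_covers (Y := .D) (by simp) ?_⟩
      rw [pathCount_zero]; exact one_ne_zero
    | succ i ih =>
      obtain ⟨n, hn⟩ := ih
      exact ⟨n + 1, pathCount_D_ne_zero_of_covers (by simp) hn⟩
  cases X with
  | A i =>
    obtain ⟨n, hn⟩ := hC i
    exact ⟨n + 1, pathCount_D_ne_zero_of_covers (X := .A i) (Y := .C i) (le_refl i) hn⟩
  | B i =>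
    obtain ⟨n, hn⟩ := hC i
    exact ⟨n + 1, pathCount_D_ne_zero_of_covers (X := .B i) (Y := .C i) (le_refl i) hn⟩
  | C i => exact hC i
  | D => exact ⟨0, by rw [pathCount_zero]; exact one_ne_zero⟩

lemma one_le_pathCount_D (X : Cell) : 1 ≤ pathCount Cell.matrix 1 .D X := by
  rw [← pathCount_zero Cell.matrix X]
  exact pathCount_le_succ 0 _ (by simp)

/-- A loop at `D` is preceded by a fixed-length path from `X` to `D` and followed by the single step
from `D` to `X`. -/
lemma exists_pathCount_D_le (X : Cell) : ∃ a, ∀ n,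
    pathCount Cell.matrix (n + 1) .D .D ≤ pathCount Cell.matrix (n + a) X X := by
  obtain ⟨m, hm⟩ := exists_pathCount_D_ne_zero X
  have hm1 : 1 ≤ pathCount Cell.matrix m X .D := by
    have h : (pathSet Cell.matrix m X .D).encard ≠ 0 := by
      intro h; exact hm (by rw [pathCount, h, ENat.toENNReal_zero])
    rw [pathCount, ← ENat.toENNReal_one, ENat.toENNReal_le]
    exact Order.one_le_iff_ne_zero.2 h
  refine ⟨m + 2, fun n => ?_⟩
  calc pathCount Cell.matrix (n + 1) .D .D
      ≤ pathCount Cell.matrix m X .D * pathCount Cell.matrix (n + 1) .D .D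
        * pathCount Cell.matrix 1 .D X := by
        refine le_mul_of_le_of_one_le ?_ (one_le_pathCount_D X)
        exact le_mul_of_one_le_left zero_le hm1
    _ ≤ pathCount Cell.matrix (m + (n + 1)) X .D * pathCount Cell.matrix 1 .D X := by
        gcongr; exact pathCount_mul_pathCount_le _ _ _ _ _
    _ ≤ pathCount Cell.matrix (m + (n + 1) + 1) X X := pathCount_mul_pathCount_le _ _ _ _ _
    _ = pathCount Cell.matrix (n + (m + 2)) X X := by congr 1; ring

lemma exists_pathSet_nonempty (X Y : Cell) :
    ∃ n, 1 ≤ n ∧ (pathSet Cell.matrix n X Y).Nonempty := by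
  obtain ⟨m, hm⟩ := exists_pathCount_D_ne_zero X
  refine ⟨m + 1, by omega, ?_⟩
  by_contra h
  rw [not_nonempty_iff_eq_empty] at h
  have h1 := pathCount_mul_pathCount_le (T := Cell.matrix) m 1 X .D Y
  rw [pathCount, pathCount, pathCount, h] at h1
  simp only [encard_empty, ENat.toENNReal_zero, nonpos_iff_eq_zero, mul_eq_zero] at h1
  rcases h1 with h1 | h1
  · exact hm h1
  · have := one_le_pathCount_D Y
    rw [pathCount, h1] at this
    exact absurd this (by simp)

lemma exists_real_le_pathCount {l : ℝ} (h : l ^ 3 - 2 * l ^ 2 - l - 2 = 0) {ρ : ℝ} (h0 : 0 < ρ)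
    (hρ : ρ < l) : ∃ c : ℝ, 0 < c ∧
      ∀ n, ENNReal.ofReal (c * ρ ^ n) ≤ pathCount Cell.matrix (n + 1) .D .D := by
  obtain ⟨c, hc0, hcT, hc⟩ := exists_le_pathCount h h0.le hρ
  refine ⟨c.toReal, ENNReal.toReal_pos hc0 hcT, fun n => ?_⟩
  rw [ENNReal.ofReal_mul ENNReal.toReal_nonneg, ENNReal.ofReal_toReal hcT, ENNReal.ofReal_pow h0.le]
  exact hc n

lemma tendsto_pathCount {l : ℝ} (h : l ^ 3 - 2 * l ^ 2 - l - 2 = 0) (X : Cell) :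
    Tendsto (fun n : ℕ => pathCount Cell.matrix n X X ^ (1 / (n : ℝ))) atTop
      (𝓝 (ENNReal.ofReal l)) := by
  obtain ⟨a, ha⟩ := exists_pathCount_D_le X
  refine tendsto_rpow_one_div_of_growth (fun n => (Model.ofSlope l h.ge).pathCount_self_le n X) a
    fun ρ h0 hρ => ?_
  obtain ⟨c, hc, hcn⟩ := exists_real_le_pathCount h h0 hρ
  exact ⟨c, hc, fun n => (hcn n).trans (ha n)⟩

lemma limsup_firstPassage_le {ρ : ℝ} (hρ : 2 < ρ) :
    limsup (fun n : ℕ => ((firstPassageSet Cell.matrix n .D .D).encard : ℝ≥0∞) ^ (1 / (n : ℝ)))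
      atTop ≤ ENNReal.ofReal ρ := by
  refine limsup_le_of_le (h := ?_)
  have hlim : Tendsto (fun n : ℕ => (2 / ρ : ℝ) ^ n * 20) atTop (𝓝 0) := by
    simpa using (tendsto_pow_atTop_nhds_zero_of_lt_one (r := (2 / ρ : ℝ)) (by positivity)
      ((div_lt_one (by linarith)).2 hρ)).mul_const 20
  filter_upwards [hlim.eventually (gt_mem_nhds one_pos), eventually_ge_atTop 2] with n hn hn2
  have hn' : (0 : ℝ) < n := by exact_mod_cast (by omega)
  rw [one_div, ENNReal.rpow_inv_le_iff hn', ENNReal.rpow_natCast]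
  obtain ⟨m, rfl⟩ := Nat.exists_eq_add_of_le' hn2
  refine (firstPassage_D_le m).trans ?_
  rw [← ENNReal.ofReal_pow (by linarith), ← ENNReal.ofReal_ofNat, ← ENNReal.ofReal_pow (by norm_num),
    ← ENNReal.ofReal_mul (by positivity)]
  refine ENNReal.ofReal_le_ofReal ?_
  rw [div_pow, div_mul_eq_mul_div, div_lt_one (by positivity)] at hn
  refine le_trans ?_ hn.le
  have : (2 : ℝ) ^ m ≤ 2 ^ (m + 2) := pow_le_pow_right₀ (by norm_num) (by omega)
  norm_num at this ⊢
  linarith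

/-! ### Nonnegative eigenvectors -/

lemma Model.isNonnegEigenvector (M : Model) :
    IsNonnegEigenvector Cell.matrix M.l M.width := by
  refine ⟨fun X => (M.width_pos X).le, fun h => (M.width_pos .D).ne' (congrFun h .D),
    fun X => ?_⟩
  have h1 := M.succSum_width X
  have h2 : succSum Cell.matrix (fun Y => ENNReal.ofReal (M.width Y)) X ≠ ⊤ := by
    rw [h1]; exact ENNReal.mul_ne_top ENNReal.ofReal_ne_top ENNReal.ofReal_ne_top
  have h3 := ENNReal.hasSum_toReal h2
  have h4 : (succSum Cell.matrix (fun Y => ENNReal.ofReal (M.width Y)) X).toReal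
      = M.l * M.width X := by
    rw [h1, ENNReal.toReal_mul, ENNReal.toReal_ofReal (M.width_pos X).le,
      ENNReal.toReal_ofReal M.l_pos.le, mul_comm]
  rw [← ENNReal.tsum_toReal_eq fun Y => by split_ifs <;> simp] at h3
  rw [← h4]
  convert! h3 using 1
  funext Y
  unfold Cell.matrix
  split_ifs <;> simp_all [(M.width_pos Y).le]

/-- The row of `D` consists of ones, so the equation at `D` is the convergence of the full sum. -/
lemma summable_of_isNonnegEigenvector {l : ℝ} {v : Cell → ℝ}
    (hv : IsNonnegEigenvector Cell.matrix l v) : Summable v := by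
  have := (hv.2.2 .D).summable
  simpa [Cell.matrix] using this

/-- The full sum is `l * v .D`, so `v .D` is positive, and `v` then bounds the number of loops at
`D` by `l ^ n`. These loops outgrow `ρ ^ n` for every `ρ < l₀`. -/
lemma le_of_isNonnegEigenvector {l₀ l : ℝ} (h : l₀ ^ 3 - 2 * l₀ ^ 2 - l₀ - 2 = 0) {v : Cell → ℝ}
    (hv : IsNonnegEigenvector Cell.matrix l v) : l₀ ≤ l := by
  obtain ⟨h0, hne, hsum⟩ := hv
  have hD : HasSum v (l * v .D) := by simpa [Cell.matrix] using hsum .D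
  obtain ⟨X, hX⟩ := Function.ne_iff.1 hne
  have hX0 : 0 < v X := lt_of_le_of_ne (h0 X) (Ne.symm hX)
  have hlv : 0 < l * v .D := hX0.trans_le (le_hasSum hD X fun Y _ => h0 Y)
  have hvD : 0 < v .D := lt_of_le_of_ne (h0 _) fun h => by simp [← h] at hlv
  have hl : 0 < l := pos_of_mul_pos_left hlv hvD.le
  have hsucc : ∀ u, succSum Cell.matrix (fun X => ENNReal.ofReal (v X)) u
      ≤ ENNReal.ofReal (v u) * ENNReal.ofReal l := by
    intro u
    rw [← ENNReal.ofReal_mul (h0 u), mul_comm, ← (hsum u).tsum_eq,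
      ENNReal.ofReal_tsum_of_nonneg _ (hsum u).summable]
    · refine (tsum_congr fun z => ?_).le
      unfold Cell.matrix
      split_ifs <;> simp_all
    · intro Y
      unfold Cell.matrix
      split_ifs <;> simp [h0]
  have hcount : ∀ n, pathCount Cell.matrix n .D .D ≤ ENNReal.ofReal (l ^ n) := by
    intro n
    have := pathCount_mul_le hsucc n .D .D
    rw [mul_comm] at this
    rw [ENNReal.ofReal_pow hl.le]
    exact (ENNReal.mul_le_mul_iff_right (by simpa using hvD) ENNReal.ofReal_ne_top).1 this
  by_contra! hlt
  obtain ⟨ρ, hρ, hρl⟩ := exists_between hlt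
  have hρ0 : 0 < ρ := hl.trans hρ
  obtain ⟨c, hc, hcn⟩ := exists_real_le_pathCount h hρ0 hρl
  have hlim : Tendsto (fun n : ℕ => (l / ρ : ℝ) ^ n * l) atTop (𝓝 0) := by
    simpa using (tendsto_pow_atTop_nhds_zero_of_lt_one (r := (l / ρ : ℝ)) (by positivity)
      ((div_lt_one hρ0).2 hρ)).mul_const l
  obtain ⟨n, hn⟩ := (hlim.eventually (gt_mem_nhds hc)).exists
  have h1 := (hcn n).trans (hcount (n + 1))
  rw [ENNReal.ofReal_le_ofReal_iff (by positivity)] at h1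
  rw [div_pow, div_mul_eq_mul_div, div_lt_iff₀ (by positivity), ← pow_succ] at hn
  linarith

/-! ### The transition matrix on basic intervals -/

namespace Model

variable (M : Model)

/-- The basic intervals of a model are the cells. -/
noncomputable def cellEquiv : Cell ≃ BasicInterval M.part :=
  Equiv.ofBijective (fun X => ⟨M.cell X, (M.isBasicInterval_iff _).2 ⟨X, rfl⟩⟩)
    ⟨fun _ _ h => M.cell_injective (congrArg Subtype.val h), fun J => by
      obtain ⟨X, hX⟩ := (M.isBasicInterval_iff _).1 J.2
      exact ⟨X, Subtype.ext hX.symm⟩⟩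

lemma transitionMatrix_cellEquiv (X Y : Cell) :
    transitionMatrix M.f M.part (M.cellEquiv X) (M.cellEquiv Y) = Cell.matrix X Y := by
  classical
  unfold transitionMatrix Cell.matrix
  exact if_congr (M.cell_subset_image_iff X Y) rfl rfl

lemma summable_eigenvector {l : ℝ} {v : BasicInterval M.part → ℝ}
    (hv : IsNonnegEigenvector (transitionMatrix M.f M.part) l v) : Summable v := by
  rw [isNonnegEigenvector_equiv M.cellEquiv M.transitionMatrix_cellEquiv] at hv
  exact M.cellEquiv.summable_iff.1 (summable_of_isNonnegEigenvector hv)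

lemma exists_eigenvector_iff {l₀ : ℝ} (h : l₀ ^ 3 - 2 * l₀ ^ 2 - l₀ - 2 = 0) (l : ℝ) :
    (∃ v : BasicInterval M.part → ℝ, IsNonnegEigenvector (transitionMatrix M.f M.part) l v) ↔
      l₀ ≤ l := by
  constructor
  · rintro ⟨v, hv⟩
    rw [isNonnegEigenvector_equiv M.cellEquiv M.transitionMatrix_cellEquiv] at hv
    exact le_of_isNonnegEigenvector h hv
  · intro hl
    refine ⟨(ofSlope l (poly_nonneg_of_le h hl)).width ∘ M.cellEquiv.symm, ?_⟩
    rw [isNonnegEigenvector_equiv M.cellEquiv M.transitionMatrix_cellEquiv, Function.comp_assoc,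
      Equiv.symm_comp_self]
    exact (ofSlope l (poly_nonneg_of_le h hl)).isNonnegEigenvector

lemma hasPerronValue {l : ℝ} (h : l ^ 3 - 2 * l ^ 2 - l - 2 = 0) :
    HasPerronValue (transitionMatrix M.f M.part) (ENNReal.ofReal l) := by
  intro u
  obtain ⟨X, rfl⟩ := M.cellEquiv.surjective u
  simp only [loopCount_equiv M.cellEquiv M.transitionMatrix_cellEquiv]
  exact tendsto_pathCount h X

lemma isStronglyPositiveRecurrent :
    IsStronglyPositiveRecurrent (transitionMatrix M.f M.part) := by
  obtain ⟨l, h⟩ := exists_root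
  have hl := two_lt_of_poly_nonneg h.ge
  refine ⟨fun u w => ?_, ENNReal.ofReal l, M.hasPerronValue h, M.cellEquiv .D, ?_⟩
  · obtain ⟨X, rfl⟩ := M.cellEquiv.surjective u
    obtain ⟨Y, rfl⟩ := M.cellEquiv.surjective w
    obtain ⟨n, hn, hne⟩ := exists_pathSet_nonempty X Y
    refine ⟨n, hn, ?_⟩
    rw [pathSet_equiv M.cellEquiv M.transitionMatrix_cellEquiv]
    exact hne.image _
  · obtain ⟨ρ, hρ, hρl⟩ := exists_between hl
    rw [firstReturnRate]
    simp only [firstReturnCount_equiv M.cellEquiv M.transitionMatrix_cellEquiv]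
    exact (limsup_firstPassage_le hρ).trans_lt
      ((ENNReal.ofReal_lt_ofReal_iff (by linarith)).2 hρl)

end Model

/-! ### Mixing and topological entropy -/

namespace Model

variable (M : Model)

lemma exists_preimage {X Y : Cell} (h : X.Covers Y) {y : Icc (0 : ℝ) 1} (hy : y ∈ M.cell Y) :
    ∃ x ∈ M.cell X, M.f x = y :=
  (M.cell_subset_image_iff X Y).2 h hy

/-- Every path of cells is followed by the orbit of a point. -/
lemma exists_orbit {n : ℕ} {X Y : Cell} {p : Fin (n + 1) → Cell}
    (hp : p ∈ pathSet Cell.matrix n X Y) {y : Icc (0 : ℝ) 1} (hy : y ∈ M.cell Y) :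
    ∃ x, M.f^[n] x = y ∧ ∀ i : Fin (n + 1), M.f^[i] x ∈ M.cell (p i) := by
  induction n generalizing X with
  | zero =>
    refine ⟨y, rfl, fun i => ?_⟩
    have hi : i = Fin.last 0 := Fin.ext (by omega)
    rw [hi, hp.2.1]; exact hy
  | succ n ih =>
    obtain ⟨hcov, htail⟩ := tail_mem_pathSet hp
    obtain ⟨x', hx', hx'p⟩ := ih htail
    obtain ⟨x, hx, hfx⟩ := M.exists_preimage (Cell.matrix_eq_one.1 hcov)
      (show x' ∈ M.cell (p 1) from hx'p 0)
    refine ⟨x, by rw [Function.iterate_succ_apply, hfx, hx'], fun i => ?_⟩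
    refine Fin.cases ?_ (fun i => ?_) i
    · rw [hp.1]; exact hx
    · rw [Fin.val_succ, Function.iterate_succ_apply, hfx]; exact hx'p i

lemma countable_preimage {S : Set (Icc (0 : ℝ) 1)} (hS : S.Countable) : (M.f ⁻¹' S).Countable := by
  have hsub : M.f ⁻¹' S ⊆ M.part ∪ ⋃ X, (M.cell X ∩ M.f ⁻¹' S) := by
    intro x hx
    by_cases h : x ∈ M.part
    · exact Or.inl h
    · obtain ⟨X, hX⟩ := M.notMem_part_iff.1 h
      exact Or.inr (mem_iUnion.2 ⟨X, hX, hx⟩)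
  refine (M.countable_part.union (countable_iUnion fun X => ?_)).mono hsub
  refine MapsTo.countable_of_injOn (f := M.f) (t := S) (fun x hx => hx.2) ?_ hS
  intro x hx y hy hxy
  exact Subtype.ext (M.map_injOn X (Ioo_subset_Icc_self hx.1) (Ioo_subset_Icc_self hy.1)
    (congrArg Subtype.val hxy))

/-- Every nonempty open set contains a point whose orbit avoids the partition set. -/
lemma exists_generic {U : Set (Icc (0 : ℝ) 1)} (hU : IsOpen U) (hne : U.Nonempty) :
    ∃ x ∈ U, ∀ n, ∃ X, M.f^[n] x ∈ M.cell X := by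
  have hc : ∀ n, {x | M.f^[n] x ∈ M.part}.Countable := by
    intro n
    induction n with
    | zero => exact M.countable_part
    | succ n ih => exact M.countable_preimage ih
  obtain ⟨O, hO, rfl⟩ := isOpen_induced_iff.1 hU
  obtain ⟨x, hx⟩ := hne
  have hxc : (x : ℝ) ∈ closure (Ioo (0 : ℝ) 1) := by
    rw [closure_Ioo zero_ne_one]; exact x.2
  have hbad : (Subtype.val '' (⋃ n, {x | M.f^[n] x ∈ M.part}) : Set ℝ).Countable :=
    (countable_iUnion hc).image _
  obtain ⟨y, hy, hyb⟩ := (hbad.dense_compl ℝ).inter_open_nonempty _ (hO.inter isOpen_Ioo)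
    (mem_closure_iff.1 hxc O hO hx)
  refine ⟨⟨y, Ioo_subset_Icc_self hy.2⟩, hy.1, fun n => M.notMem_part_iff.1 fun h => hyb ?_⟩
  exact ⟨⟨y, Ioo_subset_Icc_self hy.2⟩, mem_iUnion.2 ⟨n, h⟩, rfl⟩

lemma dist_iterate {n : ℕ} {x y : Icc (0 : ℝ) 1}
    (h : ∀ i < n, ∃ X, M.f^[i] x ∈ M.cell X ∧ M.f^[i] y ∈ M.cell X) :
    dist (M.f^[n] x) (M.f^[n] y) = M.l ^ n * dist x y := by
  induction n with
  | zero => simp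
  | succ n ih =>
    obtain ⟨X, hx, hy⟩ := h n n.lt_succ_self
    rw [Function.iterate_succ_apply', Function.iterate_succ_apply', Subtype.dist_eq, Real.dist_eq,
      coe_f, coe_f, M.abs_map_sub_map_of_mem (Ioo_subset_Icc_self hy) (Ioo_subset_Icc_self hx),
      ← Real.dist_eq, ← Subtype.dist_eq, ih fun i hi => h i (hi.trans n.lt_succ_self)]
    ring

/-- The cell `D` covers itself, so a path through `D` can wait there for any number of steps. -/
lemma exists_forall_pathSet_nonempty (X Y : Cell) :
    ∃ m, ∀ k ≥ m, (pathSet Cell.matrix k X Y).Nonempty := by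
  obtain ⟨m, hm⟩ := exists_pathCount_D_ne_zero X
  refine ⟨m + 1, fun k hk => ?_⟩
  obtain ⟨j, rfl⟩ := Nat.exists_eq_add_of_le hk
  have hj : ∀ j, 1 ≤ pathCount Cell.matrix (1 + j) .D Y := by
    intro j
    induction j with
    | zero => exact one_le_pathCount_D Y
    | succ j ih =>
      exact ih.trans (pathCount_le_succ (T := Cell.matrix) (1 + j) (u := Cell.D) (z := Cell.D) Y
        (by simp))
  by_contra h
  rw [not_nonempty_iff_eq_empty] at h
  have h1 := pathCount_mul_pathCount_le (T := Cell.matrix) m (1 + j) X .D Y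
  rw [← add_assoc, pathCount, pathCount, pathCount, h] at h1
  simp only [encard_empty, ENat.toENNReal_zero, nonpos_iff_eq_zero, mul_eq_zero] at h1
  rcases h1 with h1 | h1
  · exact hm h1
  · have := hj j
    rw [pathCount, h1] at this
    exact absurd this (by simp)

/-- The points that share the first `n` cells of a generic point of `U` lie within `l⁻¹ ^ n` of it,
hence in `U`. From the next cell, paths of every large length lead to the cell of a chosen point of
`V`, and an orbit along such a path can be made to end at that very point. -/
theorem isTopMixing : IsTopMixing M.f := by
  intro U V hU hV hUne hVne
  obtain ⟨x, hxU, hx⟩ := M.exists_generic hU hUne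
  obtain ⟨z, hzV, hz⟩ := M.exists_generic hV hVne
  obtain ⟨Y, hY⟩ := hz 0
  choose X hX using hx
  obtain ⟨r, hr, hball⟩ := Metric.isOpen_iff.1 hU x hxU
  have hlim := tendsto_pow_atTop_nhds_zero_of_lt_one (inv_nonneg.2 M.l_pos.le)
    (inv_lt_one_of_one_lt₀ M.one_lt)
  obtain ⟨n, hn⟩ := (hlim.eventually (gt_mem_nhds hr)).exists
  have hp : (fun i : Fin (n + 1) => X i) ∈ pathSet Cell.matrix n (X 0) (X n) := by
    refine ⟨rfl, rfl, fun i => Cell.matrix_eq_one.2 (M.covers_of_mem (hX i) ?_)⟩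
    rw [← Function.iterate_succ_apply' (f := M.f)]
    exact hX (i + 1)
  obtain ⟨m, hm⟩ := exists_forall_pathSet_nonempty (X n) Y
  refine ⟨n + m, fun k hk => ?_⟩
  obtain ⟨q, hq⟩ := hm (k - n) (by omega)
  obtain ⟨y', hy', hy'q⟩ := M.exists_orbit hq hY
  have hy'X : y' ∈ M.cell (X n) := hq.1 ▸ hy'q 0
  obtain ⟨y, hy, hyp⟩ := M.exists_orbit hp hy'X
  refine ⟨z, ⟨y, hball ?_, ?_⟩, hzV⟩
  · have h1 := M.dist_iterate (n := n) (x := y) (y := x)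
      fun i hi => ⟨X i, hyp ⟨i, by omega⟩, hX i⟩
    have h2 : dist (M.f^[n] y) (M.f^[n] x) ≤ 1 := by
      rw [Subtype.dist_eq]
      exact (Real.dist_le_of_mem_Icc_01 (M.f^[n] y).2 (M.f^[n] x).2)
    rw [h1] at h2
    rw [Metric.mem_ball]
    have hpos : 0 < M.l ^ n := pow_pos M.l_pos n
    have h3 : dist y x ≤ M.l⁻¹ ^ n := by
      rw [inv_pow, ← one_div, le_div_iff₀ hpos]; linarith
    exact h3.trans_lt hn
  · rw [show k = (k - n) + n by omega, Function.iterate_add_apply, hy, hy']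
    rfl

/-! ### Entropy from above, by the Lipschitz constant -/

lemma lipschitzWith_f : LipschitzWith (Real.toNNReal M.l) M.f :=
  LipschitzWith.of_dist_le_mul fun x y => by
    rw [Real.coe_toNNReal _ M.l_pos.le, Subtype.dist_eq, Subtype.dist_eq, Real.dist_eq,
      Real.dist_eq]
    exact M.abs_map_sub_map_le y x

/-- Points at distance at most `ε / (2 * l ^ n)` stay `ε`-close for `n` steps, so a uniform grid of
that mesh is a dynamical cover. -/
lemma exists_isDynCoverOf {ε : ℝ} (hε : 0 < ε) (n : ℕ) :
    ∃ s : Finset (Icc (0 : ℝ) 1), Dynamics.IsDynCoverOf M.f univ {p | dist p.1 p.2 < ε} n s ∧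
      (s.card : ℝ) ≤ (2 / ε + 2) * M.l ^ n := by
  classical
  have hpos : 0 < M.l ^ n := pow_pos M.l_pos n
  have hm0 : 0 < 2 * M.l ^ n / ε := by positivity
  set m := ⌈2 * M.l ^ n / ε⌉₊ with hm
  have hmpos : 0 < m := Nat.ceil_pos.2 hm0
  have hmpos' : (0 : ℝ) < m := by exact_mod_cast hmpos
  have hgrid : ∀ k : Fin (m + 1), (k : ℝ) / m ∈ Icc (0 : ℝ) 1 := fun k =>
    ⟨by positivity, (div_le_one hmpos').2 (by exact_mod_cast Nat.lt_succ_iff.1 k.2)⟩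
  refine ⟨Finset.univ.image fun k : Fin (m + 1) => (⟨(k : ℝ) / m, hgrid k⟩ : Icc (0 : ℝ) 1),
    fun x _ => ?_, ?_⟩
  · have hk : ⌊(x : ℝ) * m⌋₊ < m + 1 := by
      rw [Nat.lt_succ_iff]
      have : (x : ℝ) * m ≤ m := by nlinarith [x.2.2]
      exact_mod_cast (Nat.floor_le (mul_nonneg x.2.1 hmpos'.le)).trans this
    refine ⟨⟨(⌊(x : ℝ) * m⌋₊ : ℝ) / m, hgrid ⟨_, hk⟩⟩, ?_, ?_⟩
    · simp only [Finset.coe_image, Finset.coe_univ, image_univ]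
      exact ⟨⟨_, hk⟩, rfl⟩
    rw [Dynamics.mem_dynEntourage]
    intro j hj
    have h1 : dist x ⟨(⌊(x : ℝ) * m⌋₊ : ℝ) / m, hgrid ⟨_, hk⟩⟩ ≤ 1 / m := by
      rw [Subtype.dist_eq, Real.dist_eq, abs_le]
      have h2 := Nat.floor_le (mul_nonneg x.2.1 hmpos'.le)
      have h3 := (Nat.lt_floor_add_one ((x : ℝ) * m)).le
      have h4 : (⌊(x : ℝ) * m⌋₊ : ℝ) / m ≤ x := by rwa [div_le_iff₀ hmpos']
      have h5 : (x : ℝ) ≤ (⌊(x : ℝ) * m⌋₊ : ℝ) / m + 1 / m := by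
        rw [← add_div, le_div_iff₀ hmpos']; exact h3
      have h6 : 0 ≤ 1 / (m : ℝ) := by positivity
      dsimp only
      constructor <;> linarith
    have h2 := (M.lipschitzWith_f.iterate j).dist_le_mul x
      ⟨(⌊(x : ℝ) * m⌋₊ : ℝ) / m, hgrid ⟨_, hk⟩⟩
    refine h2.trans_lt ?_
    rw [NNReal.coe_pow, Real.coe_toNNReal _ M.l_pos.le]
    have h3 : M.l ^ j ≤ M.l ^ n := pow_le_pow_right₀ M.one_lt.le hj.le
    have h4 : 2 * M.l ^ n / ε ≤ m := Nat.le_ceil _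
    have h5 : M.l ^ n * (1 / m) ≤ ε / 2 := by
      rw [mul_one_div, div_le_iff₀ hmpos']
      rw [div_le_iff₀ hε] at h4
      linarith
    calc _ ≤ M.l ^ n * (1 / m) := by gcongr
      _ < ε := by linarith
  · have h1 : ((Finset.univ.image fun k : Fin (m + 1) =>
        (⟨(k : ℝ) / m, hgrid k⟩ : Icc (0 : ℝ) 1)).card : ℝ) ≤ (m + 1 : ℕ) := by
      have := Finset.card_image_le (s := Finset.univ)
        (f := fun k : Fin (m + 1) => (⟨(k : ℝ) / m, hgrid k⟩ : Icc (0 : ℝ) 1))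
      rw [Finset.card_univ, Fintype.card_fin] at this
      exact_mod_cast this
    have h2 : (m : ℝ) < 2 * M.l ^ n / ε + 1 := Nat.ceil_lt_add_one hm0.le
    have h3 : 1 ≤ M.l ^ n := one_le_pow₀ M.one_lt.le
    refine h1.trans ?_
    push_cast
    have h4 : 2 * M.l ^ n / ε = 2 / ε * M.l ^ n := by ring
    linarith

lemma coverEntropy_le : Dynamics.coverEntropy M.f univ ≤ ENNReal.log (ENNReal.ofReal M.l) := by
  refine iSup₂_le fun U hU => ?_
  obtain ⟨ε, hε, hεU⟩ := Metric.mem_uniformity_dist.1 hU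
  rw [Dynamics.coverEntropyEntourage, ← ExpGrowth.expGrowthSup_pow]
  refine ExpGrowth.expGrowthSup_le_of_eventually_le (b := ENNReal.ofReal (2 / ε + 2))
    ENNReal.ofReal_ne_top (Eventually.of_forall fun n => ?_)
  obtain ⟨s, hs, hcard⟩ := M.exists_isDynCoverOf hε n
  have h1 := (hs.of_entourage_subset (V := U) fun p hp => hεU hp).coverMincard_le_card
  calc (Dynamics.coverMincard M.f univ U n : ℝ≥0∞) ≤ ((s.card : ℕ∞) : ℝ≥0∞) :=
        ENat.toENNReal_mono h1
    _ = ENNReal.ofReal s.card := by simp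
    _ ≤ ENNReal.ofReal ((2 / ε + 2) * M.l ^ n) := ENNReal.ofReal_le_ofReal hcard
    _ = _ := by
      rw [ENNReal.ofReal_mul (by positivity), ENNReal.ofReal_pow M.l_pos.le]

end Model

/-! ### Entropy from below, by horseshoes -/

lemma exists_pos_forall_le_dist {X ι : Type*} [PseudoMetricSpace X] [T2Space X] [Finite ι]
    {Z : ι → Set X}
    (hZ : ∀ i, IsCompact (Z i)) (hd : Pairwise fun i j => Disjoint (Z i) (Z j)) :
    ∃ δ : ℝ, 0 < δ ∧ ∀ i j, i ≠ j → ∀ x ∈ Z i, ∀ y ∈ Z j, δ ≤ dist x y := by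
  have h : ∀ q : ι × ι, ∀ᶠ δ in 𝓝[>] (0 : ℝ), q.1 ≠ q.2 → ∀ x ∈ Z q.1, ∀ y ∈ Z q.2,
      δ ≤ dist x y := by
    rintro ⟨i, j⟩
    by_cases hij : i = j
    · exact Eventually.of_forall fun δ h => absurd hij h
    obtain ⟨r, hr, hlt⟩ := Metric.exists_pos_forall_lt_edist (hZ i) (hZ j).isClosed (hd hij)
    filter_upwards [Ioo_mem_nhdsGT (show (0 : ℝ) < r from hr)] with δ hδ _ x hx y hy
    have h1 := hlt x hx y hy
    rw [edist_nndist, ENNReal.coe_lt_coe] at h1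
    have h2 : (r : ℝ) < dist x y := by exact_mod_cast h1
    exact (hδ.2.trans h2).le
  obtain ⟨δ, hδ, h0⟩ := ((eventually_all.2 h).and self_mem_nhdsWithin).exists
  exact ⟨δ, h0, fun i j hij => hδ (i, j) hij⟩

/-- A lower bound for the topological entropy in terms of a horseshoe. -/
lemma log_le_coverEntropy_of_horseshoe {X ι : Type*} [MetricSpace X] [Fintype ι] {T : X → X}
    {Z : ι → Set X} (hZ : ∀ i, IsCompact (Z i)) (hd : Pairwise fun i j => Disjoint (Z i) (Z j))
    {N : ℕ} (hN : 0 < N) (horb : ∀ s : ℕ → ι, ∀ k, ∃ x, ∀ j < k, T^[j * N] x ∈ Z (s j))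
    {β : ℝ≥0∞} (hβ : β ^ N ≤ Fintype.card ι) :
    ENNReal.log β ≤ Dynamics.coverEntropy T univ := by
  classical
  rcases isEmpty_or_nonempty ι with hι | ⟨⟨i₀⟩⟩
  · have : β = 0 := by simpa [hN.ne'] using hβ
    simp [this]
  obtain ⟨δ, hδ, hsep⟩ := exists_pos_forall_le_dist hZ hd
  -- The dynamical balls around the points of a net must be disjoint, hence half of the separation
  -- `δ`.
  have hU : {p : X × X | dist p.1 p.2 < δ / 2} ∈ uniformity X :=
    Metric.dist_mem_uniformity (half_pos hδ)
  refine le_trans ?_ (Dynamics.netEntropyEntourage_le_coverEntropy T univ hU)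
  refine Frequently.le_expGrowthSup (frequently_atTop.2 fun a => ?_)
  refine ⟨a * N, Nat.le_mul_of_pos_right a hN, ?_⟩
  let ext : (Fin a → ι) → ℕ → ι := fun s j => if h : j < a then s ⟨j, h⟩ else i₀
  choose x hx using fun s : Fin a → ι => horb (ext s) a
  have hx' : ∀ s (j : Fin a), T^[j * N] (x s) ∈ Z (s j) := fun s j => by
    have := hx s j j.2
    simpa [ext] using this
  have key : ∀ s t : Fin a → ι, s ≠ t → ∃ i < a * N, δ ≤ dist (T^[i] (x s)) (T^[i] (x t)) := by
    intro s t hst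
    obtain ⟨j, hj⟩ := Function.ne_iff.1 hst
    exact ⟨j * N, Nat.mul_lt_mul_of_pos_right j.2 hN, hsep _ _ hj _ (hx' s j) _ (hx' t j)⟩
  have hinj : Function.Injective x := by
    intro s t hst
    by_contra h
    obtain ⟨i, -, hi⟩ := key s t h
    rw [hst, dist_self] at hi
    linarith
  have hnet : Dynamics.IsDynNetIn T univ {p : X × X | dist p.1 p.2 < δ / 2} (a * N)
      (Finset.univ.image x : Finset X) := by
    refine ⟨subset_univ _, ?_⟩
    intro y hy z hz hyz
    simp only [Finset.coe_image, Finset.coe_univ, image_univ, mem_range] at hy hz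
    obtain ⟨s, rfl⟩ := hy
    obtain ⟨t, rfl⟩ := hz
    obtain ⟨i, hi, hle⟩ := key s t fun h => hyz (h ▸ rfl)
    refine Set.disjoint_left.2 fun w hw hw' => ?_
    have h1 : dist (T^[i] (x s)) (T^[i] w) < δ / 2 := Dynamics.mem_ball_dynEntourage.1 hw i hi
    have h2 : dist (T^[i] (x t)) (T^[i] w) < δ / 2 := Dynamics.mem_ball_dynEntourage.1 hw' i hi
    linarith [dist_triangle_right (T^[i] (x s)) (T^[i] (x t)) (T^[i] w)]
  have hcard := hnet.card_le_netMaxcard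
  rw [Finset.card_image_of_injective _ hinj, Finset.card_univ, Fintype.card_fun,
    Fintype.card_fin] at hcard
  calc EReal.exp (ENNReal.log β * (a * N : ℕ)) = (β ^ N) ^ a := by
        rw [mul_comm, EReal.exp_nmul, ENNReal.exp_log, mul_comm, pow_mul]
    _ ≤ (Fintype.card ι : ℝ≥0∞) ^ a := by gcongr
    _ = (((Fintype.card ι ^ a : ℕ) : ℕ∞) : ℝ≥0∞) := by simp
    _ ≤ _ := ENat.toENNReal_mono hcard

namespace Model

variable (M : Model)

/-- The set of points following a path of closed cells and then entering the cell `C 0`. -/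
def cylinder {m : ℕ} (p : Fin (m + 1) → Cell) : Set (Icc (0 : ℝ) 1) :=
  {x | (∀ i : Fin (m + 1), ((M.f^[i] x : Icc (0 : ℝ) 1) : ℝ) ∈
      Icc (M.pos (p i).lo) (M.pos (p i).hi)) ∧
    ((M.f^[m + 1] x : Icc (0 : ℝ) 1) : ℝ) ∈ Icc (M.left 1) (M.left 2)}

lemma isCompact_cylinder {m : ℕ} (p : Fin (m + 1) → Cell) : IsCompact (M.cylinder p) := by
  have hc : ∀ n, Continuous fun x => ((M.f^[n] x : Icc (0 : ℝ) 1) : ℝ) := fun n =>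
    continuous_subtype_val.comp (M.continuous_f.iterate n)
  have h : M.cylinder p = (⋂ i : Fin (m + 1), (fun x => ((M.f^[i] x : Icc (0 : ℝ) 1) : ℝ)) ⁻¹'
      Icc (M.pos (p i).lo) (M.pos (p i).hi)) ∩
      (fun x => ((M.f^[m + 1] x : Icc (0 : ℝ) 1) : ℝ)) ⁻¹' Icc (M.left 1) (M.left 2) := by
    ext x
    rw [mem_inter_iff, mem_iInter]
    rfl
  rw [h]
  exact ((isClosed_iInter fun i : Fin (m + 1) => isClosed_Icc.preimage (hc i)).inter
    (isClosed_Icc.preimage (hc _))).isCompact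

lemma eq_of_mem_cell_of_mem_Icc {X Y : Cell} {x : Icc (0 : ℝ) 1} (hX : x ∈ M.cell X)
    (hY : (x : ℝ) ∈ Icc (M.pos Y.lo) (M.pos Y.hi)) : X = Y := by
  rcases X.leftOf_or_eq_or_leftOf Y with h | h | h
  · exact absurd (M.hi_le_lo h) (not_le.2 (hX.2.trans_le' hY.1))
  · exact h
  · exact absurd (M.hi_le_lo h) (not_le.2 (hX.1.trans_le hY.2))

lemma iterate_mem_part {x : Icc (0 : ℝ) 1} (hx : x ∈ M.part) (n : ℕ) : M.f^[n] x ∈ M.part :=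
  M.mapsTo_part.iterate n hx

/-- Closed cells share endpoints, so a common point of two cylinders would have an orbit that enters
the partition set by time `m`. It would then be at `left 0` or `left 1`, the ends of `D`, whose
images `1` and `0` lie outside the closure of `C 0`. Excluding this is the purpose of the extra
visit to `C 0`. -/
lemma disjoint_cylinder {m : ℕ} {p q : Fin (m + 1) → Cell} (hp : p (Fin.last m) = .D)
    (hpq : p ≠ q) : Disjoint (M.cylinder p) (M.cylinder q) := by
  refine Set.disjoint_left.2 fun x hxp hxq => ?_
  obtain ⟨i, hi⟩ := Function.ne_iff.1 hpq
  have hpart : M.f^[i] x ∈ M.part := by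
    by_contra h
    obtain ⟨X, hX⟩ := M.notMem_part_iff.1 h
    exact hi ((M.eq_of_mem_cell_of_mem_Icc hX (hxp.1 i)).symm.trans
      (M.eq_of_mem_cell_of_mem_Icc hX (hxq.1 i)))
  have hm : M.f^[m] x ∈ M.part := by
    have := M.iterate_mem_part hpart (m - i)
    rwa [← Function.iterate_add_apply, Nat.sub_add_cancel (Nat.lt_succ_iff.1 i.2)] at this
  obtain ⟨t, ht⟩ := M.mem_part_iff.1 hm
  have h1 := hxp.1 (Fin.last m)
  rw [hp, Fin.val_last, ht] at h1
  have h2 := hxp.2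
  rw [Function.iterate_succ_apply', coe_f, ht, map_pos] at h2
  have h3 : t.Le (.left 1) := M.pos_le_pos.1 h1.2
  have h4 : (Pt.left 1).Le t.step := M.pos_le_pos.1 h2.1
  have h5 : t.step.Le (.left 2) := M.pos_le_pos.1 h2.2
  match t, h3, h4, h5 with
  | .left 0, _, _, h5 => exact h5
  | .left 1, _, h4, _ => exact absurd (show 1 ≤ 0 from h4) (by norm_num)
  | .left (n + 2), h3, _, _ => exact absurd (show n + 2 ≤ 1 from h3) (by omega)

lemma exists_mem_cylinder {m : ℕ} (s : ℕ → pathSet Cell.matrix m Cell.D Cell.D) (k : ℕ) :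
    ∃ x ∈ M.cell .D, ∀ j < k, M.f^[j * (m + 2)] x ∈ M.cylinder (s j).1 := by
  induction k generalizing s with
  | zero =>
    obtain ⟨x, hx⟩ := M.cell_nonempty .D
    exact ⟨x, hx, fun j hj => absurd hj (Nat.not_lt_zero j)⟩
  | succ k ih =>
    obtain ⟨z, hz, hzk⟩ := ih fun j => s (j + 1)
    obtain ⟨c, hc, hcz⟩ := M.exists_preimage (X := Cell.C 0) (Y := Cell.D) rfl hz
    obtain ⟨d, hd, hdc⟩ := M.exists_preimage (X := Cell.D) (Y := Cell.C 0) trivial hc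
    obtain ⟨x, hxd, hx⟩ := M.exists_orbit (s 0).2 hd
    have h1 : M.f^[m + 1] x = c := by rw [Function.iterate_succ_apply', hxd, hdc]
    have h2 : M.f^[m + 2] x = z := by rw [Function.iterate_succ_apply', h1, hcz]
    refine ⟨x, (s 0).2.1 ▸ hx 0, fun j hj => ?_⟩
    cases j with
    | zero =>
      refine ⟨fun i => ?_, ?_⟩
      · rw [Nat.zero_mul, Function.iterate_zero_apply]
        exact Ioo_subset_Icc_self (hx i)
      · rw [Nat.zero_mul, Function.iterate_zero_apply, h1]
        exact Ioo_subset_Icc_self hc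
    | succ j =>
      rw [Nat.succ_mul, Function.iterate_add_apply, h2]
      exact hzk j (Nat.lt_of_succ_lt_succ hj)

/-- The loops of length `m` at `D` are closed up by the detour from `D` through `C 0` back to `D`,
which accounts for the exponent `m + 2`; their cylinders form a horseshoe. -/
lemma log_le_coverEntropy_of_pow_le {m : ℕ} {β : ℝ≥0∞}
    (hβ : β ^ (m + 2) ≤ pathCount Cell.matrix m .D .D) :
    ENNReal.log β ≤ Dynamics.coverEntropy M.f univ := by
  have hfin : (pathSet Cell.matrix m Cell.D Cell.D).Finite := by
    rw [← encard_ne_top_iff]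
    have h1 := M.pathCount_self_le m .D
    intro h
    rw [pathCount, h, ENat.toENNReal_top, top_le_iff] at h1
    exact ENNReal.pow_ne_top ENNReal.ofReal_ne_top h1
  have := hfin.fintype
  refine log_le_coverEntropy_of_horseshoe
    (Z := fun p : pathSet Cell.matrix m Cell.D Cell.D => M.cylinder p.1)
    (fun p => M.isCompact_cylinder p.1)
    (fun p q hpq => M.disjoint_cylinder p.2.2.1 fun h => hpq (Subtype.ext h))
    (Nat.succ_pos (m + 1)) (fun s k => ?_) ?_
  · obtain ⟨x, -, hx⟩ := M.exists_mem_cylinder s k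
    exact ⟨x, hx⟩
  · rw [pathCount, ← Set.coe_fintypeCard, ENat.toENNReal_coe] at hβ
    exact hβ

theorem coverEntropy_eq (h : M.l ^ 3 - 2 * M.l ^ 2 - M.l - 2 = 0) :
    Dynamics.coverEntropy M.f univ = ((Real.log M.l : ℝ) : EReal) := by
  rw [← ENNReal.log_ofReal_of_pos M.l_pos]
  refine le_antisymm M.coverEntropy_le ?_
  rw [← EReal.log_exp (Dynamics.coverEntropy M.f univ), ENNReal.log_le_log_iff]
  refine le_of_forall_lt fun b hb => ?_
  obtain ⟨r, hr0, hbr, hr⟩ := ENNReal.lt_iff_exists_real_btwn.1 hb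
  refine hbr.trans_le ?_
  rw [← ENNReal.log_le_log_iff, EReal.log_exp]
  have hrl : r < M.l := (ENNReal.ofReal_lt_ofReal_iff M.l_pos).1 hr
  obtain ⟨ρ, hrρ, hρ⟩ := exists_between hrl
  have hρ0 : 0 < ρ := hr0.trans_lt hrρ
  obtain ⟨c, hc, hcn⟩ := exists_real_le_pathCount h hρ0 hρ
  -- Loops of length `n + 1` give a horseshoe of period `n + 3`, so the goal is `r ^ (n + 3) ≤ c * ρ
  -- ^ n`.
  have hlim : Tendsto (fun n : ℕ => (r / ρ : ℝ) ^ n * r ^ 3) atTop (𝓝 0) := by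
    simpa using (tendsto_pow_atTop_nhds_zero_of_lt_one (r := (r / ρ : ℝ)) (by positivity)
      ((div_lt_one hρ0).2 hrρ)).mul_const (r ^ 3)
  obtain ⟨n, hn⟩ := (hlim.eventually (gt_mem_nhds hc)).exists
  refine M.log_le_coverEntropy_of_pow_le (m := n + 1) (le_trans ?_ (hcn n))
  rw [← ENNReal.ofReal_pow hr0]
  refine ENNReal.ofReal_le_ofReal ?_
  rw [div_pow, div_mul_eq_mul_div, div_lt_iff₀ (pow_pos hρ0 n), ← pow_add] at hn
  exact hn.le

end Model

/-! ### Constant slope on the extended real line -/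

lemma abs_sub_le_of_hasDerivAt_off_countable {h : ℝ → ℝ} {u v l : ℝ} (huv : u ≤ v) {S : Set ℝ}
    (hS : S.Countable) (hc : ContinuousOn h (Icc u v))
    (hd : ∀ t ∈ Ioo u v \ S, ∃ s, |s| ≤ l ∧ HasDerivAt h s t) :
    |h v - h u| ≤ l * |v - u| := by
  have hd' : ∀ t ∈ Ioo u v \ S, |deriv h t| ≤ l ∧ HasDerivAt h (deriv h t) t := by
    intro t ht
    obtain ⟨s, hs, hst⟩ := hd t ht
    rw [hst.deriv]
    exact ⟨hs, hst⟩
  have hS' : (S ∪ {v}).Countable := hS.union (countable_singleton v)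
  have hb : ∀ᵐ t, t ∈ uIoc u v → ‖deriv h t‖ ≤ l := by
    filter_upwards [hS'.ae_notMem MeasureTheory.volume] with t ht htu
    rw [uIoc_of_le huv] at htu
    rw [mem_union, mem_singleton_iff, not_or] at ht
    exact (hd' t ⟨⟨htu.1, lt_of_le_of_ne htu.2 ht.2⟩, ht.1⟩).1
  have hint : IntervalIntegrable (deriv h) MeasureTheory.volume u v := by
    refine (intervalIntegrable_const (c := l)).mono_fun
      (measurable_deriv h).aestronglyMeasurable ?_
    rw [Filter.EventuallyLE, MeasureTheory.ae_restrict_iff' measurableSet_uIoc]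
    filter_upwards [hb] with t ht htu
    exact (ht htu).trans (le_abs_self l)
  rw [← MeasureTheory.integral_eq_of_hasDerivAt_off_countable_of_le h (deriv h) huv hS hc
    (fun t ht => (hd' t ht).2) hint]
  exact intervalIntegral.norm_integral_le_of_norm_le_const_ae hb

/-- The set `Q` is an arbitrary closed countable set, so the mean value bound must tolerate a
countable exceptional set. Finiteness of `g` along the whole interval matters because `EReal.toReal`
is discontinuous at the infinities, where it takes the value `0`. -/
lemma abs_toReal_sub_toReal_le {a b : EReal} {g : Icc a b → Icc a b} {Q : Set (Icc a b)} {l : ℝ}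
    (hg : IsCPMM g Q) (hl : HasConstantSlopeExt g Q l) {p q : Icc a b} (hpq : p ≤ q)
    (hp : (p : EReal) ≠ ⊥) (hq : (q : EReal) ≠ ⊤)
    (hfin : ∀ r ∈ Icc p q, (g r : EReal) ≠ ⊥ ∧ (g r : EReal) ≠ ⊤) :
    |(g q : EReal).toReal - (g p : EReal).toReal| ≤
      |l| * |(q : EReal).toReal - (p : EReal).toReal| := by
  have hpq' : (p : EReal) ≤ q := hpq
  have hp' : (p : EReal) ≠ ⊤ := fun h => hq (top_le_iff.1 (h ▸ hpq'))
  have hq' : (q : EReal) ≠ ⊥ := fun h => hp (le_bot_iff.1 (h ▸ hpq'))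
  obtain ⟨u, hu⟩ : ∃ u : ℝ, (p : EReal) = u := ⟨_, (EReal.coe_toReal hp' hp).symm⟩
  obtain ⟨v, hv⟩ : ∃ v : ℝ, (q : EReal) = v := ⟨_, (EReal.coe_toReal hq hq').symm⟩
  have huv : u ≤ v := by rw [hu, hv] at hpq'; exact_mod_cast hpq'
  let e : ℝ → Icc a b := fun t => projIcc a b hg.lt.le t
  have he : ∀ t ∈ Icc u v, (e t : EReal) = t := by
    intro t ht
    have h1 : (t : EReal) ∈ Icc a b :=
      ⟨p.2.1.trans (by rw [hu]; exact_mod_cast ht.1),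
        le_trans (by rw [hv]; exact_mod_cast ht.2) q.2.2⟩
    exact congrArg Subtype.val (projIcc_of_mem hg.lt.le h1)
  have hec : Continuous e := continuous_projIcc.comp continuous_coe_real_ereal
  have hemem : ∀ t ∈ Icc u v, e t ∈ Icc p q := by
    intro t ht
    constructor
    · change (p : EReal) ≤ e t
      rw [he t ht, hu]; exact_mod_cast ht.1
    · change (e t : EReal) ≤ q
      rw [he t ht, hv]; exact_mod_cast ht.2
  have hep : e u = p := Subtype.ext ((he u (left_mem_Icc.2 huv)).trans hu.symm)
  have heq : e v = q := Subtype.ext ((he v (right_mem_Icc.2 huv)).trans hv.symm)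
  rw [hu, hv, EReal.toReal_coe, EReal.toReal_coe, ← hep, ← heq]
  refine abs_sub_le_of_hasDerivAt_off_countable (h := fun t => (g (e t) : EReal).toReal) huv
    (S := Icc u v ∩ e ⁻¹' Q) ?_ ?_ ?_
  · refine MapsTo.countable_of_injOn (f := e) (t := Q) (fun x hx => hx.2) ?_ hg.countable
    intro x hx y hy hxy
    have := congrArg Subtype.val hxy
    rw [he x hx.1, he y hy.1] at this
    exact_mod_cast this
  · intro t ht
    obtain ⟨h1, h2⟩ := hfin _ (hemem t ht)
    have h3 := EReal.tendsto_toReal h2 h1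
    exact (ContinuousAt.comp (f := fun t => (g (e t) : EReal)) h3
      (continuous_subtype_val.comp (hg.continuous.comp hec)).continuousAt).continuousWithinAt
  · rintro t ⟨ht, htQ⟩
    have htQ' : e t ∉ Q := fun h => htQ ⟨Ioo_subset_Icc_self ht, h⟩
    obtain ⟨s, c, hs, hsc⟩ := hl _ ⟨e t, htQ', rfl⟩
    refine ⟨s, hs.le.trans (le_abs_self l), ?_⟩
    have hopen : IsOpen (Ioo u v ∩ e ⁻¹' Qᶜ) :=
      isOpen_Ioo.inter (hg.isClosed.isOpen_compl.preimage hec)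
    obtain ⟨r, hr, hball⟩ := Metric.isOpen_iff.1 hopen t ⟨ht, htQ'⟩
    have hJ : e '' Metric.ball t r ⊆ connectedComponentIn Qᶜ (e t) := by
      refine IsPreconnected.subset_connectedComponentIn
        ((convex_ball t r).isPreconnected.image e hec.continuousOn)
        (mem_image_of_mem e (Metric.mem_ball_self hr)) ?_
      rintro _ ⟨x, hx, rfl⟩
      exact (hball hx).2
    have hlin : HasDerivAt (fun x : ℝ => s * x + c) s t := by
      simpa using ((hasDerivAt_id t).const_mul s).add_const c
    refine hlin.congr_of_eventuallyEq ?_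
    filter_upwards [Metric.ball_mem_nhds t hr] with x hx
    rw [hsc (e x) (hJ (mem_image_of_mem e hx)) x (he x (Ioo_subset_Icc_self (hball hx).1)),
      EReal.toReal_coe]

section Conjugacy

variable {a b : EReal} {ψ : Icc (0 : ℝ) 1 ≃ₜ Icc a b}

lemma Homeomorph.le_iff_le_or_le_iff_ge (ψ : Icc (0 : ℝ) 1 ≃ₜ Icc a b) :
    (∀ x y, ψ x ≤ ψ y ↔ x ≤ y) ∨ ∀ x y, ψ x ≤ ψ y ↔ y ≤ x :=
  (ψ.continuous.strictMono_of_inj_boundedOrder' ψ.injective).imp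
    (fun h _ _ => h.le_iff_le) (fun h _ _ => h.le_iff_ge)

/-- A point strictly between two others in the image is an interior point. -/
lemma mem_Ioo_of_lt_of_lt {x y z : Icc (0 : ℝ) 1} (hxy : ψ x < ψ y) (hyz : ψ y < ψ z) :
    (y : ℝ) ∈ Ioo (0 : ℝ) 1 := by
  rcases ψ.le_iff_le_or_le_iff_ge with h | h <;> rw [← not_le, h, not_le] at hxy hyz
  · exact ⟨x.2.1.trans_lt hxy, lt_of_lt_of_le hyz z.2.2⟩
  · exact ⟨z.2.1.trans_lt hyz, lt_of_lt_of_le hxy x.2.2⟩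

lemma ne_bot_and_ne_top_of_mem_Ioo {x : Icc (0 : ℝ) 1} (hx : (x : ℝ) ∈ Ioo (0 : ℝ) 1) :
    (ψ x : EReal) ≠ ⊥ ∧ (ψ x : EReal) ≠ ⊤ := by
  have h0 : ¬ x ≤ ⟨0, by simp⟩ := not_le.2 hx.1
  have h1 : ¬ ⟨1, by simp⟩ ≤ x := not_le.2 hx.2
  have key : ∃ p q, ¬ ψ x ≤ ψ p ∧ ¬ ψ q ≤ ψ x := by
    rcases ψ.le_iff_le_or_le_iff_ge with h | h <;> rw [← h] at h0 h1
    exacts [⟨_, _, h0, h1⟩, ⟨_, _, h1, h0⟩]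
  obtain ⟨p, q, hp, hq⟩ := key
  constructor
  · intro h
    exact hp (show (ψ x : EReal) ≤ ψ p by rw [h]; exact bot_le)
  · intro h
    exact hq (show (ψ q : EReal) ≤ ψ x by rw [h]; exact le_top)

lemma symm_mem_of_mem_Icc {O : Set (Icc (0 : ℝ) 1)} (hO : O.OrdConnected) {x y : Icc (0 : ℝ) 1}
    (hx : x ∈ O) (hy : y ∈ O) {r : Icc a b} (hr : r ∈ Icc (ψ x) (ψ y)) : ψ.symm r ∈ O := by
  have h1 : ψ x ≤ ψ (ψ.symm r) := by rw [ψ.apply_symm_apply]; exact hr.1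
  have h2 : ψ (ψ.symm r) ≤ ψ y := by rw [ψ.apply_symm_apply]; exact hr.2
  rcases ψ.le_iff_le_or_le_iff_ge with h | h <;> rw [h] at h1 h2
  exacts [hO.out hx hy ⟨h1, h2⟩, hO.out hy hx ⟨h2, h1⟩]

/-- One application of `f` increases diameters, measured on the line through `ψ`, by a factor of at
most `|l|`. Only interior points are used, since `ψ` may be infinite at `0` and `1`. -/
lemma abs_toReal_sub_le_of_conj {f : Icc (0 : ℝ) 1 → Icc (0 : ℝ) 1} {g : Icc a b → Icc a b}
    {Q : Set (Icc a b)} {l R : ℝ} (hg : IsCPMM g Q) (hl : HasConstantSlopeExt g Q l)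
    (hfg : ∀ x, ψ (f x) = g (ψ x)) {O : Set (Icc (0 : ℝ) 1)} (hO : O.OrdConnected)
    (hO1 : ∀ x ∈ O, (x : ℝ) ∈ Ioo (0 : ℝ) 1) (hO2 : ∀ x ∈ O, (f x : ℝ) ∈ Ioo (0 : ℝ) 1)
    (hR : ∀ x ∈ O, ∀ y ∈ O, |(ψ y : EReal).toReal - (ψ x : EReal).toReal| ≤ R) :
    ∀ x ∈ O, ∀ y ∈ O, |(ψ (f y) : EReal).toReal - (ψ (f x) : EReal).toReal| ≤ |l| * R := by
  have key : ∀ x ∈ O, ∀ y ∈ O, ψ x ≤ ψ y →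
      |(ψ (f y) : EReal).toReal - (ψ (f x) : EReal).toReal| ≤ |l| * R := by
    intro x hx y hy hxy
    rw [hfg, hfg]
    refine (abs_toReal_sub_toReal_le hg hl hxy (ne_bot_and_ne_top_of_mem_Ioo (hO1 x hx)).1
      (ne_bot_and_ne_top_of_mem_Ioo (hO1 y hy)).2 fun r hr => ?_).trans
      (mul_le_mul_of_nonneg_left (hR x hx y hy) (abs_nonneg l))
    have := ne_bot_and_ne_top_of_mem_Ioo (ψ := ψ) (hO2 _ (symm_mem_of_mem_Icc hO hx hy hr))
    rwa [hfg, ψ.apply_symm_apply] at this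
  intro x hx y hy
  rcases le_total (ψ x) (ψ y) with h | h
  · exact key x hx y hy h
  · rw [abs_sub_comm]; exact key y hy x hx h

/-- On an infinite interval the interior points are not within bounded distance. -/
lemma exists_lt_abs_sub_of_eq_bot_or_eq_top (hab : a = ⊥ ∨ b = ⊤) {w : Icc (0 : ℝ) 1}
    (hw : (w : ℝ) ∈ Ioo (0 : ℝ) 1) (R : ℝ) :
    ∃ x : Icc (0 : ℝ) 1, (x : ℝ) ∈ Ioo (0 : ℝ) 1 ∧
      R < |(ψ x : EReal).toReal - (ψ w : EReal).toReal| := by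
  obtain ⟨h1, h2⟩ := ne_bot_and_ne_top_of_mem_Ioo (ψ := ψ) hw
  obtain ⟨u, hu⟩ : ∃ u : ℝ, (ψ w : EReal) = u := ⟨_, (EReal.coe_toReal h2 h1).symm⟩
  have hab' : a ≤ u ∧ (u : EReal) ≤ b := hu ▸ (ψ w).2
  have hR : R ≤ |R| := le_abs_self R
  have hR0 : 0 ≤ |R| := abs_nonneg R
  rcases hab with rfl | rfl
  · have hmem : ∀ t : ℝ, t ≤ u → (t : EReal) ∈ Icc ⊥ b := fun t ht =>
      ⟨bot_le, (EReal.coe_le_coe ht).trans hab'.2⟩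
    -- The point `q` is the witness; `p` lies beyond it only to certify that the preimage of `q` is
    -- interior.
    let p : Icc ⊥ b := ⟨_, hmem (u - |R| - 2) (by linarith)⟩
    let q : Icc ⊥ b := ⟨_, hmem (u - |R| - 1) (by linarith)⟩
    have hpq : p < q := EReal.coe_lt_coe (by linarith)
    have hqw : q < ψ w := show (q : EReal) < ψ w by rw [hu]; exact EReal.coe_lt_coe (by linarith)
    refine ⟨ψ.symm q, mem_Ioo_of_lt_of_lt (ψ := ψ) (x := ψ.symm p) (z := w) (by simpa using hpq)
      (by simpa using hqw), ?_⟩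
    rw [ψ.apply_symm_apply, hu, EReal.toReal_coe, EReal.toReal_coe, abs_sub_comm]
    refine lt_of_lt_of_le ?_ (le_abs_self _)
    linarith
  · have hmem : ∀ t : ℝ, u ≤ t → (t : EReal) ∈ Icc a ⊤ := fun t ht =>
      ⟨hab'.1.trans (EReal.coe_le_coe ht), le_top⟩
    let p : Icc a ⊤ := ⟨_, hmem (u + |R| + 2) (by linarith)⟩
    let q : Icc a ⊤ := ⟨_, hmem (u + |R| + 1) (by linarith)⟩
    have hpq : q < p := EReal.coe_lt_coe (by linarith)
    have hqw : ψ w < q := show (ψ w : EReal) < q by rw [hu]; exact EReal.coe_lt_coe (by linarith)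
    refine ⟨ψ.symm q, mem_Ioo_of_lt_of_lt (ψ := ψ) (x := w) (z := ψ.symm p) (by simpa using hqw)
      (by simpa using hpq), ?_⟩
    rw [ψ.apply_symm_apply, hu, EReal.toReal_coe, EReal.toReal_coe]
    refine lt_of_lt_of_le ?_ (le_abs_self _)
    linarith

lemma abs_toReal_sub_le_of_mem_Icc {x y z w : Icc (0 : ℝ) 1} (hx : (x : ℝ) ∈ Ioo (0 : ℝ) 1)
    (hy : (y : ℝ) ∈ Ioo (0 : ℝ) 1) (hz : z ∈ Icc x y) (hw : w ∈ Icc x y) :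
    |(ψ w : EReal).toReal - (ψ z : EReal).toReal| ≤
      |(ψ y : EReal).toReal - (ψ x : EReal).toReal| := by
  have hmono : ∀ s t : Icc (0 : ℝ) 1, (s : ℝ) ∈ Ioo (0 : ℝ) 1 → (t : ℝ) ∈ Ioo (0 : ℝ) 1 →
      ψ s ≤ ψ t → (ψ s : EReal).toReal ≤ (ψ t : EReal).toReal := fun s t hs ht hst =>
    EReal.toReal_le_toReal hst (ne_bot_and_ne_top_of_mem_Ioo hs).1
      (ne_bot_and_ne_top_of_mem_Ioo ht).2
  have hin : ∀ s ∈ Icc x y, (s : ℝ) ∈ Ioo (0 : ℝ) 1 := fun s hs =>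
    ⟨hx.1.trans_le hs.1, lt_of_le_of_lt hs.2 hy.2⟩
  have hz' := hin z hz
  have hw' := hin w hw
  rcases ψ.le_iff_le_or_le_iff_ge with h | h
  · have h1 := hmono x z hx hz' ((h _ _).2 hz.1)
    have h2 := hmono z y hz' hy ((h _ _).2 hz.2)
    have h3 := hmono x w hx hw' ((h _ _).2 hw.1)
    have h4 := hmono w y hw' hy ((h _ _).2 hw.2)
    rw [abs_of_nonneg (by linarith : 0 ≤ (ψ y : EReal).toReal - (ψ x : EReal).toReal), abs_le]
    constructor <;> linarith
  · have h1 := hmono z x hz' hx ((h _ _).2 hz.1)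
    have h2 := hmono y z hy hz' ((h _ _).2 hz.2)
    have h3 := hmono w x hw' hx ((h _ _).2 hw.1)
    have h4 := hmono y w hy hw' ((h _ _).2 hw.2)
    rw [abs_of_nonpos (by linarith : (ψ y : EReal).toReal - (ψ x : EReal).toReal ≤ 0), abs_le]
    constructor <;> linarith

end Conjugacy

namespace Model

variable (M : Model)

lemma image_cell_D {x : Icc (0 : ℝ) 1} (hx : (x : ℝ) ∈ Ioo (0 : ℝ) 1) :
    ∃ y ∈ M.cell .D, M.f y = x := by
  have h : (x : ℝ) ∈ Ioo (M.pos Cell.D.imLo) (M.pos Cell.D.imHi) := by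
    simpa only [Cell.imLo, Cell.imHi, Grid.pos, M.left_zero, M.right_zero] using hx
  rw [← val_image_f_cell] at h
  obtain ⟨_, ⟨y, hy, rfl⟩, hyx⟩ := h
  exact ⟨y, hy, Subtype.ext hyx⟩

lemma f_mem_Ioo {X : Cell} {x : Icc (0 : ℝ) 1} (hx : x ∈ M.cell X) :
    (M.f x : ℝ) ∈ Ioo (0 : ℝ) 1 := by
  have h : (M.f x : ℝ) ∈ Ioo (M.pos X.imLo) (M.pos X.imHi) := by
    rw [← val_image_f_cell]; exact mem_image_of_mem _ (mem_image_of_mem _ hx)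
  exact ⟨(M.pos_nonneg _).trans_lt h.1, h.2.trans_le (M.pos_le_one _)⟩

lemma mem_Ioo_of_mem_cell {X : Cell} {x : Icc (0 : ℝ) 1} (hx : x ∈ M.cell X) :
    (x : ℝ) ∈ Ioo (0 : ℝ) 1 :=
  ⟨(M.pos_nonneg _).trans_lt hx.1, hx.2.trans_le (M.pos_le_one _)⟩

/-- The ends of `C 0` are interior points, so `C 0` has a finite length on the line. Its image is
`D`, whose image is all of the open interval, so two steps of slope `l` would bound the interior of
an infinite interval. -/
theorem not_isConjugateTo_of_eq_bot_or_eq_top {a b : EReal} {g : Icc a b → Icc a b}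
    {Q : Set (Icc a b)} {l : ℝ} (hab : a = ⊥ ∨ b = ⊤) (hg : IsCPMM g Q)
    (hl : HasConstantSlopeExt g Q l) : ¬ IsConjugateTo M.f g := by
  rintro ⟨ψ, hψ⟩
  have hmem : ∀ n, (M.left (n + 1)) ∈ Ioo (0 : ℝ) 1 := fun n => by
    rw [← M.left_zero, ← M.right_zero]
    exact ⟨M.left_strictMono n.succ_pos, M.left_lt_right _ _⟩
  let p : ℕ → Icc (0 : ℝ) 1 := fun n => ⟨M.left (n + 1), Ioo_subset_Icc_self (hmem n)⟩
  have h1 : ∀ x ∈ M.cell (.C 0), ∀ y ∈ M.cell (.C 0),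
      |(ψ y : EReal).toReal - (ψ x : EReal).toReal| ≤
        |(ψ (p 1) : EReal).toReal - (ψ (p 0) : EReal).toReal| := fun x hx y hy =>
    abs_toReal_sub_le_of_mem_Icc (hmem 0) (hmem 1) ⟨hx.1.le, hx.2.le⟩ ⟨hy.1.le, hy.2.le⟩
  have h2 := abs_toReal_sub_le_of_conj hg hl hψ (M.ordConnected_cell _)
    (fun x hx => M.mem_Ioo_of_mem_cell hx) (fun x hx => M.f_mem_Ioo hx) h1
  have h3 : ∀ x ∈ M.cell .D, ∀ y ∈ M.cell .D, |(ψ y : EReal).toReal - (ψ x : EReal).toReal| ≤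
      |l| * |(ψ (p 1) : EReal).toReal - (ψ (p 0) : EReal).toReal| := by
    intro x hx y hy
    obtain ⟨x', hx', rfl⟩ := M.exists_preimage (X := Cell.C 0) (Y := Cell.D) rfl hx
    obtain ⟨y', hy', rfl⟩ := M.exists_preimage (X := Cell.C 0) (Y := Cell.D) rfl hy
    exact h2 x' hx' y' hy'
  have h4 := abs_toReal_sub_le_of_conj hg hl hψ (M.ordConnected_cell _)
    (fun x hx => M.mem_Ioo_of_mem_cell hx) (fun x hx => M.f_mem_Ioo hx) h3
  obtain ⟨x, hx, hlt⟩ := exists_lt_abs_sub_of_eq_bot_or_eq_top (ψ := ψ) hab (w := p 0) (hmem 0)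
    (|l| * (|l| * |(ψ (p 1) : EReal).toReal - (ψ (p 0) : EReal).toReal|))
  obtain ⟨x', hx', hfx⟩ := M.image_cell_D hx
  obtain ⟨w', hw', hfw⟩ := M.image_cell_D (x := p 0) (hmem 0)
  have := h4 w' hw' x' hx'
  rw [hfx, hfw] at this
  linarith

end Model

/-! ### The main theorem -/

theorem mainTheorem4 :
    ∃ lmin : ℝ, (∀ x : ℝ, x ^ 3 - 2 * x ^ 2 - x - 2 = 0 ↔ x = lmin) ∧
    ∃ (f : Icc (0 : ℝ) 1 → Icc (0 : ℝ) 1) (P : Set (Icc (0 : ℝ) 1))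
      (K : Cell → Set (Icc (0 : ℝ) 1)),
      IsExampleMap lmin f P K ∧
      IsCPMM f P ∧
      IsTopMixing f ∧
      (∀ (l : ℝ) (v : BasicInterval P → ℝ),
        IsNonnegEigenvector (transitionMatrix f P) l v → Summable v) ∧
      (∀ l : ℝ, (∃ v : BasicInterval P → ℝ,
        IsNonnegEigenvector (transitionMatrix f P) l v) ↔ lmin ≤ l) ∧
      (∀ l : ℝ, lmin ≤ l →
        ∃ (g : Icc (0 : ℝ) 1 → Icc (0 : ℝ) 1) (Q : Set (Icc (0 : ℝ) 1)),
          IsCPMM g Q ∧ HasConstantSlope g Q l ∧ IsConjugateTo f g) ∧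
      (∀ (a b : EReal) (g : Icc a b → Icc a b) (Q : Set (Icc a b)) (l : ℝ),
        (a = ⊥ ∨ b = ⊤) → IsCPMM g Q → HasConstantSlopeExt g Q l → ¬ IsConjugateTo f g) ∧
      Dynamics.coverEntropy f univ = ((Real.log lmin : ℝ) : EReal) ∧
      HasPerronValue (transitionMatrix f P) (ENNReal.ofReal lmin) ∧
      IsStronglyPositiveRecurrent (transitionMatrix f P) := by
  obtain ⟨lmin, h⟩ := exists_root
  let M := Model.ofSlope lmin h.ge
  refine ⟨lmin, poly_eq_zero_iff h, M.f, M.part, M.cell, Model.ofSlope_isExampleMap h, M.isCPMM,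
    M.isTopMixing, fun l v hv => M.summable_eigenvector hv, M.exists_eigenvector_iff h,
    fun l hl => ?_, fun a b g Q l hab hg hl => M.not_isConjugateTo_of_eq_bot_or_eq_top hab hg hl,
    M.coverEntropy_eq h, M.hasPerronValue h, M.isStronglyPositiveRecurrent⟩
  let N := Model.ofSlope l (poly_nonneg_of_le h hl)
  exact ⟨N.f, N.part, N.isCPMM, N.hasConstantSlope, M.isConjugateTo N⟩
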